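/- Let $B$ be a definite quaternion algebra over $\mathbb{Q}$ whose discriminant $N$ (the product of the primes at which $B$ ramifies) is odd, and let $\mathcal{O}$ be a maximal order of $B$. Let $\mathrm{Cl}(\mathcal{O})$ be the set of classes $[I]$ of invertible right $\mathcal{O}$-ideals in $B$, where $I \sim bI$ for $b \in B^\times$. The Picard group $\mathrm{Pic}(\mathcal{O})$ of invertible two-sided $\mathcal{O}$-ideals modulo $\mathbb{Q}^\times$ acts on $\mathrm{Cl}(\mathcal{O})$ by right multiplication. For a prime $p \mid N$ let $\mathfrak{P}_p$ be the two-sided prime ideal of $\mathcal{O}$ of norm $p$ (so $\mathfrak{P}_p^2 = p\mathcal{O}$), and let $\sigma_p([I]) = [I\,\mathfrak{P}_p]$, an involution of $\mathrm{Cl}(\mathcal{O})$. A sign pattern for $N$ is a multiplicative function $d \mapsto \varepsilon_d$ from the divisors of $N$ to $\{\pm 1\}$ (that is, $\varepsilon_{ab} = \varepsilon_a \varepsilon_b$ for coprime $a, b$ with $ab \mid N$); $+_N$ denotes the sign pattern that is identically $1$. Given a sign pattern $\varepsilon$, let $\Sigma^\varepsilon$ be the signed multigraph on $\mathrm{Cl}(\mathcal{O})$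 which has, for each prime $p \mid N$ and each orbit $\{x, \sigma_p(x)\}$ of $\sigma_p$, an edge (possibly a loop) of sign $\varepsilon_p$ between $x$ and $\sigma_p(x)$. The parity of a path is the product of the signs of its edges. An orbit of $\mathrm{Pic}(\mathcal{O})$ on $\mathrm{Cl}(\mathcal{O})$ is called $\varepsilon$-admissible if no closed path of $\Sigma^\varepsilon$ in it (repeated vertices and edges allowed) has parity $-1$. A class $x \in \mathrm{Cl}(\mathcal{O})$ is a trivial zero for $\varepsilon$ if its orbit is not $\varepsilon$-admissible. Denote by $\Delta_d$ the discriminant of $\mathbb{Q}(\sqrt{-d})$, and let $S$ be the set of divisors $d > 1$ of $N$ such that $\left(\frac{\Delta_d}{p}\right) = -1$ for all primes $p \mid \frac{N}{d}$. Let $\varepsilon \neq +_N$ be a sign pattern for $N$. Then $\varepsilon$ has no trivial zeroes if and only if both of the following conditions hold: (i) $\varepsilon_d = 1$ for all $d \in S$; and (ii) if $3 \mid N$, then $\varepsilon_3 = 1$ or $N$ is divisible by some prime $p \equiv 1 \pmod 3$. -/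

import Mathlib

open scoped Quaternion TensorProduct

namespace BrandtZeroes

/-! ### Quaternion algebras over the rationals -/

/-- `B` is a quaternion algebra over the field `K` (of characteristic different from 2): it has a
basis `1, i, j, ij` with `i² = a`, `j² = b`, `ji = -ij` for some nonzero `a, b` in `K`. -/
def IsQuaternionAlgebra (K B : Type*) [Field K] [Ring B] [Algebra K B] : Prop :=
  ∃ a b : K, a ≠ 0 ∧ b ≠ 0 ∧ Nonempty (B ≃ₐ[K] ℍ[K, a, b])

/-- The base change of `B` to the field `K ⊇ ℚ` is a division algebra. For a quaternion algebra
`B`, a completion `K` of `ℚ`, this says that `B` is ramified at the corresponding place. -/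
def IsRamifiedOver (K B : Type*) [Field K] [Algebra ℚ K] [Ring B] [Algebra ℚ B] : Prop :=
  ∀ x : K ⊗[ℚ] B, x ≠ 0 → IsUnit x

/-- `B` is definite: ramified at the real place. -/
def IsDefinite (B : Type*) [Ring B] [Algebra ℚ B] : Prop :=
  IsRamifiedOver ℝ B

/-- `N` is the discriminant of `B`: the product of the (distinct) finite primes at which `B` is
ramified. -/
def HasDiscriminant (B : Type*) [Ring B] [Algebra ℚ B] (N : ℕ) : Prop :=
  Squarefree N ∧ ∀ (p : ℕ) [Fact p.Prime], p ∣ N ↔ IsRamifiedOver ℚ_[p] B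

variable {B : Type*} [Ring B] [Algebra ℚ B]

/-- `O` is an order of `B`: a subring that is a full `ℤ`-lattice. -/
def IsOrder (O : Subalgebra ℤ B) : Prop :=
  Submodule.IsLattice ℚ (Subalgebra.toSubmodule O)

/-- `O` is a maximal order of `B` with respect to inclusion. -/
def IsMaximalOrder (O : Subalgebra ℤ B) : Prop :=
  Maximal IsOrder O

/-! ### Ideals and ideal classes -/

/-- The left order `{x ∈ B : x I ⊆ I}` of `I`. -/
def leftOrder (I : Submodule ℤ B) : Submodule ℤ B where
  carrier := {x | ∀ y ∈ I, x * y ∈ I}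
  add_mem' := fun ha hb y hy => by rw [add_mul]; exact I.add_mem (ha y hy) (hb y hy)
  zero_mem' := fun y _ => by rw [zero_mul]; exact I.zero_mem
  smul_mem' := fun c x hx y hy => by rw [smul_mul_assoc]; exact I.smul_mem c (hx y hy)

/-- Invertible (fractional) right `O`-ideals: full lattices `I` in `B` with `I O = I` that have an
inverse lattice `J`, i.e. `J I = O` and `I J` is the left order of `I`. Here products of lattices
are the lattices generated by the products of their elements. -/
structure InvRightIdeal (O : Subalgebra ℤ B) where
  carrier : Submodule ℤ B
  isLattice : Submodule.IsLattice ℚ carrier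
  mul_right : carrier * Subalgebra.toSubmodule O = carrier
  exists_inv : ∃ J : Submodule ℤ B, Submodule.IsLattice ℚ J ∧
    J * carrier = Subalgebra.toSubmodule O ∧ carrier * J = leftOrder carrier

/-- Invertible (fractional) two-sided `O`-ideals. -/
structure InvTwoSidedIdeal (O : Subalgebra ℤ B) where
  carrier : Submodule ℤ B
  isLattice : Submodule.IsLattice ℚ carrier
  mul_right : carrier * Subalgebra.toSubmodule O = carrier
  mul_left : Subalgebra.toSubmodule O * carrier = carrier
  exists_inv : ∃ J : Submodule ℤ B, Submodule.IsLattice ℚ J ∧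
    J * carrier = Subalgebra.toSubmodule O ∧ carrier * J = Subalgebra.toSubmodule O

/-- A product of full lattices is a full lattice. -/
theorem isLattice_mul {I J : Submodule ℤ B} (hI : Submodule.IsLattice ℚ I)
    (hJ : Submodule.IsLattice ℚ J) : Submodule.IsLattice ℚ (I * J) where
  fg := hI.fg.mul hJ.fg
  span_eq_top := by
    have key : ∀ x ∈ I, ∀ y : B, x * y ∈ Submodule.span ℚ ((I * J : Submodule ℤ B) : Set B) := by
      intro x hx y
      have hy : y ∈ Submodule.span ℚ (J : Set B) := by rw [hJ.span_eq_top]; trivial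
      induction hy using Submodule.span_induction with
      | mem y hy => exact Submodule.subset_span (Submodule.mul_mem_mul hx hy)
      | zero => rw [mul_zero]; exact Submodule.zero_mem _
      | add a b _ _ ha hb => rw [mul_add]; exact Submodule.add_mem _ ha hb
      | smul c a _ ha => rw [mul_smul_comm]; exact Submodule.smul_mem _ c ha
    rw [eq_top_iff, ← hI.span_eq_top, Submodule.span_le]
    intro x hx
    simpa using key x hx 1

variable {O : Subalgebra ℤ B}

/-- The product `I P` of an invertible right ideal and an invertible two-sided ideal. -/
def InvRightIdeal.mul (I : InvRightIdeal O) (P : InvTwoSidedIdeal O) : InvRightIdeal O where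
  carrier := I.carrier * P.carrier
  isLattice := isLattice_mul I.isLattice P.isLattice
  mul_right := by rw [mul_assoc, P.mul_right]
  exists_inv := by
    obtain ⟨J, hJ, hJI, hIJ⟩ := I.exists_inv
    obtain ⟨Q, hQ, hQP, hPQ⟩ := P.exists_inv
    refine ⟨Q * J, isLattice_mul hQ hJ, ?_, ?_⟩
    · rw [mul_assoc, ← mul_assoc J, hJI, P.mul_left, hQP]
    · rw [mul_assoc, ← mul_assoc P.carrier, hPQ, ← mul_assoc, I.mul_right, hIJ]
      apply le_antisymm
      · intro x hx y hy
        induction hy using Submodule.mul_induction_on' with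
        | mem_mul_mem a ha b hb =>
          rw [← mul_assoc]; exact Submodule.mul_mem_mul (hx a ha) hb
        | add a _ b _ ha hb => rw [mul_add]; exact Submodule.add_mem _ ha hb
      · intro x hx y hy
        have h1 : y ∈ I.carrier * P.carrier * Q := by
          rw [mul_assoc, hPQ, I.mul_right]; exact hy
        clear hy
        have h2 : x * y ∈ I.carrier * P.carrier * Q := by
          induction h1 using Submodule.mul_induction_on' with
          | mem_mul_mem a ha b hb =>
            rw [← mul_assoc]; exact Submodule.mul_mem_mul (hx a ha) hb
          | add a _ b _ ha hb => rw [mul_add]; exact Submodule.add_mem _ ha hb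
        rwa [mul_assoc, hPQ, I.mul_right] at h2

/-- Two invertible right ideals are equivalent if `J = b I` for some `b ∈ Bˣ`. -/
instance rightIdealSetoid (O : Subalgebra ℤ B) : Setoid (InvRightIdeal O) where
  r I J := ∃ b : Bˣ, J.carrier = Submodule.span ℤ {(b : B)} * I.carrier
  iseqv :=
    { refl := fun I => ⟨1, by rw [Units.val_one, ← Submodule.one_eq_span, one_mul]⟩
      symm := by
        rintro I J ⟨b, h⟩
        refine ⟨b⁻¹, ?_⟩
        rw [h, ← mul_assoc, Submodule.span_mul_span, Set.singleton_mul_singleton, Units.inv_mul,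
          ← Submodule.one_eq_span, one_mul]
      trans := by
        rintro I J L ⟨b, h⟩ ⟨c, h'⟩
        refine ⟨c * b, ?_⟩
        rw [h', h, ← mul_assoc, Submodule.span_mul_span, Set.singleton_mul_singleton,
          Units.val_mul] }

/-- `Cl(O)`: the set of classes of invertible right `O`-ideals. -/
def RightClassSet (O : Subalgebra ℤ B) : Type _ := Quotient (rightIdealSetoid O)

/-- Right multiplication `[I] ↦ [I P]` of a right ideal class by an invertible two-sided ideal. -/
def RightClassSet.mul (x : RightClassSet O) (P : InvTwoSidedIdeal O) : RightClassSet O :=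
  Quotient.map (fun I : InvRightIdeal O => I.mul P)
    (by
      rintro I J ⟨b, h⟩
      refine ⟨b, ?_⟩
      change J.carrier * P.carrier = _ * (I.carrier * P.carrier)
      rw [h, mul_assoc]) x

/-- The orbit of `x ∈ Cl(O)` under right multiplication by all invertible two-sided ideals, i.e.
under the action of `Pic(O)`. -/
def picOrbit (x : RightClassSet O) : Set (RightClassSet O) :=
  Set.range fun P : InvTwoSidedIdeal O => x.mul P

/-- `P` is the two-sided prime ideal `𝔓_p` of norm `p` of the maximal order `O`, for a prime `p`
at which `B` is ramified: the (unique) invertible two-sided ideal with `P² = p O`. Adelically it is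
generated by a uniformizer `ϖ_p` of `O_p`, which may be chosen with `ϖ_p² = p`. -/
def IsPrimeAbove (p : ℕ) (P : InvTwoSidedIdeal O) : Prop :=
  P.carrier * P.carrier = Submodule.span ℤ {(p : B)} * Subalgebra.toSubmodule O

/-! ### Sign patterns, the signed graph, and trivial zeroes -/

/-- A sign pattern for `N`: a multiplicative function from the divisors of `N` to `{±1}`. -/
@[ext]
structure SignPattern (N : ℕ) where
  toFun : {d : ℕ // d ∣ N} → ℤˣ
  map_mul : ∀ a b c : {d : ℕ // d ∣ N}, a.1.Coprime b.1 → c.1 = a.1 * b.1 →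
    toFun c = toFun a * toFun b

instance (N : ℕ) : CoeFun (SignPattern N) fun _ => {d : ℕ // d ∣ N} → ℤˣ :=
  ⟨SignPattern.toFun⟩

/-- The sign pattern `+_N`, equal to `1` at all divisors of `N`. -/
def SignPattern.plus (N : ℕ) : SignPattern N where
  toFun := fun _ => 1
  map_mul := fun _ _ _ _ _ => (mul_one 1).symm

/-- The signed multigraph `Σ^ε` on `Cl(O)` has, for every prime `p ∣ N`, an edge of sign `ε_p`
between `x` and `σ_p(x) = x 𝔓_p` (a loop if these coincide). `SignedPath ε x y s` says that there
is a path of parity `s` from `x` to `y` in `Σ^ε`, the parity being the product of the signs of the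
edges. -/
inductive SignedPath {N : ℕ} (ε : SignPattern N) :
    RightClassSet O → RightClassSet O → ℤˣ → Prop
  | nil (x : RightClassSet O) : SignedPath ε x x 1
  | cons {p : ℕ} (hp : p.Prime) (hpN : p ∣ N) (P : InvTwoSidedIdeal O) (hP : IsPrimeAbove p P)
      (x : RightClassSet O) {z : RightClassSet O} {s : ℤˣ} (h : SignedPath ε (x.mul P) z s) :
      SignedPath ε x z (ε ⟨p, hpN⟩ * s)

/-- An orbit `X` is `ε`-admissible if no closed path of `Σ^ε` in `X` has parity `-1`. (A path that
starts in an orbit stays in it.) -/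
def IsAdmissible {N : ℕ} (ε : SignPattern N) (X : Set (RightClassSet O)) : Prop :=
  ∀ x ∈ X, ¬ SignedPath ε x x (-1)

/-- `x ∈ Cl(O)` is a trivial zero for `ε` if its orbit is not `ε`-admissible. -/
def IsTrivialZero {N : ℕ} (ε : SignPattern N) (x : RightClassSet O) : Prop :=
  ¬ IsAdmissible ε (picOrbit x)

/-- `ε` has no trivial zeroes on `Cl(O)`. -/
def HasNoTrivialZeroes {N : ℕ} (O : Subalgebra ℤ B) (ε : SignPattern N) : Prop :=
  ∀ x : RightClassSet O, ¬ IsTrivialZero ε x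

/-! ### Discriminants of imaginary quadratic fields -/

/-- `ℚ(√-d)`, as a subfield of `ℂ`. -/
noncomputable abbrev QuadField (d : ℕ) : IntermediateField ℚ ℂ :=
  IntermediateField.adjoin ℚ {(Real.sqrt d : ℂ) * Complex.I}

instance (d : ℕ) : NumberField (QuadField d) where
  to_charZero := inferInstance
  to_finiteDimensional := by
    apply IntermediateField.adjoin.finiteDimensional
    refine ⟨Polynomial.X ^ 2 + Polynomial.C (d : ℚ), Polynomial.monic_X_pow_add_C _ two_ne_zero, ?_⟩
    have h : ((Real.sqrt d : ℝ) : ℂ) ^ 2 = d := by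
      rw [← Complex.ofReal_pow, Real.sq_sqrt (Nat.cast_nonneg d), Complex.ofReal_natCast]
    simp [mul_pow, h]

/-- `Δ_d`: the discriminant of `ℚ(√-d)`. -/
noncomputable def quadDisc (d : ℕ) : ℤ :=
  NumberField.discr (QuadField d)

/-- The set of divisors `d > 1` of `N` such that `(Δ_d / p) = -1` for every prime `p ∣ N / d`. -/
def inertDivisors (N : ℕ) : Set ℕ :=
  {d | d ∣ N ∧ 1 < d ∧ ∀ (p : ℕ) [Fact p.Prime], p ∣ N / d → legendreSym p (quadDisc d) = -1}

end BrandtZeroes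

namespace BrandtZeroes
open scoped NumberTheorySymbols

/-! ### Hilbert symbols of integers -/

/-! The prime ideals 𝔓_p commute, so a closed path of parity -1 at a class [I] yields an equation c
I = I Q, where Q is a product of such ideals, Q² = m² d O, d ∣ N and ε_d = -1. Then c² I = m² d I,
so c²/(m² d) is a unit of the left order of I; it has norm 1 and integral trace. Hence nrd c = m² d
and (trd c)² = m² d k with an integer 0 ≤ k ≤ 4, so d k is a rational square. As d > 1 is odd and
squarefree, k is 0 or 3, and in both cases a rational multiple of 2 c - trd c is a square root of -d
(`exists_mul_self_eq_of_closedPath`).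

Conversely, let b² = -d in B with d ∣ N. Put b into a maximal order O' and let L = O' O. The ideal Q
with Q² = d O consists of the elements of O with norm divisible by d (`mem_iff_of_mul_self_eq`), and
nrd b = d, so b L = L Q: the path given by Q is closed at [L] and has parity ε_d
(`exists_isTrivialZero`).

So trivial zeroes exist if and only if some ℚ(√-d) with d ∣ N and ε_d = -1 embeds in B, that is, if
-d is a nonsquare in ℚ_p for all p ∣ N. At p ∣ d this is automatic; at p ∣ N/d it says (Δ_d/p) = -1.
These d form S, which is condition (i); condition (ii) follows from (i), since 3 ∈ S if 3 ∣ N and no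
prime p ≡ 1 mod 3 divides N.

Necessity of the local condition holds because B is a division algebra at p. Sufficiency
(`exists_mul_self_eq`) is a local-global principle proved with Hilbert symbols of integers:
quadratic reciprocity gives the product formula, Legendre's descent gives global zeros of ternary
forms, and Dirichlet's theorem gives s < 0 such that (s, a) and (s, -d) agree with B = (a, b),
whence B ≅ (a, s) ≅ (-d, s).

The ideal theory is done globally: a ring containing O with integral traces is O, and at ramified
primes integrality of the norm is closed under addition. Invertibility of lattices comes from a
nilpotence argument modulo p (`one_mem_of_prime_mem`). -/

/-- The prime-to-`p` part of a nonzero integer. -/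
def unitPart (p : ℕ) (a : ℤ) : ℤ := a / (p : ℤ) ^ padicValInt p a

theorem pow_mul_unitPart (p : ℕ) (a : ℤ) : (p : ℤ) ^ padicValInt p a * unitPart p a = a :=
  Int.mul_ediv_cancel' (padicValInt_dvd a)

theorem not_dvd_unitPart {p : ℕ} (hp : p.Prime) {a : ℤ} (ha : a ≠ 0) : ¬ (p : ℤ) ∣ unitPart p a := by
  have := Fact.mk hp
  rintro ⟨c, hc⟩
  have h := pow_mul_unitPart p a
  rw [hc, ← mul_assoc, ← pow_succ] at h
  have h1 : (p : ℤ) ^ (padicValInt p a + 1) ∣ a := ⟨c, h.symm⟩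
  rw [padicValInt_dvd_iff] at h1
  omega

theorem exists_eq_pow_mul {p : ℕ} (hp : p.Prime) {a : ℤ} (ha : a ≠ 0) :
    ∃ (k : ℕ) (u : ℤ), ¬ (p : ℤ) ∣ u ∧ a = (p : ℤ) ^ k * u :=
  ⟨_, _, not_dvd_unitPart hp ha, (pow_mul_unitPart p a).symm⟩

theorem padicValInt_pow_mul {p : ℕ} (hp : p.Prime) (k : ℕ) {u : ℤ} (hu : ¬ (p : ℤ) ∣ u) :
    padicValInt p ((p : ℤ) ^ k * u) = k := by
  have := Fact.mk hp
  have hu0 : u ≠ 0 := by rintro rfl; exact hu (dvd_zero _)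
  have hp0 : (p : ℤ) ≠ 0 := by exact_mod_cast hp.ne_zero
  rw [padicValInt.mul (pow_ne_zero _ hp0) hu0, padicValInt.eq_zero_of_not_dvd hu, add_zero,
    padicValInt, Int.natAbs_pow, Int.natAbs_natCast, padicValNat.prime_pow]

theorem unitPart_pow_mul {p : ℕ} (hp : p.Prime) (k : ℕ) {u : ℤ} (hu : ¬ (p : ℤ) ∣ u) :
    unitPart p ((p : ℤ) ^ k * u) = u := by
  have hp0 : (p : ℤ) ≠ 0 := by exact_mod_cast hp.ne_zero
  rw [unitPart, padicValInt_pow_mul hp k hu, Int.mul_ediv_cancel_left _ (pow_ne_zero _ hp0)]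

theorem unitPart_of_not_dvd {p : ℕ} {u : ℤ} (hu : ¬ (p : ℤ) ∣ u) : unitPart p u = u := by
  rw [unitPart, padicValInt.eq_zero_of_not_dvd hu, pow_zero, Int.ediv_one]

theorem not_dvd_mul {p : ℕ} (hp : p.Prime) {a b : ℤ} (ha : ¬ (p : ℤ) ∣ a) (hb : ¬ (p : ℤ) ∣ b) :
    ¬ (p : ℤ) ∣ a * b := fun h =>
  ((Nat.prime_iff_prime_int.mp hp).dvd_or_dvd h).elim ha hb

theorem unitPart_mul {p : ℕ} (hp : p.Prime) {a b : ℤ} (ha : a ≠ 0) (hb : b ≠ 0) :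
    unitPart p (a * b) = unitPart p a * unitPart p b := by
  have : a * b = (p : ℤ) ^ (padicValInt p a + padicValInt p b) * (unitPart p a * unitPart p b) := by
    rw [pow_add, mul_mul_mul_comm, pow_mul_unitPart, pow_mul_unitPart]
  rw [this]
  exact unitPart_pow_mul hp _ (not_dvd_mul hp (not_dvd_unitPart hp ha) (not_dvd_unitPart hp hb))

/-- The Hilbert symbol of two nonzero integers at an odd prime `p`. -/
def hilb (p : ℕ) (a b : ℤ) : ℤ :=
  J(-1 | p) ^ (padicValInt p a * padicValInt p b) * J(unitPart p a | p) ^ padicValInt p b *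
    J(unitPart p b | p) ^ padicValInt p a

theorem hilb_comm (p : ℕ) (a b : ℤ) : hilb p a b = hilb p b a := by
  unfold hilb; rw [mul_comm (padicValInt p a)]; ring

theorem hilb_mul_left {p : ℕ} (hp : p.Prime) {a a' : ℤ} (ha : a ≠ 0) (ha' : a' ≠ 0) (b : ℤ) :
    hilb p (a * a') b = hilb p a b * hilb p a' b := by
  have := Fact.mk hp
  unfold hilb
  rw [padicValInt.mul ha ha', unitPart_mul hp ha ha', jacobiSym.mul_left]
  ring

theorem hilb_mul_right {p : ℕ} (hp : p.Prime) {b b' : ℤ} (a : ℤ) (hb : b ≠ 0) (hb' : b' ≠ 0) :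
    hilb p a (b * b') = hilb p a b * hilb p a b' := by
  rw [hilb_comm, hilb_mul_left hp hb hb', hilb_comm p b, hilb_comm p b']

theorem hilb_pow_mul {p : ℕ} (hp : p.Prime) (k l : ℕ) {u w : ℤ} (hu : ¬ (p : ℤ) ∣ u)
    (hw : ¬ (p : ℤ) ∣ w) : hilb p ((p : ℤ) ^ k * u) ((p : ℤ) ^ l * w) =
      J(-1 | p) ^ (k * l) * J(u | p) ^ l * J(w | p) ^ k := by
  rw [hilb, padicValInt_pow_mul hp k hu, padicValInt_pow_mul hp l hw, unitPart_pow_mul hp k hu,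
    unitPart_pow_mul hp l hw]

theorem hilb_eq_one_of_not_dvd {p : ℕ} {a b : ℤ} (ha : ¬ (p : ℤ) ∣ a)
    (hb : ¬ (p : ℤ) ∣ b) : hilb p a b = 1 := by
  simp [hilb, padicValInt.eq_zero_of_not_dvd ha, padicValInt.eq_zero_of_not_dvd hb]

theorem jacobiSym_eq_or {p : ℕ} (hp : p.Prime) {u : ℤ} (hu : ¬ (p : ℤ) ∣ u) :
    J(u | p) = 1 ∨ J(u | p) = -1 := by
  apply jacobiSym.eq_one_or_neg_one
  rw [Int.gcd_comm]
  exact (Nat.Prime.coprime_iff_not_dvd hp).2 (fun h => hu (by simpa using Int.natCast_dvd.2 h))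

theorem not_dvd_neg_one {p : ℕ} (hp : p.Prime) : ¬ (p : ℤ) ∣ -1 := by
  rw [dvd_neg, Int.natCast_dvd]; simpa using hp.one_lt.ne'

theorem hilb_eq_or {p : ℕ} (hp : p.Prime) {a b : ℤ} (ha : a ≠ 0) (hb : b ≠ 0) :
    hilb p a b = 1 ∨ hilb p a b = -1 := by
  unfold hilb
  have key : ∀ (x : ℤ) (n : ℕ), (x = 1 ∨ x = -1) → (x ^ n = 1 ∨ x ^ n = -1) := by
    rintro x n (rfl | rfl)
    · simp
    · exact neg_one_pow_eq_or ℤ n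
  rcases key _ (padicValInt p a * padicValInt p b) (jacobiSym_eq_or hp (not_dvd_neg_one hp)) with h1 | h1 <;>
  rcases key _ (padicValInt p b) (jacobiSym_eq_or hp (not_dvd_unitPart hp ha)) with h2 | h2 <;>
  rcases key _ (padicValInt p a) (jacobiSym_eq_or hp (not_dvd_unitPart hp hb)) with h3 | h3 <;>
  rw [h1, h2, h3] <;> simp

theorem hilb_sq_left {p : ℕ} (hp : p.Prime) {a b : ℤ} (ha : a ≠ 0) (hb : b ≠ 0) :
    hilb p (a * a) b = 1 := by
  rw [hilb_mul_left hp ha ha]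
  rcases hilb_eq_or hp ha hb with h | h <;> rw [h] <;> rfl

theorem hilb_mul_self_left {p : ℕ} (hp : p.Prime) {a b c : ℤ} (ha : a ≠ 0) (hb : b ≠ 0)
    (hc : c ≠ 0) : hilb p (c * c * a) b = hilb p a b := by
  rw [hilb_mul_left hp (mul_ne_zero hc hc) ha, hilb_sq_left hp hc hb, one_mul]

theorem hilb_neg_self {p : ℕ} (hp : p.Prime) {a : ℤ} (ha : a ≠ 0) : hilb p a (-a) = 1 := by
  obtain ⟨k, u, hu, rfl⟩ := exists_eq_pow_mul hp ha
  rw [← mul_neg, hilb_pow_mul hp k k hu (by rwa [dvd_neg]), ← neg_one_mul u, jacobiSym.mul_left]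
  have h1 := jacobiSym_eq_or hp hu
  have h2 := jacobiSym_eq_or hp (not_dvd_neg_one hp)
  -- What remains is J(-1 | p)^(k² + k) J(u | p)^(2k), and k² + k is even.
  rcases Nat.even_or_odd k with hk | hk
  · rw [pow_mul]
    rcases h1 with h1 | h1 <;> rcases h2 with h2 | h2 <;> simp [h1, h2, hk.neg_one_pow]
  · rw [pow_mul]
    rcases h1 with h1 | h1 <;> rcases h2 with h2 | h2 <;> simp [h1, h2, hk.neg_one_pow]

/-- The Hilbert symbol of two nonzero integers at the prime `2`. -/
def hilbTwo (a b : ℤ) : ℤ :=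
  (if unitPart 2 a % 4 = 3 ∧ unitPart 2 b % 4 = 3 then -1 else 1) *
    ZMod.χ₈ (unitPart 2 a) ^ padicValInt 2 b * ZMod.χ₈ (unitPart 2 b) ^ padicValInt 2 a

theorem hilbTwo_comm (a b : ℤ) : hilbTwo a b = hilbTwo b a := by
  simp only [hilbTwo, and_comm (a := unitPart 2 a % 4 = 3)]; ring

theorem hilbTwo_mul_left {a a' b : ℤ} (ha : a ≠ 0) (ha' : a' ≠ 0) :
    hilbTwo (a * a') b = hilbTwo a b * hilbTwo a' b := by
  unfold hilbTwo
  rw [padicValInt.mul ha ha', unitPart_mul Nat.prime_two ha ha', Int.cast_mul, map_mul]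
  have h1 := not_dvd_unitPart Nat.prime_two ha
  have h2 := not_dvd_unitPart Nat.prime_two ha'
  generalize unitPart 2 a = x at *
  generalize unitPart 2 a' = y at *
  generalize unitPart 2 b = z at *
  have key : (if x * y % 4 = 3 ∧ z % 4 = 3 then (-1 : ℤ) else 1) =
      (if x % 4 = 3 ∧ z % 4 = 3 then -1 else 1) * (if y % 4 = 3 ∧ z % 4 = 3 then -1 else 1) := by
    have hx : x % 4 = 1 ∨ x % 4 = 3 := by push_cast at h1; omega
    have hy : y % 4 = 1 ∨ y % 4 = 3 := by push_cast at h2; omega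
    by_cases hz : z % 4 = 3 <;> rcases hx with hx | hx <;> rcases hy with hy | hy <;>
      simp [Int.mul_emod, hx, hy, hz]
  rw [key]
  ring

theorem hilbTwo_mul_right {a b b' : ℤ} (hb : b ≠ 0) (hb' : b' ≠ 0) :
    hilbTwo a (b * b') = hilbTwo a b * hilbTwo a b' := by
  rw [hilbTwo_comm, hilbTwo_mul_left hb hb', hilbTwo_comm b, hilbTwo_comm b']

theorem hilbTwo_pow_mul (k l : ℕ) {u w : ℤ} (hu : ¬ (2 : ℤ) ∣ u) (hw : ¬ (2 : ℤ) ∣ w) :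
    hilbTwo (2 ^ k * u) (2 ^ l * w) =
      (if u % 4 = 3 ∧ w % 4 = 3 then -1 else 1) * ZMod.χ₈ u ^ l * ZMod.χ₈ w ^ k := by
  have h1 := padicValInt_pow_mul Nat.prime_two k (u := u) (by exact_mod_cast hu)
  have h2 := padicValInt_pow_mul Nat.prime_two l (u := w) (by exact_mod_cast hw)
  have h3 := unitPart_pow_mul Nat.prime_two k (u := u) (by exact_mod_cast hu)
  have h4 := unitPart_pow_mul Nat.prime_two l (u := w) (by exact_mod_cast hw)
  push_cast at h1 h2 h3 h4
  rw [hilbTwo, h1, h2, h3, h4]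

theorem hilbTwo_eq_one_of_one_mod_eight {s : ℤ} (hs : s % 8 = 1) (a : ℤ) : hilbTwo s a = 1 := by
  have h1 : ¬ ((2 : ℕ) : ℤ) ∣ s := by push_cast; omega
  have h2 : (s : ZMod 8) = 1 := by
    have := (ZMod.intCast_eq_intCast_iff s 1 8).2 hs
    simpa using this
  rw [hilbTwo, unitPart_of_not_dvd h1, padicValInt.eq_zero_of_not_dvd h1, h2, if_neg (by omega)]
  simp

end BrandtZeroes

/-! ### Local isotropy of z² = a x² + b y² and the Hilbert symbol -/

namespace BrandtZeroes
open scoped NumberTheorySymbols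

/-- The ternary form `z² - a x² - b y²` is isotropic over `K`. -/
def IsIsotropic (K : Type*) [Field K] (a b : K) : Prop :=
  ∃ x y z : K, (x ≠ 0 ∨ y ≠ 0 ∨ z ≠ 0) ∧ z ^ 2 = a * x ^ 2 + b * y ^ 2

section Field
variable {K : Type*} [Field K] {a b : K}

theorem IsIsotropic.symm (h : IsIsotropic K a b) : IsIsotropic K b a := by
  obtain ⟨x, y, z, h0, h⟩ := h
  exact ⟨y, x, z, by tauto, by rw [h, add_comm]⟩

theorem IsIsotropic.of_mul_self {c : K} (hc : c ≠ 0) (h : IsIsotropic K (c * c * a) b) :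
    IsIsotropic K a b := by
  obtain ⟨x, y, z, h0, h⟩ := h
  refine ⟨c * x, y, z, ?_, by rw [h]; ring⟩
  simpa [hc] using h0

theorem IsIsotropic.mul_self {c : K} (hc : c ≠ 0) (h : IsIsotropic K a b) :
    IsIsotropic K (c * c * a) b := by
  obtain ⟨x, y, z, h0, h⟩ := h
  refine ⟨x / c, y, z, ?_, by rw [h]; field_simp⟩
  simpa [hc] using h0

/-- Multiplying z² - a x² = b y² by -a gives (a x)² - a z² = -a b y². Trading b for -a b lowers the
valuation when p divides both entries exactly once. -/
theorem IsIsotropic.neg_mul (ha : a ≠ 0) (h : IsIsotropic K a b) :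
    IsIsotropic K a (-(a * b)) := by
  obtain ⟨x, y, z, h0, h⟩ := h
  refine ⟨z, y, a * x, ?_, by rw [h]; ring⟩
  simp only [ne_eq, mul_eq_zero, ha, false_or]
  tauto

theorem IsIsotropic.of_neg_mul (ha : a ≠ 0) (h : IsIsotropic K a (-(a * b))) :
    IsIsotropic K a b := by
  have := (h.neg_mul ha).symm
  rw [show -(a * -(a * b)) = a * a * b by ring] at this
  exact (this.of_mul_self ha).symm

theorem isIsotropic_of_isSquare (h : IsSquare a) : IsIsotropic K a b := by
  obtain ⟨c, rfl⟩ := h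
  exact ⟨1, 0, c, by simp, by ring⟩

end Field

/-- Every nonzero integer is a square times an integer of valuation at most one. -/
theorem exists_mul_self_mul {p : ℕ} (hp : p.Prime) {a : ℤ} (ha : a ≠ 0) :
    ∃ c u : ℤ, c ≠ 0 ∧ ¬ (p : ℤ) ∣ u ∧ (a = c * c * u ∨ a = c * c * (p * u)) := by
  obtain ⟨k, u, hu, rfl⟩ := exists_eq_pow_mul hp ha
  have hp0 : (p : ℤ) ≠ 0 := by exact_mod_cast hp.ne_zero
  obtain ⟨m, hm | hm⟩ := Nat.even_or_odd' k
  · exact ⟨p ^ m, u, pow_ne_zero _ hp0, hu, Or.inl (by rw [hm]; ring)⟩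
  · exact ⟨p ^ m, u, pow_ne_zero _ hp0, hu, Or.inr (by rw [hm]; ring)⟩

section Padic
variable {p : ℕ} [hp : Fact p.Prime]

theorem toZMod_eq_zero_iff (x : ℤ_[p]) : PadicInt.toZMod x = 0 ↔ ‖x‖ < 1 := by
  rw [← RingHom.mem_ker, PadicInt.ker_toZMod, PadicInt.maximalIdeal_eq_span_p,
    Ideal.mem_span_singleton, PadicInt.norm_lt_one_iff_dvd]

/-- An isotropic vector of a ternary form over `ℚ_p` may be taken primitive. -/
theorem IsIsotropic.exists_primitive {a b : ℤ} (h : IsIsotropic ℚ_[p] a b) :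
    ∃ x y z : ℤ_[p], (‖x‖ = 1 ∨ ‖y‖ = 1 ∨ ‖z‖ = 1) ∧ z ^ 2 = a * x ^ 2 + b * y ^ 2 := by
  obtain ⟨x, y, z, h0, h⟩ := h
  -- The element c will be the coordinate of largest norm; dividing by it makes the vector integral
  -- with a unit entry.
  have main : ∀ c : ℚ_[p], c ≠ 0 → ‖x‖ ≤ ‖c‖ → ‖y‖ ≤ ‖c‖ → ‖z‖ ≤ ‖c‖ →
      (c = x ∨ c = y ∨ c = z) → ∃ x y z : ℤ_[p], (‖x‖ = 1 ∨ ‖y‖ = 1 ∨ ‖z‖ = 1) ∧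
        z ^ 2 = a * x ^ 2 + b * y ^ 2 := by
    intro c hc hx hy hz hcc
    have hc' : 0 < ‖c‖ := norm_pos_iff.2 hc
    have lift : ∀ t : ℚ_[p], ‖t‖ ≤ ‖c‖ → ∃ T : ℤ_[p], (T : ℚ_[p]) = t / c := fun t ht =>
      ⟨⟨t / c, by rw [norm_div]; exact div_le_one_of_le₀ ht hc'.le⟩, rfl⟩
    obtain ⟨X, hX⟩ := lift x hx
    obtain ⟨Y, hY⟩ := lift y hy
    obtain ⟨Z, hZ⟩ := lift z hz
    refine ⟨X, Y, Z, ?_, ?_⟩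
    · rw [PadicInt.norm_def, PadicInt.norm_def, PadicInt.norm_def, hX, hY, hZ]
      rcases hcc with rfl | rfl | rfl <;> simp [div_self hc]
    · apply PadicInt.ext
      push_cast
      rw [hX, hY, hZ, div_pow, div_pow, div_pow, h]
      field_simp
  have hne : ∀ {c t : ℚ_[p]}, t ≠ 0 → ‖t‖ ≤ ‖c‖ → c ≠ 0 := by
    rintro c t ht h rfl
    rw [norm_zero] at h
    exact ht (norm_le_zero_iff.1 h)
  obtain ⟨t, ht, ht'⟩ : ∃ t : ℚ_[p], t ≠ 0 ∧ (t = x ∨ t = y ∨ t = z) := by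
    rcases h0 with h0 | h0 | h0
    exacts [⟨x, h0, by simp⟩, ⟨y, h0, by simp⟩, ⟨z, h0, by simp⟩]
  rcases le_total ‖x‖ ‖y‖ with h1 | h1 <;> rcases le_total ‖y‖ ‖z‖ with h2 | h2 <;>
    rcases le_total ‖x‖ ‖z‖ with h3 | h3
  all_goals first
    | (refine main x ?_ le_rfl (by linarith) (by linarith) (by simp); refine hne ht ?_
       rcases ht' with rfl | rfl | rfl <;> linarith)
    | (refine main y ?_ (by linarith) le_rfl (by linarith) (by simp); refine hne ht ?_
       rcases ht' with rfl | rfl | rfl <;> linarith)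
    | (refine main z ?_ (by linarith) (by linarith) le_rfl (by simp); refine hne ht ?_
       rcases ht' with rfl | rfl | rfl <;> linarith)

theorem norm_intCast_eq_one {u : ℤ} (hu : ¬ (p : ℤ) ∣ u) : ‖(u : ℤ_[p])‖ = 1 :=
  le_antisymm (PadicInt.norm_le_one _)
    (not_lt.1 fun h => hu ((PadicInt.norm_int_lt_one_iff_dvd u).1 h))

/-- In a primitive zero of `z² - u x² - p v y²` the coordinate `x` is a unit. -/
theorem norm_eq_one_of_primitive {u v : ℤ} (hv : ¬ (p : ℤ) ∣ v) {x y z : ℤ_[p]}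
    (h0 : ‖x‖ = 1 ∨ ‖y‖ = 1 ∨ ‖z‖ = 1) (h : z ^ 2 = u * x ^ 2 + p * v * y ^ 2) : ‖x‖ = 1 := by
  by_contra hx
  have hx : (p : ℤ_[p]) ∣ x :=
    (PadicInt.norm_lt_one_iff_dvd x).1 (lt_of_le_of_ne (PadicInt.norm_le_one x) hx)
  have hpp : Prime (p : ℤ_[p]) := PadicInt.prime_p
  have hz : (p : ℤ_[p]) ∣ z := by
    apply hpp.dvd_of_dvd_pow (n := 2)
    rw [h]
    exact dvd_add ((hx.trans (dvd_pow_self x two_ne_zero)).mul_left _) ⟨v * y ^ 2, by ring⟩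
  have hy : (p : ℤ_[p]) ∣ y := by
    have h1 : (p : ℤ_[p]) * p ∣ p * (v * y ^ 2) := by
      have : (p : ℤ_[p]) * (v * y ^ 2) = z * z - u * (x * x) := by linear_combination -h
      rw [this]
      exact dvd_sub (mul_dvd_mul hz hz) ((mul_dvd_mul hx hx).mul_left _)
    have h2 := (mul_dvd_mul_iff_left hpp.ne_zero).1 h1
    rcases hpp.dvd_or_dvd h2 with h3 | h3
    · rw [← PadicInt.norm_lt_one_iff_dvd, norm_intCast_eq_one hv] at h3
      exact absurd h3 (lt_irrefl _)
    · exact hpp.dvd_of_dvd_pow h3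
  rw [← PadicInt.norm_lt_one_iff_dvd] at hx hy hz
  rcases h0 with h0 | h0 | h0 <;> linarith

/-- Reduction modulo p of a primitive zero leaves z² = u x² with x a unit. -/
theorem jacobiSym_eq_one_of_isIsotropic {u v : ℤ} (hu : ¬ (p : ℤ) ∣ u) (hv : ¬ (p : ℤ) ∣ v)
    (h : IsIsotropic ℚ_[p] ((u : ℤ) : ℚ_[p]) ((p * v : ℤ) : ℚ_[p])) : J(u | p) = 1 := by
  obtain ⟨x, y, z, h0, h⟩ := h.exists_primitive
  push_cast at h
  have hx := norm_eq_one_of_primitive hv h0 h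
  have h1 := congrArg (PadicInt.toZMod (p := p)) h
  simp only [map_pow, map_add, map_mul, map_intCast, map_natCast, CharP.cast_eq_zero, zero_mul,
    add_zero] at h1
  have hx' : PadicInt.toZMod x ≠ 0 := by rw [Ne, toZMod_eq_zero_iff, hx]; exact lt_irrefl _
  have hu' : ((u : ℤ) : ZMod p) ≠ 0 := by rwa [Ne, ZMod.intCast_zmod_eq_zero_iff_dvd]
  rw [← jacobiSym.legendreSym.to_jacobiSym, legendreSym.eq_one_iff p hu']
  exact ⟨PadicInt.toZMod z / PadicInt.toZMod x, by field_simp; exact h1.symm⟩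

/-- A class of pairs of nonzero integers that is stable under symmetry, `(a, b) ↦ (c² a, b)` and
`(a, b) ↦ (a, -ab)` contains all pairs once it contains those of a unit and an integer of
valuation at most one. -/
theorem symbol_induction {P : ℤ → ℤ → Prop} (hsymm : ∀ a b, P a b → P b a)
    (hsq : ∀ a b c, a ≠ 0 → b ≠ 0 → c ≠ 0 → P a b → P (c * c * a) b)
    (hneg : ∀ a b, a ≠ 0 → b ≠ 0 → P a (-(a * b)) → P a b)
    (hunit : ∀ u v, ¬ (p : ℤ) ∣ u → ¬ (p : ℤ) ∣ v → P u v)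
    (hmix : ∀ u v, ¬ (p : ℤ) ∣ u → ¬ (p : ℤ) ∣ v → P u (p * v)) {a b : ℤ} (ha : a ≠ 0)
    (hb : b ≠ 0) : P a b := by
  have hp0 : (p : ℤ) ≠ 0 := by exact_mod_cast hp.out.ne_zero
  have hn0 : ∀ {u : ℤ}, ¬ (p : ℤ) ∣ u → u ≠ 0 := by rintro u hu rfl; exact hu (dvd_zero _)
  -- The pair (p u, p v) is traded for (p u, -p² u v), which up to the square p² is a mixed case.
  have key : ∀ u v, ¬ (p : ℤ) ∣ u → ¬ (p : ℤ) ∣ v → P (p * u) (p * v) := by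
    intro u v hu hv
    refine hneg _ _ (mul_ne_zero hp0 (hn0 hu)) (mul_ne_zero hp0 (hn0 hv)) ?_
    rw [show -(p * u * (p * v)) = p * p * (-(u * v)) by ring]
    have h2 : ¬ (p : ℤ) ∣ -(u * v) := by rw [dvd_neg]; exact not_dvd_mul hp.out hu hv
    exact hsymm _ _ (hsq _ _ _ (hn0 h2) (mul_ne_zero hp0 (hn0 hu)) hp0 (hmix _ _ h2 hu))
  obtain ⟨c, u, hc, hu, h1⟩ := exists_mul_self_mul hp.out ha
  obtain ⟨d, v, hd, hv, h2⟩ := exists_mul_self_mul hp.out hb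
  have red : ∀ a' b', a' ≠ 0 → b' ≠ 0 → P a' b' → P (c * c * a') (d * d * b') :=
    fun a' b' ha' hb' h => hsq _ _ _ ha' (mul_ne_zero (mul_ne_zero hd hd) hb') hc
      (hsymm _ _ (hsq _ _ _ hb' ha' hd (hsymm _ _ h)))
  rcases h1 with rfl | rfl <;> rcases h2 with rfl | rfl
  · exact red _ _ (hn0 hu) (hn0 hv) (hunit _ _ hu hv)
  · exact red _ _ (hn0 hu) (mul_ne_zero hp0 (hn0 hv)) (hmix _ _ hu hv)
  · exact red _ _ (mul_ne_zero hp0 (hn0 hu)) (hn0 hv) (hsymm _ _ (hmix _ _ hv hu))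
  · exact red _ _ (mul_ne_zero hp0 (hn0 hu)) (mul_ne_zero hp0 (hn0 hv)) (key _ _ hu hv)

theorem hilb_neg_mul {a b : ℤ} (ha : a ≠ 0) (hb : b ≠ 0) :
    hilb p a (-(a * b)) = hilb p a b := by
  rw [show -(a * b) = -a * b by ring, hilb_mul_right hp.out _ (neg_ne_zero.2 ha) hb,
    hilb_neg_self hp.out ha, one_mul]

theorem hilb_unit_mul {u v : ℤ} (hu : ¬ (p : ℤ) ∣ u) (hv : ¬ (p : ℤ) ∣ v) :
    hilb p u (p * v) = J(u | p) := by
  have h := hilb_pow_mul hp.out 0 1 hu hv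
  simpa using h

theorem hilb_eq_one_of_isIsotropic {a b : ℤ} (ha : a ≠ 0) (hb : b ≠ 0)
    (h : IsIsotropic ℚ_[p] (a : ℚ_[p]) (b : ℚ_[p])) : hilb p a b = 1 := by
  revert h
  refine symbol_induction (p := p)
    (P := fun a b => IsIsotropic ℚ_[p] (a : ℚ_[p]) (b : ℚ_[p]) → hilb p a b = 1)
    ?_ ?_ ?_ ?_ ?_ ha hb
  · intro a b h h'; rw [hilb_comm]; exact h h'.symm
  · intro a b c ha hb hc h h'
    rw [hilb_mul_self_left hp.out ha hb hc]
    push_cast at h'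
    exact h (h'.of_mul_self (by exact_mod_cast hc))
  · intro a b ha hb h h'
    rw [← hilb_neg_mul ha hb]
    apply h
    push_cast
    exact h'.neg_mul (by exact_mod_cast ha)
  · intro u v hu hv _; exact hilb_eq_one_of_not_dvd hu hv
  · intro u v hu hv h
    rw [hilb_unit_mul hu hv]
    exact jacobiSym_eq_one_of_isIsotropic hu hv h

/-- An integer prime to the odd prime `p` that is a square modulo `p` is a square in `ℤ_p`. -/
theorem exists_sq_eq_of_isSquare (h2 : p ≠ 2) {u : ℤ} (hu : ¬ (p : ℤ) ∣ u)
    (h : IsSquare (u : ZMod p)) : ∃ w : ℤ_[p], w ^ 2 = u := by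
  obtain ⟨c, hc⟩ := h
  obtain ⟨c, rfl⟩ := ZMod.intCast_surjective c
  have hcu : (p : ℤ) ∣ c ^ 2 - u := by
    rw [← ZMod.intCast_zmod_eq_zero_iff_dvd]; push_cast; rw [hc]; ring
  -- The derivative of X² - u at c is 2 c, and Hensel's lemma needs it to be a unit.
  have hcp : ¬ (p : ℤ) ∣ 2 * c := by
    apply not_dvd_mul hp.out
    · intro h
      have := Int.natCast_dvd_natCast.1 (by exact_mod_cast h : (p : ℤ) ∣ (2 : ℕ))
      exact h2 ((Nat.prime_dvd_prime_iff_eq hp.out Nat.prime_two).1 this)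
    · intro h
      have h3 : (p : ℤ) ∣ c ^ 2 := h.trans (dvd_pow_self c two_ne_zero)
      exact hu (by simpa using dvd_sub h3 hcu)
  have e1 : (Polynomial.X ^ 2 - Polynomial.C u : Polynomial ℤ).aeval (c : ℤ_[p]) =
      ((c ^ 2 - u : ℤ) : ℤ_[p]) := by simp
  have e2 : (Polynomial.X ^ 2 - Polynomial.C u : Polynomial ℤ).derivative.aeval (c : ℤ_[p]) =
      ((2 * c : ℤ) : ℤ_[p]) := by
    simp only [Polynomial.derivative_sub, Polynomial.derivative_X_pow, Polynomial.derivative_C]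
    simp
    exact Or.inl (map_ofNat _ 2)
  obtain ⟨w, hw, -⟩ := hensels_lemma (p := p) (R := ℤ)
    (F := Polynomial.X ^ 2 - Polynomial.C u) (a := (c : ℤ_[p])) (by
      rw [e1, e2, norm_intCast_eq_one hcp, one_pow]
      exact (PadicInt.norm_int_lt_one_iff_dvd _).2 hcu)
  refine ⟨w, ?_⟩
  simp at hw
  exact sub_eq_zero.1 hw

theorem isSquare_padic_of_jacobiSym (h2 : p ≠ 2) {u : ℤ} (hu : ¬ (p : ℤ) ∣ u)
    (h : J(u | p) = 1) : IsSquare (u : ℚ_[p]) := by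
  have hu' : ((u : ℤ) : ZMod p) ≠ 0 := by rwa [Ne, ZMod.intCast_zmod_eq_zero_iff_dvd]
  rw [← jacobiSym.legendreSym.to_jacobiSym, legendreSym.eq_one_iff p hu'] at h
  obtain ⟨w, hw⟩ := exists_sq_eq_of_isSquare h2 hu h
  refine ⟨w, ?_⟩
  rw [← sq, ← PadicInt.coe_pow, hw, PadicInt.coe_intCast]

/-- The conic u x² + v y² = 1 has a point modulo p. At integers lifting it the left side is 1 modulo
p, hence a p-adic square by Hensel, and serves as z². -/
theorem isIsotropic_of_not_dvd (h2 : p ≠ 2) {u v : ℤ} (hu : ¬ (p : ℤ) ∣ u)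
    (hv : ¬ (p : ℤ) ∣ v) : IsIsotropic ℚ_[p] (u : ℚ_[p]) (v : ℚ_[p]) := by
  have hu' : ((u : ℤ) : ZMod p) ≠ 0 := by rwa [Ne, ZMod.intCast_zmod_eq_zero_iff_dvd]
  have hv' : ((v : ℤ) : ZMod p) ≠ 0 := by rwa [Ne, ZMod.intCast_zmod_eq_zero_iff_dvd]
  obtain ⟨x, y, hxy⟩ := FiniteField.exists_root_sum_quadratic (R := ZMod p)
    (f := Polynomial.C (u : ZMod p) * Polynomial.X ^ 2)
    (g := Polynomial.C (v : ZMod p) * Polynomial.X ^ 2 - Polynomial.C 1)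
    (by rw [Polynomial.degree_C_mul_X_pow _ hu']; rfl)
    (by
      rw [Polynomial.degree_sub_C, Polynomial.degree_C_mul_X_pow _ hv']
      · rfl
      · rw [Polynomial.degree_C_mul_X_pow _ hv']; decide)
    (by rw [ZMod.card]; exact Nat.odd_iff.1 (hp.out.odd_of_ne_two h2))
  obtain ⟨x, rfl⟩ := ZMod.intCast_surjective x
  obtain ⟨y, rfl⟩ := ZMod.intCast_surjective y
  simp at hxy
  have h1 : ((u * x ^ 2 + v * y ^ 2 : ℤ) : ZMod p) = 1 := by
    push_cast; linear_combination hxy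
  obtain ⟨w, hw⟩ := exists_sq_eq_of_isSquare h2 (u := u * x ^ 2 + v * y ^ 2)
    (by rw [← ZMod.intCast_zmod_eq_zero_iff_dvd, h1]; exact one_ne_zero)
    (by rw [h1]; exact IsSquare.one)
  have hw' : (w : ℚ_[p]) ^ 2 = u * x ^ 2 + v * y ^ 2 := by
    rw [← PadicInt.coe_pow, hw, PadicInt.coe_intCast]; push_cast; ring
  refine ⟨x, y, w, ?_, hw'⟩
  by_contra hcon
  push Not at hcon
  have hx0 : x = 0 := by exact_mod_cast hcon.1
  have hy0 : y = 0 := by exact_mod_cast hcon.2.1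
  rw [hx0, hy0] at h1
  simp at h1

theorem isIsotropic_of_hilb_eq_one (h2 : p ≠ 2) {a b : ℤ} (ha : a ≠ 0) (hb : b ≠ 0)
    (h : hilb p a b = 1) : IsIsotropic ℚ_[p] (a : ℚ_[p]) (b : ℚ_[p]) := by
  revert h
  refine symbol_induction (p := p)
    (P := fun a b => hilb p a b = 1 → IsIsotropic ℚ_[p] (a : ℚ_[p]) (b : ℚ_[p]))
    ?_ ?_ ?_ ?_ ?_ ha hb
  · intro a b h h'; rw [hilb_comm] at h'; exact (h h').symm
  · intro a b c ha hb hc h h'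
    rw [hilb_mul_self_left hp.out ha hb hc] at h'
    push_cast
    exact (h h').mul_self (by exact_mod_cast hc)
  · intro a b ha hb h h'
    rw [← hilb_neg_mul ha hb] at h'
    have := h h'
    push_cast at this
    exact this.of_neg_mul (by exact_mod_cast ha)
  · intro u v hu hv _; exact isIsotropic_of_not_dvd h2 hu hv
  · intro u v hu hv h
    rw [hilb_unit_mul hu hv] at h
    exact isIsotropic_of_isSquare (isSquare_padic_of_jacobiSym h2 hu h)

end Padic

/-! ### The 2-adic symbol -/

theorem hilbTwo_neg_self {a : ℤ} (ha : a ≠ 0) : hilbTwo a (-a) = 1 := by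
  obtain ⟨k, u, hu, rfl⟩ := exists_eq_pow_mul Nat.prime_two ha
  push_cast at hu ⊢
  rw [← mul_neg, hilbTwo_pow_mul k k hu (by rwa [dvd_neg]), if_neg (by omega), one_mul, ← mul_pow,
    ← map_mul]
  -- The condition `x * 4 ≠ 0` says that x is odd; then x · (-x) = -1 modulo 8, where χ₈ is 1.
  have h8 : ∀ x : ZMod 8, x * 4 ≠ 0 → ZMod.χ₈ (x * -x) = 1 := by decide
  push_cast
  rw [h8, one_pow]
  intro h
  have : ((u * 4 : ℤ) : ZMod 8) = 0 := by push_cast; exact h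
  rw [ZMod.intCast_zmod_eq_zero_iff_dvd] at this
  push_cast at this
  omega

/-- Reduction modulo `8` of `2`-adic integers. -/
noncomputable def toZModEight : ℤ_[2] →+* ZMod 8 := PadicInt.toZModPow 3

theorem toZModEight_sq_of_norm_eq_one {x : ℤ_[2]} (hx : ‖x‖ = 1) : toZModEight x ^ 2 = 1 := by
  obtain ⟨w, hw⟩ := ((PadicInt.isUnit_iff.2 hx).map toZModEight).exists_right_inv
  have key : ∀ x w : ZMod 8, x * w = 1 → x ^ 2 = 1 := by decide
  exact key _ _ hw

theorem zmod_eight_sq (x : ZMod 8) : x ^ 2 = 0 ∨ x ^ 2 = 4 ∨ x ^ 2 = 1 := by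
  revert x; decide

theorem intCast_zmod_eight_odd {u : ℤ} (hu : ¬ (2 : ℤ) ∣ u) :
    (u : ZMod 8) = 1 ∨ (u : ZMod 8) = 3 ∨ (u : ZMod 8) = 5 ∨ (u : ZMod 8) = 7 := by
  have h := ZMod.intCast_mod u 8
  have h1 : u % 8 = 1 ∨ u % 8 = 3 ∨ u % 8 = 5 ∨ u % 8 = 7 := by omega
  push_cast at h
  rcases h1 with h1 | h1 | h1 | h1 <;> rw [h1] at h <;> rw [← h] <;> simp

theorem mod_four_eq_three_iff {u : ℤ} :
    u % 4 = 3 ↔ (u : ZMod 8) = 3 ∨ (u : ZMod 8) = 7 := by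
  have h3 : (u : ZMod 8) = 3 ↔ u % 8 = 3 % 8 := by
    have := ZMod.intCast_eq_intCast_iff u 3 8
    simpa [Int.ModEq] using this
  have h7 : (u : ZMod 8) = 7 ↔ u % 8 = 7 % 8 := by
    have := ZMod.intCast_eq_intCast_iff u 7 8
    simpa [Int.ModEq] using this
  rw [h3, h7]
  omega

theorem hilbTwo_eq_or {a b : ℤ} (ha : a ≠ 0) (hb : b ≠ 0) :
    hilbTwo a b = 1 ∨ hilbTwo a b = -1 := by
  have h8 : ∀ x : ZMod 8, (x = 1 ∨ x = 3 ∨ x = 5 ∨ x = 7) →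
    ZMod.χ₈ x = 1 ∨ ZMod.χ₈ x = -1 := by decide
  have hu := h8 _ (intCast_zmod_eight_odd (by exact_mod_cast not_dvd_unitPart Nat.prime_two ha))
  have hv := h8 _ (intCast_zmod_eight_odd (by exact_mod_cast not_dvd_unitPart Nat.prime_two hb))
  have key : ∀ (x : ℤ) (n : ℕ), (x = 1 ∨ x = -1) → (x ^ n = 1 ∨ x ^ n = -1) := by
    rintro x n (rfl | rfl)
    · simp
    · exact neg_one_pow_eq_or ℤ n
  unfold hilbTwo
  rcases key _ (padicValInt 2 b) hu with h1 | h1 <;>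
    rcases key _ (padicValInt 2 a) hv with h2 | h2 <;> rw [h1, h2] <;> split_ifs <;> simp

-- A primitive zero survives reduction modulo 8, where unit squares are 1 and the others 0 or 4, so
-- both basic cases are finite checks. Only this direction is needed at 2, since
-- `exists_ternary_zero` does not test that prime.
set_option synthInstance.maxSize 1000 in
theorem hilbTwo_eq_one_of_isIsotropic {a b : ℤ} (ha : a ≠ 0) (hb : b ≠ 0)
    (h : IsIsotropic ℚ_[2] (a : ℚ_[2]) (b : ℚ_[2])) : hilbTwo a b = 1 := by
  revert h
  refine symbol_induction (p := 2)
    (P := fun a b => IsIsotropic ℚ_[2] (a : ℚ_[2]) (b : ℚ_[2]) → hilbTwo a b = 1)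
    ?_ ?_ ?_ ?_ ?_ ha hb
  · intro a b h h'; rw [hilbTwo_comm]; exact h h'.symm
  · intro a b c ha hb hc h h'
    push_cast at h'
    rw [hilbTwo_mul_left (mul_ne_zero hc hc) ha, h (h'.of_mul_self (by exact_mod_cast hc)),
      mul_one, hilbTwo_mul_left hc hc]
    rcases hilbTwo_eq_or hc hb with h | h <;> rw [h] <;> rfl
  · intro a b ha hb h h'
    have h1 := h (by push_cast; exact h'.neg_mul (by exact_mod_cast ha))
    rwa [show -(a * b) = -a * b by ring, hilbTwo_mul_right (neg_ne_zero.2 ha) hb,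
      hilbTwo_neg_self ha, one_mul] at h1
  · intro u v hu hv h
    push_cast at hu hv
    have h1 := hilbTwo_pow_mul 0 0 hu hv
    simp only [pow_zero, one_mul, mul_one] at h1
    rw [h1, if_neg]
    rw [mod_four_eq_three_iff, mod_four_eq_three_iff]
    obtain ⟨x, y, z, h0, h⟩ := h.exists_primitive
    have h2 := congrArg toZModEight h
    simp only [map_pow, map_add, map_mul, map_intCast] at h2
    -- For U, V ≡ 3 mod 4, a square value U s + V t forces all three squares to be even, against
    -- primitivity.
    have key : ∀ U V s t : ZMod 8, (U = 3 ∨ U = 7) → (V = 3 ∨ V = 7) →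
        (s = 0 ∨ s = 4 ∨ s = 1) → (t = 0 ∨ t = 4 ∨ t = 1) → U * s + V * t = 0 ∨
          U * s + V * t = 4 ∨ U * s + V * t = 1 → s ≠ 1 ∧ t ≠ 1 ∧ U * s + V * t ≠ 1 := by decide
    rintro ⟨hu3, hv3⟩
    obtain ⟨k1, k2, k3⟩ := key _ _ _ _ hu3 hv3 (zmod_eight_sq (toZModEight x))
      (zmod_eight_sq (toZModEight y)) (h2 ▸ zmod_eight_sq (toZModEight z))
    rcases h0 with h0 | h0 | h0
    · exact k1 (toZModEight_sq_of_norm_eq_one h0)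
    · exact k2 (toZModEight_sq_of_norm_eq_one h0)
    · exact k3 (h2 ▸ toZModEight_sq_of_norm_eq_one h0)
  · intro u v hu hv h
    obtain ⟨x, y, z, h0, h⟩ := h.exists_primitive
    push_cast at h
    have hx := norm_eq_one_of_primitive (p := 2) (u := u) hv h0 (by push_cast; exact h)
    push_cast at hu hv
    have h2 := congrArg toZModEight h
    simp only [map_pow, map_add, map_mul, map_intCast, map_ofNat,
      toZModEight_sq_of_norm_eq_one hx] at h2
    have h1 := hilbTwo_pow_mul 0 1 hu hv
    simp only [pow_zero, one_mul, mul_one, pow_one] at h1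
    push_cast
    rw [h1]
    simp only [mod_four_eq_three_iff]
    have key : ∀ U V t : ZMod 8, (U = 1 ∨ U = 3 ∨ U = 5 ∨ U = 7) →
        (V = 1 ∨ V = 3 ∨ V = 5 ∨ V = 7) → (t = 0 ∨ t = 4 ∨ t = 1) →
        U * 1 + 2 * V * t = 0 ∨ U * 1 + 2 * V * t = 4 ∨ U * 1 + 2 * V * t = 1 →
        (if (U = 3 ∨ U = 7) ∧ (V = 3 ∨ V = 7) then (-1 : ℤ) else 1) * ZMod.χ₈ U = 1 := by decide
    exact key _ _ _ (intCast_zmod_eight_odd hu) (intCast_zmod_eight_odd hv)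
      (zmod_eight_sq (toZModEight y)) (h2 ▸ zmod_eight_sq (toZModEight z))

end BrandtZeroes

namespace BrandtZeroes
open scoped NumberTheorySymbols

/-! ### The product formula -/

/-- The Hilbert symbol at the real place. -/
def hilbReal (a b : ℤ) : ℤ := if a < 0 ∧ b < 0 then -1 else 1

theorem hilbReal_comm (a b : ℤ) : hilbReal a b = hilbReal b a := by
  simp only [hilbReal, and_comm (a := a < 0)]

theorem hilbReal_mul_left {a a' b : ℤ} (ha : a ≠ 0) (ha' : a' ≠ 0) :
    hilbReal (a * a') b = hilbReal a b * hilbReal a' b := by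
  unfold hilbReal
  rcases lt_or_gt_of_ne ha with h | h <;> rcases lt_or_gt_of_ne ha' with h' | h' <;>
    by_cases hb : b < 0
  all_goals
    simp [h, h', hb, not_lt_of_gt, mul_pos_of_neg_of_neg, mul_neg_of_neg_of_pos,
      mul_neg_of_pos_of_neg]

/-- A multiplicative property of nonzero integers may be checked on `-1`, `2` and odd primes. -/
theorem int_induction_on_primes {P : ℤ → Prop} (hneg : P (-1)) (htwo : P 2)
    (hodd : ∀ p : ℕ, p.Prime → p ≠ 2 → P p) (hmul : ∀ a b, a ≠ 0 → b ≠ 0 → P a → P b → P (a * b))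
    {a : ℤ} (ha : a ≠ 0) : P a := by
  have h1 : P 1 := by simpa using hmul (-1) (-1) (by norm_num) (by norm_num) hneg hneg
  have hnat : ∀ n : ℕ, n ≠ 0 → P n := by
    intro n
    induction n using induction_on_primes with
    | zero => intro h; exact absurd rfl h
    | one => intro _; exact_mod_cast h1
    | prime_mul p n hp ih =>
      intro h
      have hn : n ≠ 0 := right_ne_zero_of_mul h
      push_cast
      refine hmul _ _ (by exact_mod_cast hp.ne_zero) (by exact_mod_cast hn) ?_ (ih hn)
      by_cases h2 : p = 2
      · rw [h2]; exact_mod_cast htwo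
      · exact hodd p hp h2
  rcases Int.natAbs_eq a with h | h
  · rw [h]; exact hnat _ (Int.natAbs_ne_zero.2 ha)
  · rw [h, ← neg_one_mul]
    exact hmul _ _ (by norm_num) (by simpa using ha) hneg (hnat _ (Int.natAbs_ne_zero.2 ha))

/-- The product formula for `a, b`, for all sufficiently large sets of odd primes. -/
def ProductFormula (a b : ℤ) : Prop :=
  ∀ P : Finset ℕ, (∀ p ∈ P, p.Prime ∧ p ≠ 2) →
    (∀ p : ℕ, p.Prime → p ≠ 2 → ((p : ℤ) ∣ a ∨ (p : ℤ) ∣ b) → p ∈ P) →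
    ∏ p ∈ P, hilb p a b = hilbTwo a b * hilbReal a b

theorem ProductFormula.symm {a b : ℤ} (h : ProductFormula a b) : ProductFormula b a := by
  intro P hP hP'
  rw [hilbTwo_comm, hilbReal_comm, ← h P hP fun p h1 h2 h3 => hP' p h1 h2 h3.symm]
  exact Finset.prod_congr rfl fun p _ => hilb_comm p b a

theorem ProductFormula.mul {a a' b : ℤ} (ha : a ≠ 0) (ha' : a' ≠ 0) (h : ProductFormula a b)
    (h' : ProductFormula a' b) : ProductFormula (a * a') b := by
  intro P hP hP'
  rw [Finset.prod_congr rfl fun p hp => hilb_mul_left (hP p hp).1 ha ha' b, Finset.prod_mul_distrib,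
    h P hP fun p h1 h2 h3 => hP' p h1 h2 (h3.imp_left fun h => h.mul_right _),
    h' P hP fun p h1 h2 h3 => hP' p h1 h2 (h3.imp_left fun h => h.mul_left _),
    hilbTwo_mul_left ha ha', hilbReal_mul_left ha ha']
  ring

theorem not_two_dvd_prime {p : ℕ} (hp : p.Prime) (h2 : p ≠ 2) : ¬ (2 : ℤ) ∣ p := by
  intro h
  exact h2 ((Nat.prime_dvd_prime_iff_eq Nat.prime_two hp).1 (by exact_mod_cast h)).symm

theorem prime_not_dvd_two {p : ℕ} (hp : p.Prime) (h2 : p ≠ 2) : ¬ (p : ℤ) ∣ 2 := by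
  intro h
  exact h2 ((Nat.prime_dvd_prime_iff_eq hp Nat.prime_two).1 (by exact_mod_cast h))

theorem prime_not_dvd_prime {p q : ℕ} (hp : p.Prime) (hq : q.Prime) (h : p ≠ q) :
    ¬ (p : ℤ) ∣ q := by
  intro h'
  exact h ((Nat.prime_dvd_prime_iff_eq hp hq).1 (by exact_mod_cast h'))

theorem not_dvd_one {p : ℕ} (hp : p.Prime) : ¬ (p : ℤ) ∣ 1 := by
  intro h; exact not_dvd_neg_one hp (by rwa [dvd_neg])

theorem neg_one_not_two_dvd : ¬ (2 : ℤ) ∣ -1 := by decide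

theorem not_two_dvd_one : ¬ (2 : ℤ) ∣ 1 := by decide

theorem productFormula_of_not_dvd {a b : ℤ} (ha : ∀ p : ℕ, p.Prime → p ≠ 2 → ¬ (p : ℤ) ∣ a)
    (hb : ∀ p : ℕ, p.Prime → p ≠ 2 → ¬ (p : ℤ) ∣ b) (h : hilbTwo a b * hilbReal a b = 1) :
    ProductFormula a b := by
  intro P hP _
  rw [h]
  exact Finset.prod_eq_one fun p hp => hilb_eq_one_of_not_dvd (ha p (hP p hp).1 (hP p hp).2)
    (hb p (hP p hp).1 (hP p hp).2)

theorem productFormula_prime {a : ℤ} (ha : ∀ p : ℕ, p.Prime → p ≠ 2 → ¬ (p : ℤ) ∣ a) {q : ℕ}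
    (hq : q.Prime) (h2 : q ≠ 2) (h : J(a | q) = hilbTwo a q * hilbReal a q) :
    ProductFormula a q := by
  intro P hP hP'
  have := Fact.mk hq
  rw [← h, Finset.prod_eq_single q]
  · have := hilb_unit_mul (ha q hq h2) (not_dvd_one hq)
    rwa [mul_one] at this
  · intro p hp hpq
    exact hilb_eq_one_of_not_dvd (ha p (hP p hp).1 (hP p hp).2)
      (prime_not_dvd_prime (hP p hp).1 hq hpq)
  · intro h; exact absurd (hP' q hq h2 (Or.inr dvd_rfl)) h

theorem hilbTwo_of_odd {u w : ℤ} (hu : ¬ (2 : ℤ) ∣ u) (hw : ¬ (2 : ℤ) ∣ w) :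
    hilbTwo u w = if u % 4 = 3 ∧ w % 4 = 3 then -1 else 1 := by
  have h1 := hilbTwo_pow_mul 0 0 hu hw
  simpa using h1

theorem hilbTwo_two_of_odd {w : ℤ} (hw : ¬ (2 : ℤ) ∣ w) : hilbTwo 2 w = ZMod.χ₈ w := by
  have h1 := hilbTwo_pow_mul 1 0 not_two_dvd_one hw
  simpa using h1

theorem hilbTwo_two_two : hilbTwo 2 2 = 1 := by
  have h1 := hilbTwo_pow_mul 1 1 not_two_dvd_one not_two_dvd_one
  simpa using h1

theorem hilbReal_natCast (a : ℤ) (n : ℕ) : hilbReal a n = 1 :=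
  if_neg fun h => by omega

/-- Both sides are bimultiplicative, so a and b may be taken among -1, 2 and the odd primes; there
the formula is quadratic reciprocity with its two supplements. -/
theorem productFormula {a b : ℤ} (ha : a ≠ 0) (hb : b ≠ 0) : ProductFormula a b := by
  have hneg : ∀ p : ℕ, p.Prime → p ≠ 2 → ¬ (p : ℤ) ∣ -1 := fun p hp _ => not_dvd_neg_one hp
  have htwo : ∀ p : ℕ, p.Prime → p ≠ 2 → ¬ (p : ℤ) ∣ 2 := fun p hp h2 => prime_not_dvd_two hp h2
  have e1 : ∀ q : ℕ, q.Prime → q ≠ 2 → ProductFormula (-1) q := by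
    intro q hq h2
    refine productFormula_prime hneg hq h2 ?_
    rw [jacobiSym.at_neg_one (hq.odd_of_ne_two h2), hilbReal_natCast,
      hilbTwo_of_odd neg_one_not_two_dvd (not_two_dvd_prime hq h2),
      ZMod.χ₄_nat_eq_if_mod_four]
    have := Nat.odd_iff.1 (hq.odd_of_ne_two h2)
    split_ifs <;> omega
  have e2 : ∀ q : ℕ, q.Prime → q ≠ 2 → ProductFormula 2 q := by
    intro q hq h2
    refine productFormula_prime htwo hq h2 ?_
    rw [jacobiSym.at_two (hq.odd_of_ne_two h2), hilbReal_natCast,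
      hilbTwo_two_of_odd (not_two_dvd_prime hq h2), mul_one, Int.cast_natCast]
  have e3 : ProductFormula (-1) 2 := by
    refine productFormula_of_not_dvd hneg htwo ?_
    rw [hilbTwo_comm, hilbTwo_two_of_odd neg_one_not_two_dvd]
    decide
  refine int_induction_on_primes (P := fun a => ProductFormula a b) ?_ ?_ ?_
    (fun a a' ha ha' h h' => h.mul ha ha' h') ha
  · refine int_induction_on_primes (P := fun b => ProductFormula (-1) b) ?_ e3 e1
      (fun a a' ha ha' h h' => (h.symm.mul ha ha' h'.symm).symm) hb
    refine productFormula_of_not_dvd hneg hneg ?_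
    rw [hilbTwo_of_odd neg_one_not_two_dvd neg_one_not_two_dvd]
    decide
  · refine int_induction_on_primes (P := fun b => ProductFormula 2 b) e3.symm ?_ e2
      (fun a a' ha ha' h h' => (h.symm.mul ha ha' h'.symm).symm) hb
    refine productFormula_of_not_dvd htwo htwo ?_
    rw [hilbTwo_two_two]
    decide
  · intro q hq hq2
    refine int_induction_on_primes (P := fun b => ProductFormula q b) (e1 q hq hq2).symm
      (e2 q hq hq2).symm ?_ (fun a a' ha ha' h h' => (h.symm.mul ha ha' h'.symm).symm) hb
    intro l hl hl2 P hP hP'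
    have hqo := Nat.odd_iff.1 (hq.odd_of_ne_two hq2)
    have hlo := Nat.odd_iff.1 (hl.odd_of_ne_two hl2)
    rw [hilbReal_natCast, mul_one, hilbTwo_of_odd (not_two_dvd_prime hq hq2)
      (not_two_dvd_prime hl hl2)]
    -- For q = l only the place q contributes, with J(-1 | q); for q ≠ l the places q and l
    -- contribute J(l | q) J(q | l).
    by_cases hql : q = l
    · subst hql
      rw [Finset.prod_eq_single q]
      · have h1 := hilb_pow_mul hq 1 1 (not_dvd_one hq) (not_dvd_one hq)
        simp only [pow_one, mul_one, jacobiSym.one_left] at h1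
        rw [h1, jacobiSym.at_neg_one (hq.odd_of_ne_two hq2), ZMod.χ₄_nat_eq_if_mod_four]
        split_ifs <;> omega
      · intro p hp hpq
        exact hilb_eq_one_of_not_dvd (prime_not_dvd_prime (hP p hp).1 hq hpq)
          (prime_not_dvd_prime (hP p hp).1 hq hpq)
      · intro h; exact absurd (hP' q hq hq2 (Or.inr dvd_rfl)) h
    · have hl' := Fact.mk hl
      have hq' := Fact.mk hq
      rw [Finset.prod_eq_mul q l hql]
      · have h1 := hilb_unit_mul (prime_not_dvd_prime hl hq (Ne.symm hql)) (not_dvd_one hl)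
        have h2 := hilb_unit_mul (prime_not_dvd_prime hq hl hql) (not_dvd_one hq)
        rw [mul_one] at h1 h2
        rw [h1, hilb_comm, h2]
        have hJ := jacobiSym_eq_or hl (prime_not_dvd_prime hl hq (Ne.symm hql))
        by_cases hq4 : q % 4 = 1
        · rw [jacobiSym.quadratic_reciprocity_one_mod_four hq4 (hl.odd_of_ne_two hl2),
            if_neg (by omega)]
          rw [jacobiSym.quadratic_reciprocity_one_mod_four hq4 (hl.odd_of_ne_two hl2)] at hJ
          rcases hJ with h | h <;> rw [h] <;> rfl
        · by_cases hl4 : l % 4 = 1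
          · rw [jacobiSym.quadratic_reciprocity_one_mod_four hl4 (hq.odd_of_ne_two hq2),
              if_neg (by omega)]
            rcases hJ with h | h <;> rw [h] <;> rfl
          · rw [jacobiSym.quadratic_reciprocity_three_mod_four (a := l) (by omega) (by omega),
              if_pos (by omega)]
            rcases hJ with h | h <;> rw [h] <;> rfl
      · intro p hp hpq
        exact hilb_eq_one_of_not_dvd (prime_not_dvd_prime (hP p hp).1 hq hpq.1)
          (prime_not_dvd_prime (hP p hp).1 hl hpq.2)
      · intro h; exact absurd (hP' q hq hq2 (Or.inl dvd_rfl)) h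
      · intro h; exact absurd (hP' l hl hl2 (Or.inr dvd_rfl)) h

/-! ### Legendre's theorem on ternary forms -/

theorem isSquare_zmod_two (x : ZMod 2) : IsSquare x := by
  revert x; decide

/-- Chinese remainder theorem: the roots modulo the primes dividing n are glued one prime at a time.
-/
theorem isSquare_zmod_of_squarefree {n : ℕ} (hn : Squarefree n) {a : ℤ}
    (h : ∀ p : ℕ, p.Prime → p ∣ n → IsSquare (a : ZMod p)) : ∃ t : ℤ, (n : ℤ) ∣ t ^ 2 - a := by
  induction n using induction_on_primes with
  | zero => exact absurd hn not_squarefree_zero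
  | one => exact ⟨0, by simp⟩
  | prime_mul p n hp ih =>
    have hcop : Nat.Coprime p n := Nat.coprime_of_squarefree_mul hn
    obtain ⟨t, ht⟩ := ih hn.of_mul_right fun q hq hqn => h q hq (hqn.mul_left p)
    obtain ⟨c, hc⟩ := h p hp (dvd_mul_right p n)
    obtain ⟨c, rfl⟩ := ZMod.intCast_surjective c
    have hc' : (p : ℤ) ∣ c ^ 2 - a := by
      rw [← ZMod.intCast_zmod_eq_zero_iff_dvd]; push_cast; rw [hc]; ring
    obtain ⟨x, y, hxy⟩ := Int.isCoprime_iff_gcd_eq_one.2 (by simpa using hcop :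
      Int.gcd (p : ℤ) (n : ℤ) = 1)
    refine ⟨t + y * n * (c - t), ?_⟩
    push_cast
    refine IsCoprime.mul_dvd ⟨x, y, hxy⟩ ?_ ?_
    · have : (t + y * n * (c - t)) ^ 2 - a =
          (c ^ 2 - a) + p * (x * (t - c) * (t + y * n * (c - t) + c)) := by
        linear_combination (c - t) * (t + y * n * (c - t) + c) * hxy
      rw [this]
      exact dvd_add hc' (dvd_mul_right _ _)
    · have : (t + y * n * (c - t)) ^ 2 - a =
          (t ^ 2 - a) + n * (y * (c - t) * (t + y * n * (c - t) + t)) := by ring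
      rw [this]
      exact dvd_add ht (dvd_mul_right _ _)

/-- A residue class contains a representative of absolute value at most half the modulus. -/
theorem exists_small_residue (t : ℤ) {m : ℤ} (hm : 0 < m) :
    ∃ r : ℤ, m ∣ r - t ∧ 4 * r ^ 2 ≤ m ^ 2 := by
  have h1 := Int.emod_nonneg t hm.ne'
  have h2 := Int.emod_lt_of_pos t hm
  have h3 : m ∣ t % m - t := by
    rw [← dvd_neg, neg_sub]; exact Int.dvd_self_sub_emod
  by_cases h : 2 * (t % m) ≤ m
  · exact ⟨t % m, h3, by nlinarith⟩
  · refine ⟨t % m - m, ?_, by nlinarith⟩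
    rw [sub_right_comm]
    exact dvd_sub h3 dvd_rfl

/-- Legendre's theorem: the form `z² - a x² - b y²` is isotropic over `ℚ` if it is so over `ℝ` and
over `ℚ_p` for all odd `p`. -/
theorem exists_ternary_zero {a b : ℤ} (ha : a ≠ 0) (hb : b ≠ 0) (hpos : 0 < a ∨ 0 < b)
    (h : ∀ p : ℕ, p.Prime → p ≠ 2 → hilb p a b = 1) :
    ∃ x y z : ℤ, (x ≠ 0 ∨ y ≠ 0 ∨ z ≠ 0) ∧ z ^ 2 = a * x ^ 2 + b * y ^ 2 := by
  -- Descent on |a| + |b|, with |a| ≤ |b|. If b is squarefree, the local conditions make a a square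
  -- modulo b, so r² - a = b b' with |b'| < |b|. As b b' is a norm from ℚ(√a), b and b' have the
  -- same symbols with a, and a zero for b' gives one for b. A square factor of b is removed. Every
  -- integer is a square modulo 2, so no condition is needed there.
  obtain ⟨n, hn⟩ : ∃ n, a.natAbs + b.natAbs ≤ n := ⟨_, le_rfl⟩
  induction n generalizing a b with
  | zero => omega
  | succ n ih =>
  wlog hab : a.natAbs ≤ b.natAbs generalizing a b
  · obtain ⟨x, y, z, h0, h1⟩ := this hb ha hpos.symm
      (fun p hp h2 => by rw [hilb_comm]; exact h p hp h2) (by omega) (by omega)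
    exact ⟨y, x, z, by tauto, by rw [h1, add_comm]⟩
  by_cases hb1 : b.natAbs = 1
  · rcases hpos with h0 | h0
    · exact ⟨1, 0, 1, by simp, by rw [show a = 1 by omega]; ring⟩
    · exact ⟨0, 1, 1, by simp, by rw [show b = 1 by omega]; ring⟩
  by_cases hsq : Squarefree b.natAbs
  · obtain ⟨t, ht⟩ : ∃ t : ℤ, b ∣ t ^ 2 - a := by
      obtain ⟨t, ht⟩ := isSquare_zmod_of_squarefree hsq (a := a) (by
        intro p hp hpb
        have := Fact.mk hp
        rcases eq_or_ne p 2 with rfl | h2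
        · exact isSquare_zmod_two _
        by_cases hpa : (p : ℤ) ∣ a
        · rw [(ZMod.intCast_zmod_eq_zero_iff_dvd a p).2 hpa]; exact IsSquare.zero
        obtain ⟨k, w, hw, rfl⟩ := exists_eq_pow_mul hp hb
        have hk : k = 1 := by
          have h1 : k ≠ 0 := by
            rintro rfl
            rw [pow_zero, one_mul] at hpb
            exact hw (Int.natCast_dvd.2 hpb)
          by_contra hk1
          have : p * p ∣ ((p : ℤ) ^ k * w).natAbs := by
            rw [← Int.natCast_dvd]
            push_cast
            rw [← sq]
            exact (pow_dvd_pow _ (by omega)).mul_right _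
          exact hp.one_lt.ne' (Nat.isUnit_iff.1 (hsq p this))
        have h3 := h p hp h2
        rw [hk, pow_one, hilb_unit_mul hpa hw] at h3
        exact ZMod.isSquare_of_jacobiSym_eq_one h3)
      exact ⟨t, Int.natAbs_dvd.1 ht⟩
    obtain ⟨r, hr, hr2⟩ := exists_small_residue t (m := |b|) (abs_pos.2 hb)
    obtain ⟨b', hb'⟩ : b ∣ r ^ 2 - a := by
      have h1 : b ∣ r - t := (abs_dvd _ _).1 hr
      have h2 : r ^ 2 - a = (r - t) * (r + t) + (t ^ 2 - a) := by ring
      rw [h2]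
      exact dvd_add (h1.mul_right _) ht
    by_cases hb'0 : b' = 0
    · exact ⟨1, 0, r, by simp, by rw [hb'0] at hb'; linear_combination hb'⟩
    have ea := Int.abs_eq_natAbs a
    have eb := Int.abs_eq_natAbs b
    have eb' := Int.abs_eq_natAbs b'
    have hm : 2 ≤ |b| := by omega
    have hlt : |b'| < |b| := by
      have h1 : |b| * |b'| ≤ r ^ 2 + |a| := by
        rw [← abs_mul, ← hb']
        calc |r ^ 2 - a| ≤ |r ^ 2| + |a| := abs_sub _ _
          _ = r ^ 2 + |a| := by rw [abs_of_nonneg (sq_nonneg r)]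
      have h2 : |a| ≤ |b| := by omega
      -- Since |r| ≤ |b|/2, the inequality |b'| ≥ |b| would give b² ≤ b²/4 + |b|, impossible for |b|
      -- ≥ 2.
      by_contra hcon
      push Not at hcon
      rw [sq_abs] at hr2
      nlinarith [sq_abs b]
    have hpos' : 0 < a ∨ 0 < b' := by
      rcases hpos with h0 | h0
      · exact Or.inl h0
      · rcases lt_or_gt_of_ne ha with h1 | h1
        · right
          have : 0 < b * b' := by rw [← hb']; nlinarith [sq_nonneg r]
          exact pos_of_mul_pos_right this h0.le
        · exact Or.inl h1
    obtain ⟨x, y, z, h0, h1⟩ := ih ha hb'0 hpos' (by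
      intro p hp h2
      have := Fact.mk hp
      have h3 : hilb p a (b * b') = 1 := by
        refine hilb_eq_one_of_isIsotropic ha (mul_ne_zero hb hb'0) ⟨1, 1, r, by simp, ?_⟩
        rw [← hb']
        push_cast
        ring
      rwa [hilb_mul_right hp a hb hb'0, h p hp h2, one_mul] at h3) (by omega)
    by_cases hy : y = 0
    · exact ⟨x, 0, z, by rw [hy] at h0; simpa using h0, by rw [h1, hy]; ring⟩
    -- Coordinates of (z + x√a)(r + √a), whose norm is b' y² · b b' = b (b' y)².
    · exact ⟨z + r * x, b' * y, z * r + a * x, Or.inr (Or.inl (mul_ne_zero hb'0 hy)), by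
        linear_combination (r ^ 2 - a) * h1 + b' * y ^ 2 * hb'⟩
  · obtain ⟨c, hc, hc1⟩ : ∃ c : ℕ, c * c ∣ b.natAbs ∧ c ≠ 1 := by
      simpa [Squarefree] using hsq
    obtain ⟨b', rfl⟩ : ((c : ℤ) * c) ∣ b := by
      rw [← Int.dvd_natAbs]; exact_mod_cast hc
    have hc0 : (c : ℤ) ≠ 0 := by rintro h; simp [h] at hb
    have hb'0 : b' ≠ 0 := right_ne_zero_of_mul hb
    obtain ⟨x, y, z, h0, h1⟩ := ih ha hb'0
      (hpos.imp_right fun h => pos_of_mul_pos_right h (mul_self_nonneg _)) (by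
        intro p hp h2
        have := h p hp h2
        rwa [hilb_comm, hilb_mul_self_left hp hb'0 ha hc0, hilb_comm] at this) (by
        rw [Int.natAbs_mul, Int.natAbs_mul, Int.natAbs_natCast] at hn
        have h2 : 2 ≤ c := by have : c ≠ 0 := by exact_mod_cast hc0
                              omega
        have h3 : 0 < b'.natAbs := Int.natAbs_pos.2 hb'0
        have h4 : c * c * b'.natAbs ≥ 2 * b'.natAbs := Nat.mul_le_mul_right _ (by nlinarith)
        omega)
    refine ⟨c * x, y, c * z, ?_, by linear_combination (c : ℤ) ^ 2 * h1⟩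
    simp only [ne_eq, mul_eq_zero, hc0, false_or]
    exact h0

end BrandtZeroes

namespace BrandtZeroes
open scoped NumberTheorySymbols

/-! ### A common slot -/

/-- Two pairs of integers whose Hilbert symbols agree at all places other than an odd prime `l`
have the same Hilbert symbol at `l`. -/
theorem hilb_eq_of_forall_ne {a b c d : ℤ} (ha : a ≠ 0) (hb : b ≠ 0) (hc : c ≠ 0) (hd : d ≠ 0)
    {l : ℕ} (hl : l.Prime) (hl2 : l ≠ 2)
    (h : ∀ p : ℕ, p.Prime → p ≠ 2 → p ≠ l → hilb p a b = hilb p c d)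
    (htot : hilbTwo a b * hilbReal a b = hilbTwo c d * hilbReal c d) :
    hilb l a b = hilb l c d := by
  have hn : (a * b * (c * d)).natAbs ≠ 0 := by
    rw [Int.natAbs_ne_zero]; exact mul_ne_zero (mul_ne_zero ha hb) (mul_ne_zero hc hd)
  -- Both product formulas are read over one set of primes; after cancelling the equal nonzero
  -- factors only l remains.
  set P : Finset ℕ := insert l ((a * b * (c * d)).natAbs.primeFactors.erase 2) with hPdef
  have hP : ∀ p ∈ P, p.Prime ∧ p ≠ 2 := by
    intro p hp
    rw [hPdef, Finset.mem_insert, Finset.mem_erase, Nat.mem_primeFactors] at hp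
    rcases hp with rfl | hp
    · exact ⟨hl, hl2⟩
    · exact ⟨hp.2.1, hp.1⟩
  have hP' : ∀ p : ℕ, p.Prime → p ≠ 2 → (p : ℤ) ∣ a * b * (c * d) → p ∈ P := by
    intro p hp h2 h3
    rw [hPdef, Finset.mem_insert, Finset.mem_erase, Nat.mem_primeFactors]
    exact Or.inr ⟨h2, hp, Int.natCast_dvd.1 h3, hn⟩
  have e1 := productFormula ha hb P hP fun p hp h2 h3 => hP' p hp h2
    ((h3.elim (fun h => h.mul_right _) (fun h => h.mul_left _)).mul_right _)
  have e2 := productFormula hc hd P hP fun p hp h2 h3 => hP' p hp h2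
    ((h3.elim (fun h => h.mul_right _) (fun h => h.mul_left _)).mul_left _)
  have hlP : l ∈ P := Finset.mem_insert_self _ _
  rw [← Finset.mul_prod_erase P _ hlP] at e1 e2
  have e3 : ∏ p ∈ P.erase l, hilb p a b = ∏ p ∈ P.erase l, hilb p c d :=
    Finset.prod_congr rfl fun p hp => h p (hP p (Finset.mem_of_mem_erase hp)).1
      (hP p (Finset.mem_of_mem_erase hp)).2 (Finset.ne_of_mem_erase hp)
  rw [e3, htot, ← e2] at e1
  refine mul_right_cancel₀ ?_ e1
  rw [Finset.prod_ne_zero_iff]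
  intro p hp
  rcases hilb_eq_or (hP p (Finset.mem_of_mem_erase hp)).1 hc hd with h | h <;> rw [h] <;> norm_num

/-- The integer `a` is a square in `ℚ_p`, for odd `p`. -/
def IsLocalSquare (p : ℕ) (a : ℤ) : Prop := Even (padicValInt p a) ∧ J(unitPart p a | p) = 1

theorem not_isLocalSquare_of_hilb {p : ℕ} {a b : ℤ} (h : hilb p a b = -1)
    (hp : p.Prime) (hb : b ≠ 0) : ¬ IsLocalSquare p a := by
  rintro ⟨h1, h2⟩
  rw [hilb, h2, one_pow, mul_one, pow_mul] at h
  have e1 := jacobiSym_eq_or hp (not_dvd_neg_one hp)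
  have e2 := jacobiSym_eq_or hp (not_dvd_unitPart hp hb)
  have e3 : J(-1 | p) ^ padicValInt p a = 1 := by
    rcases e1 with e | e <;> rw [e]
    · exact one_pow _
    · exact h1.neg_one_pow
  have e4 : J(unitPart p b | p) ^ padicValInt p a = 1 := by
    rcases e2 with e | e <;> rw [e]
    · exact one_pow _
    · exact h1.neg_one_pow
  rw [e3, e4] at h
  norm_num at h

/-- Two local non-squares have nontrivial Hilbert symbol with a common element. -/
theorem exists_local_slot {p : ℕ} (hp : p.Prime) {a d : ℤ} (ha : a ≠ 0) (hd : d ≠ 0)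
    (ha' : ¬ IsLocalSquare p a) (hd' : ¬ IsLocalSquare p d) :
    ∃ (e : ℕ) (η : ℤ), (η = 1 ∨ η = -1) ∧ ∀ u : ℤ, ¬ (p : ℤ) ∣ u → J(u | p) = η →
      hilb p (p ^ e * u) a = -1 ∧ hilb p (p ^ e * u) d = -1 := by
  obtain ⟨k, w, hw, rfl⟩ := exists_eq_pow_mul hp ha
  obtain ⟨l, v, hv, rfl⟩ := exists_eq_pow_mul hp hd
  rw [IsLocalSquare, padicValInt_pow_mul hp _ hw, unitPart_pow_mul hp _ hw] at ha'
  rw [IsLocalSquare, padicValInt_pow_mul hp _ hv, unitPart_pow_mul hp _ hv] at hd'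
  have key : ∀ {x : ℤ} {n : ℕ}, (x = 1 ∨ x = -1) → Even n → x ^ n = 1 := by
    rintro x n (rfl | rfl) hn
    · exact one_pow n
    · exact hn.neg_one_pow
  have key' : ∀ {x : ℤ} {n : ℕ}, (x = 1 ∨ x = -1) → ¬ Even n → x ^ n = x := by
    rintro x n (rfl | rfl) hn
    · exact one_pow n
    · exact (Nat.not_even_iff_odd.1 hn).neg_one_pow
  have hm := jacobiSym_eq_or hp (not_dvd_neg_one hp)
  have hJw := jacobiSym_eq_or hp hw
  have hJv := jacobiSym_eq_or hp hv
  -- For odd p, ℚ_p^× modulo squares is a Klein four-group on which (·, a) and (·, d) are nontrivial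
  -- characters, so both are -1 at some class p^e u. If a and d have even valuation, any u with
  -- symbol 1 may accompany p. If exactly one valuation is odd, that entry dictates η for p u. If
  -- both are odd, a nonsquare unit works.
  by_cases hk : Even k <;> by_cases hl : Even l
  · refine ⟨1, 1, Or.inl rfl, fun u hu hJ => ?_⟩
    have hJu := jacobiSym_eq_or hp hu
    rw [hilb_pow_mul hp _ _ hu hw, hilb_pow_mul hp _ _ hu hv, one_mul, one_mul, key hm hk,
      key hm hl, key hJu hk, key hJu hl]
    simp only [hk, hl, true_and] at ha' hd'
    rw [hJw.resolve_left ha', hJv.resolve_left hd']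
    norm_num
  · refine ⟨1, -(J(-1 | p) * J(v | p)), ?_, fun u hu hJ => ?_⟩
    · rcases hm with h | h <;> rcases hJv with h' | h' <;> simp [h, h']
    have hJu := jacobiSym_eq_or hp hu
    rw [hilb_pow_mul hp _ _ hu hw, hilb_pow_mul hp _ _ hu hv, one_mul, one_mul, key hm hk,
      key' hm hl, key hJu hk, key' hJu hl]
    simp only [hk, true_and] at ha'
    rw [hJw.resolve_left ha', hJ]
    rcases hm with h | h <;> rcases hJv with h' | h' <;> simp [h, h']
  · refine ⟨1, -(J(-1 | p) * J(w | p)), ?_, fun u hu hJ => ?_⟩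
    · rcases hm with h | h <;> rcases hJw with h' | h' <;> simp [h, h']
    have hJu := jacobiSym_eq_or hp hu
    rw [hilb_pow_mul hp _ _ hu hw, hilb_pow_mul hp _ _ hu hv, one_mul, one_mul, key' hm hk,
      key hm hl, key' hJu hk, key hJu hl]
    simp only [hl, true_and] at hd'
    rw [hJv.resolve_left hd', hJ]
    rcases hm with h | h <;> rcases hJw with h' | h' <;> simp [h, h']
  · refine ⟨0, -1, Or.inr rfl, fun u hu hJ => ?_⟩
    have hJu := jacobiSym_eq_or hp hu
    rw [hilb_pow_mul hp _ _ hu hw, hilb_pow_mul hp _ _ hu hv, key' hJu hk, key' hJu hl, hJ]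
    simp

theorem exists_jacobiSym_eq {p : ℕ} (hp : p.Prime) (h2 : p ≠ 2) {η : ℤ} (hη : η = 1 ∨ η = -1) :
    ∃ c : ℤ, J(c | p) = η := by
  have := Fact.mk hp
  rcases hη with rfl | rfl
  · exact ⟨1, jacobiSym.one_left p⟩
  · obtain ⟨x, hx⟩ := FiniteField.exists_nonsquare (F := ZMod p) (by rwa [ringChar.eq (ZMod p) p])
    obtain ⟨c, rfl⟩ := ZMod.intCast_surjective x
    exact ⟨c, ZMod.nonsquare_iff_jacobiSym_eq_neg_one.2 hx⟩

theorem exists_int_jacobiSym_eq (c₀ : ℤ) (κ : ℕ → ℤ) (T : Finset ℕ)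
    (hT : ∀ p ∈ T, p.Prime ∧ p ≠ 2 ∧ (κ p = 1 ∨ κ p = -1)) :
    ∃ c : ℤ, (8 : ℤ) ∣ c - c₀ ∧ ∀ p ∈ T, J(c | p) = κ p := by
  induction T using Finset.induction_on with
  | empty => exact ⟨c₀, by simp, by simp⟩
  | insert q T hq ih =>
    obtain ⟨c, hc, hcT⟩ := ih fun p hp => hT p (Finset.mem_insert_of_mem hp)
    obtain ⟨hqp, hq2, hκ⟩ := hT q (Finset.mem_insert_self q T)
    obtain ⟨r, hr⟩ := exists_jacobiSym_eq hqp hq2 hκ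
    have hcop : IsCoprime (8 * ∏ p ∈ T, (p : ℤ)) (q : ℤ) := by
      refine IsCoprime.mul_left ?_ (IsCoprime.prod_left fun p hp => ?_)
      · rw [show (8 : ℤ) = 2 ^ 3 by norm_num]
        refine IsCoprime.pow_left ?_
        exact_mod_cast (Nat.coprime_primes Nat.prime_two hqp).2 hq2.symm
      · have h1 := (hT p (Finset.mem_insert_of_mem hp)).1
        exact_mod_cast (Nat.coprime_primes h1 hqp).2 (by rintro rfl; exact hq hp)
    obtain ⟨x, y, hxy⟩ := hcop
    refine ⟨c + x * (8 * ∏ p ∈ T, (p : ℤ)) * (r - c), ?_, ?_⟩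
    · have : c + x * (8 * ∏ p ∈ T, (p : ℤ)) * (r - c) - c₀ =
        (c - c₀) + 8 * (x * (∏ p ∈ T, (p : ℤ)) * (r - c)) := by ring
      rw [this]
      exact dvd_add hc (dvd_mul_right _ _)
    · intro p hp
      rcases Finset.mem_insert.1 hp with rfl | hp
      · rw [← hr]
        refine jacobiSym.mod_left' (Int.ModEq.symm ((Int.modEq_iff_dvd).2 ⟨y * (c - r), ?_⟩))
        linear_combination (r - c) * hxy
      · rw [← hcT p hp]
        refine jacobiSym.mod_left' (Int.ModEq.symm ((Int.modEq_iff_dvd).2 ?_))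
        rw [add_sub_cancel_left]
        exact (((Finset.dvd_prod_of_mem (fun p : ℕ => (p : ℤ)) hp).mul_left 8).mul_left x).mul_right _

/-- The Chinese remainder theorem gives a residue class, invertible because c₀ is odd and the
prescribed symbols are nonzero; Dirichlet's theorem gives a prime in it. -/
theorem exists_prime_jacobiSym_eq {c₀ : ℤ} (hc₀ : ¬ (2 : ℤ) ∣ c₀) (κ : ℕ → ℤ) (T : Finset ℕ)
    (hT : ∀ p ∈ T, p.Prime ∧ p ≠ 2 ∧ (κ p = 1 ∨ κ p = -1)) (B : ℕ) :
    ∃ l : ℕ, l.Prime ∧ B < l ∧ (8 : ℤ) ∣ l - c₀ ∧ ∀ p ∈ T, J(l | p) = κ p := by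
  obtain ⟨c, hc8, hcT⟩ := exists_int_jacobiSym_eq c₀ κ T hT
  have hT0 : ∀ p ∈ T, p ≠ 0 := fun p hp => (hT p hp).1.ne_zero
  have : NeZero (8 * ∏ p ∈ T, p) := ⟨mul_ne_zero (by norm_num) (Finset.prod_ne_zero_iff.2 hT0)⟩
  have hunit : IsUnit ((c : ℤ) : ZMod (8 * ∏ p ∈ T, p)) := by
    rw [ZMod.coe_int_isUnit_iff_isCoprime]
    refine IsCoprime.symm ?_
    push_cast
    refine IsCoprime.mul_right ?_ (IsCoprime.prod_right fun p hp => ?_)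
    · rw [show (8 : ℤ) = 2 ^ 3 by norm_num]
      obtain ⟨k, hk⟩ : ∃ k, c = 2 * k + 1 := ⟨c / 2, by omega⟩
      exact IsCoprime.pow_right ⟨1, -k, by rw [hk]; ring⟩
    · have h1 : J(c | p) ≠ 0 := by
        rw [hcT p hp]; rcases (hT p hp).2.2 with h | h <;> rw [h] <;> norm_num
      rw [Int.isCoprime_iff_gcd_eq_one]
      by_contra h2
      exact h1 (jacobiSym.eq_zero_iff.2 ⟨hT0 p hp, h2⟩)
  obtain ⟨l, hlB, hl, hlc⟩ := Nat.forall_exists_prime_gt_and_eq_mod hunit B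
  have hdvd : ((8 * ∏ p ∈ T, p : ℕ) : ℤ) ∣ l - c := by
    rw [← ZMod.intCast_zmod_eq_zero_iff_dvd]; push_cast
    rw [sub_eq_zero]
    exact_mod_cast hlc
  push_cast at hdvd
  refine ⟨l, hl, hlB, ?_, fun p hp => ?_⟩
  · have := dvd_add ((dvd_mul_right _ _).trans hdvd) hc8
    rwa [sub_add_sub_cancel] at this
  · rw [← hcT p hp]
    refine jacobiSym.mod_left' (Int.ModEq.symm ((Int.modEq_iff_dvd).2 ?_))
    exact ((Finset.dvd_prod_of_mem (fun p : ℕ => (p : ℤ)) hp).mul_left 8).trans hdvd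

/-- If `(a, b)` is ramified exactly at the primes dividing `N` and the real place, and `d < 0` is
not a square at the primes dividing `N`, then some `s < 0` has the symbols of `(a, b)` with both
`a` and `d` at all odd primes. -/
theorem exists_common_slot {a b d : ℤ} (ha : a < 0) (hb : b < 0) (hd : d < 0) {N : ℕ} (hN : Odd N)
    (hab : ∀ p : ℕ, p.Prime → p ≠ 2 → hilb p a b = if p ∣ N then -1 else 1)
    (hab2 : hilbTwo a b = 1) (hdN : ∀ p : ℕ, p.Prime → p ∣ N → ¬ IsLocalSquare p d) :
    ∃ s : ℤ, s < 0 ∧ ∀ p : ℕ, p.Prime → p ≠ 2 →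
      hilb p s a = hilb p a b ∧ hilb p s d = hilb p a b := by
  -- The witness is s = -M l. The factor M carries the exponents e_q of the local slots at q ∣ N,
  -- and the auxiliary prime l makes the unit part of s have symbol η_p at all odd p ∣ a d N.
  -- Moreover l ≡ -M mod 8, so s ≡ M² ≡ 1 is harmless at 2. The only uncontrolled place is l, where
  -- the product formula decides.
  have hN0 : N ≠ 0 := by rintro rfl; simp at hN
  have hodd : ∀ p : ℕ, p.Prime → p ∣ N → p ≠ 2 := by
    rintro p hp hpN rfl
    exact (Nat.not_even_iff_odd.2 hN) (even_iff_two_dvd.2 hpN)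
  have hloc : ∀ p : ℕ, ∃ (e : ℕ) (η : ℤ), (η = 1 ∨ η = -1) ∧ (p.Prime → p ∣ N → ∀ u : ℤ,
      ¬ (p : ℤ) ∣ u → J(u | p) = η → hilb p (p ^ e * u) a = -1 ∧ hilb p (p ^ e * u) d = -1) ∧
      (¬ p ∣ N → e = 0 ∧ η = 1) := by
    intro p
    by_cases h : p.Prime ∧ p ∣ N
    · have h1 : ¬ IsLocalSquare p a := not_isLocalSquare_of_hilb
        (by rw [hab p h.1 (hodd p h.1 h.2), if_pos h.2]) h.1 hb.ne
      obtain ⟨e, η, hη, H⟩ := exists_local_slot h.1 ha.ne hd.ne h1 (hdN p h.1 h.2)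
      exact ⟨e, η, hη, fun _ _ => H, fun h' => absurd h.2 h'⟩
    · exact ⟨0, 1, Or.inl rfl, fun h1 h2 => absurd ⟨h1, h2⟩ h, fun _ => ⟨rfl, rfl⟩⟩
  choose e η hη hslot hout using hloc
  set Q := N.primeFactors with hQ
  let m : ℕ → ℤ := fun p => ∏ q ∈ Q.erase p, (q : ℤ) ^ e q
  have hmdvd : ∀ p : ℕ, p.Prime → ¬ (p : ℤ) ∣ m p := by
    intro p hp h
    obtain ⟨q, hq, hpq⟩ := (Nat.prime_iff_prime_int.1 hp).exists_mem_finset_dvd h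
    have h1 := (Nat.prime_iff_prime_int.1 hp).dvd_of_dvd_pow hpq
    exact prime_not_dvd_prime hp (Nat.prime_of_mem_primeFactors (Finset.mem_of_mem_erase hq))
      (Finset.ne_of_mem_erase hq).symm h1
  have hmall : ∀ p : ℕ, p.Prime → (∏ q ∈ Q, (q : ℤ) ^ e q) = p ^ e p * m p := by
    intro p hp
    by_cases hpN : p ∣ N
    · exact (Finset.mul_prod_erase Q (fun q : ℕ => (q : ℤ) ^ e q)
        (Nat.mem_primeFactors.2 ⟨hp, hpN, hN0⟩)).symm
    · have : p ∉ Q := fun h => hpN (Nat.dvd_of_mem_primeFactors h)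
      rw [(hout p hpN).1, pow_zero, one_mul]
      simp only [m]
      rw [Finset.erase_eq_of_notMem this]
  set M := ∏ q ∈ Q, (q : ℤ) ^ e q with hM
  have hMpos : 0 < M := Finset.prod_pos fun q hq => pow_pos
    (by exact_mod_cast (Nat.prime_of_mem_primeFactors hq).pos) _
  have hM2 : ¬ (2 : ℤ) ∣ M := by
    have h2 := hmdvd 2 Nat.prime_two
    have h3 := hmall 2 Nat.prime_two
    have h4 : ¬ 2 ∣ N := fun h => hodd 2 Nat.prime_two h rfl
    rw [(hout 2 h4).1, pow_zero, one_mul] at h3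
    rw [h3]
    exact_mod_cast h2
  have hX0 : (a * d * N : ℤ) ≠ 0 :=
    mul_ne_zero (mul_ne_zero ha.ne hd.ne) (by exact_mod_cast hN0)
  set T := (a * d * N : ℤ).natAbs.primeFactors.erase 2 with hT
  have hTmem : ∀ p ∈ T, p.Prime ∧ p ≠ 2 := fun p hp =>
    ⟨Nat.prime_of_mem_primeFactors (Finset.mem_of_mem_erase hp), Finset.ne_of_mem_erase hp⟩
  have hmemT : ∀ p : ℕ, p.Prime → p ≠ 2 → (p : ℤ) ∣ a * d * N → p ∈ T := fun p hp h2 h3 =>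
    Finset.mem_erase.2 ⟨h2, Nat.mem_primeFactors.2 ⟨hp, Int.natCast_dvd.1 h3,
      Int.natAbs_ne_zero.2 hX0⟩⟩
  have hmJ : ∀ p : ℕ, p.Prime → J(-m p | p) = 1 ∨ J(-m p | p) = -1 := fun p hp =>
    jacobiSym_eq_or hp (by rw [dvd_neg]; exact hmdvd p hp)
  obtain ⟨l, hl, hlB, hl8, hlT⟩ := exists_prime_jacobiSym_eq (c₀ := -M) (by rwa [dvd_neg])
    (fun p => η p * J(-m p | p)) T (fun p hp => ⟨(hTmem p hp).1, (hTmem p hp).2, by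
      rcases hη p with h | h <;> rcases hmJ p (hTmem p hp).1 with h' | h' <;> simp [h, h']⟩)
    (max 2 (a * d * N : ℤ).natAbs)
  have hl2 : l ≠ 2 := by have := le_max_left 2 (a * d * N : ℤ).natAbs; omega
  have hlX : ¬ (l : ℤ) ∣ a * d * N := by
    intro h
    have h1 := Nat.le_of_dvd (Int.natAbs_pos.2 hX0) (Int.natCast_dvd.1 h)
    have := le_max_right 2 (a * d * N : ℤ).natAbs
    omega
  have hlN : ¬ l ∣ N := fun h => hlX ((Int.natCast_dvd_natCast.2 h).mul_left _)
  have hs : ∀ p : ℕ, p.Prime → -(M * l) = p ^ e p * (-m p * l) := by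
    intro p hp; rw [hmall p hp]; ring
  have hu : ∀ p : ℕ, p.Prime → p ≠ l → ¬ (p : ℤ) ∣ -m p * l := fun p hp hpl =>
    not_dvd_mul hp (by rw [dvd_neg]; exact hmdvd p hp) (prime_not_dvd_prime hp hl hpl)
  have hJ : ∀ p ∈ T, J(-m p * l | p) = η p := by
    intro p hp
    rw [jacobiSym.mul_left, hlT p hp]
    rcases hmJ p (hTmem p hp).1 with h' | h' <;> simp [h']
  have hs0 : -(M * l) < 0 := by
    have : (0 : ℤ) < l := by exact_mod_cast hl.pos
    nlinarith
  have hs8 : (-(M * l)) % 8 = 1 := by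
    have h1 : (8 : ℤ) ∣ M ^ 2 - 1 := by
      have : M % 8 = 1 ∨ M % 8 = 3 ∨ M % 8 = 5 ∨ M % 8 = 7 := by omega
      rw [← Int.emod_emod_of_dvd _ (dvd_refl (8 : ℤ)), Int.dvd_iff_emod_eq_zero] at *
      rcases this with h | h | h | h <;> simp [sq, Int.sub_emod, Int.mul_emod, h]
    have h2 : -(M * l) = 1 + (M ^ 2 - 1) - M * (l - -M) := by ring
    have h3 : (8 : ℤ) ∣ -(M * l) - 1 := by
      have : -(M * l) - 1 = (M ^ 2 - 1) - M * (l - -M) := by ring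
      rw [this]
      exact dvd_sub h1 (hl8.mul_left M)
    omega
  have hunit : ∀ p : ℕ, p.Prime → p ≠ 2 → p ≠ l → ¬ p ∣ N → ∀ x : ℤ, x ≠ 0 → x ∣ a * d →
      hilb p (-(M * l)) x = 1 := by
    intro p hp h2 hpl hpN x hx hxad
    have h1 := hs p hp
    rw [(hout p hpN).1, pow_zero, one_mul] at h1
    rw [h1]
    by_cases hpx : (p : ℤ) ∣ x
    -- Here p ∤ N, so e_p = 0 and η_p = 1: s is a unit and a square modulo p.
    · have h3 := hJ p (hmemT p hp h2 ((hpx.trans hxad).mul_right _))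
      rw [(hout p hpN).2] at h3
      obtain ⟨k, w, hw, rfl⟩ := exists_eq_pow_mul hp hx
      have := hilb_pow_mul hp 0 k (hu p hp hpl) hw
      rw [pow_zero, one_mul] at this
      rw [this, h3]
      simp
    · exact hilb_eq_one_of_not_dvd (hu p hp hpl) hpx
  have hgen : ∀ p : ℕ, p.Prime → p ≠ 2 → p ≠ l →
      hilb p (-(M * l)) a = hilb p a b ∧ hilb p (-(M * l)) d = hilb p a b := by
    intro p hp h2 hpl
    rw [hab p hp h2]
    by_cases hpN : p ∣ N
    · rw [if_pos hpN, hs p hp]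
      exact hslot p hp hpN _ (hu p hp hpl)
        (hJ p (hmemT p hp h2 ((Int.natCast_dvd_natCast.2 hpN).mul_left _)))
    · rw [if_neg hpN]
      exact ⟨hunit p hp h2 hpl hpN a ha.ne (dvd_mul_right _ _),
        hunit p hp h2 hpl hpN d hd.ne (dvd_mul_left _ _)⟩
  refine ⟨-(M * l), hs0, fun p hp h2 => ?_⟩
  by_cases hpl : p = l
  · subst hpl
    constructor
    · refine hilb_eq_of_forall_ne hs0.ne ha.ne ha.ne hb.ne hp h2
        (fun q hq hq2 hql => (hgen q hq hq2 hql).1) ?_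
      rw [hab2, hilbTwo_eq_one_of_one_mod_eight hs8, hilbReal, hilbReal, if_pos ⟨hs0, ha⟩,
        if_pos ⟨ha, hb⟩]
    · refine hilb_eq_of_forall_ne hs0.ne hd.ne ha.ne hb.ne hp h2
        (fun q hq hq2 hql => (hgen q hq hq2 hql).2) ?_
      rw [hab2, hilbTwo_eq_one_of_one_mod_eight hs8, hilbReal, hilbReal, if_pos ⟨hs0, hd⟩,
        if_pos ⟨ha, hb⟩]
  · exact hgen p hp h2 hpl

end BrandtZeroes

namespace BrandtZeroes

/-! ### Base change of quaternion algebras -/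

section BaseChange
variable (K : Type*) [Field K] [Algebra ℚ K] (a b : ℚ)

/-- The base change `ℍ[K, a, b]` of `ℍ[ℚ, a, b]`. -/
abbrev QuatOver : Type _ := ℍ[K, algebraMap ℚ K a, algebraMap ℚ K b]

/-- The coordinatewise inclusion of `ℍ[ℚ, a, b]` into its base change to `K`. -/
def quatMap : ℍ[ℚ, a, b] →ₐ[ℚ] QuatOver K a b where
  toFun x := ⟨algebraMap ℚ K x.re, algebraMap ℚ K x.imI, algebraMap ℚ K x.imJ,
    algebraMap ℚ K x.imK⟩
  map_one' := by ext <;> simp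
  map_zero' := by ext <;> simp
  map_add' x y := by ext <;> simp [-eq_ratCast]
  map_mul' x y := by ext <;> simp [-eq_ratCast]
  commutes' r := by
    rw [IsScalarTower.algebraMap_apply ℚ K (QuatOver K a b)]
    ext <;> simp [QuaternionAlgebra.algebraMap_eq]

variable {B : Type*} [Ring B] [Algebra ℚ B] {a b}

/-- The `K`-algebra map from the base change of `B` to `ℍ[K, a, b]`. -/
noncomputable def baseChangeHom (e : B ≃ₐ[ℚ] ℍ[ℚ, a, b]) : K ⊗[ℚ] B →ₐ[K] QuatOver K a b :=
  Algebra.TensorProduct.lift (Algebra.ofId K (QuatOver K a b)) ((quatMap K a b).comp e.toAlgHom)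
    (fun x _ => show Commute _ _ from Algebra.commutes x _)

theorem baseChangeHom_tmul (e : B ≃ₐ[ℚ] ℍ[ℚ, a, b]) (x : K) (y : B) :
    baseChangeHom K e (x ⊗ₜ y) = x • quatMap K a b (e y) := by
  exact (Algebra.TensorProduct.lift_tmul _ _ _ x y).trans (Algebra.smul_def _ _).symm

theorem baseChangeHom_bijective (e : B ≃ₐ[ℚ] ℍ[ℚ, a, b]) : Function.Bijective (baseChangeHom K e) := by
  have hfin : Module.Finite ℚ B := Module.Finite.equiv e.toLinearEquiv.symm
  have hsurj : Function.Surjective (baseChangeHom K e) := by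
    intro x
    refine ⟨x.re ⊗ₜ e.symm 1 + x.imI ⊗ₜ e.symm ⟨0, 1, 0, 0⟩ + x.imJ ⊗ₜ e.symm ⟨0, 0, 1, 0⟩ +
      x.imK ⊗ₜ e.symm ⟨0, 0, 0, 1⟩, ?_⟩
    simp only [map_add, baseChangeHom_tmul, AlgEquiv.apply_symm_apply]
    ext <;> simp [quatMap]
  refine ⟨?_, hsurj⟩
  have hrank : Module.finrank K (K ⊗[ℚ] B) = Module.finrank K (QuatOver K a b) := by
    rw [Module.finrank_baseChange, e.toLinearEquiv.finrank_eq, QuaternionAlgebra.finrank_eq_four,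
      QuaternionAlgebra.finrank_eq_four]
  exact (LinearMap.injective_iff_surjective_of_finrank_eq_finrank hrank
    (f := (baseChangeHom K e).toLinearMap)).2 hsurj

/-- `B` is ramified over `K` if and only if the norm form of `ℍ[K, a, b]` is anisotropic. -/
theorem isRamifiedOver_iff (e : B ≃ₐ[ℚ] ℍ[ℚ, a, b]) :
    IsRamifiedOver K B ↔ ∀ x : QuatOver K a b, x * star x = 0 → x = 0 := by
  have hbij := baseChangeHom_bijective K e
  constructor
  · intro h x hx
    by_contra hx0
    obtain ⟨y, rfl⟩ := hbij.2 x
    have hy : y ≠ 0 := by rintro rfl; exact hx0 (map_zero _)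
    have h1 := ((h y hy).map (baseChangeHom K e)).mul_right_eq_zero.1 hx
    exact hx0 (star_eq_zero.1 h1)
  · intro h y hy
    have hx : baseChangeHom K e y ≠ 0 := fun h0 => hy (hbij.1 (h0.trans (map_zero _).symm))
    set x := baseChangeHom K e y with hxdef
    obtain ⟨n, hn⟩ : ∃ n : K, x * star x = (n : QuatOver K a b) :=
      ⟨_, QuaternionAlgebra.mul_star_eq_coe x⟩
    have hn0 : n ≠ 0 := by
      rintro rfl
      exact hx (h x (hn.trans QuaternionAlgebra.coe_zero))
    have hn' : star x * x = (n : QuatOver K a b) :=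
      (QuaternionAlgebra.instIsStarNormal x).star_comm_self.trans hn
    obtain ⟨w, hw⟩ := hbij.2 (n⁻¹ • star x)
    have key : x * (n⁻¹ • star x) = 1 := by
      rw [mul_smul_comm, hn, QuaternionAlgebra.smul_coe, inv_mul_cancel₀ hn0,
        QuaternionAlgebra.coe_one]
    have key' : (n⁻¹ • star x) * x = 1 := by
      rw [smul_mul_assoc, hn', QuaternionAlgebra.smul_coe, inv_mul_cancel₀ hn0,
        QuaternionAlgebra.coe_one]
    refine ⟨⟨y, w, hbij.1 ?_, hbij.1 ?_⟩, rfl⟩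
    · rw [map_mul, map_one, hw]; exact key
    · rw [map_mul, map_one, hw]; exact key'

theorem mul_star_eq {R : Type*} [CommRing R] {c d : R} (x : ℍ[R, c, d]) :
    x * star x = ((x.re ^ 2 - c * x.imI ^ 2 - d * x.imJ ^ 2 + c * d * x.imK ^ 2 : R) :
      ℍ[R, c, d]) := by
  rw [QuaternionAlgebra.mul_star_eq_coe]
  congr 1
  simp
  ring

/-- The norm form of `(c, d)` is isotropic if and only if `z² - c x² - d y²` is. -/
theorem not_anisotropic_iff {F : Type*} [Field F] {c d : F} :
    (¬ ∀ x : ℍ[F, c, d], x * star x = 0 → x = 0) ↔ IsIsotropic F c d := by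
  simp only [mul_star_eq]
  constructor
  · intro h
    push Not at h
    obtain ⟨x, hx, hx0⟩ := h
    replace hx := QuaternionAlgebra.coe_injective (hx.trans QuaternionAlgebra.coe_zero.symm)
    -- The equation equates the norm of re + imI √c with d times the norm of imJ + imK √c. If the
    -- latter vanishes, either c is a square or imJ = imK = 0. Otherwise the product of the two
    -- elements has norm d times a nonzero square.
    by_cases hd : x.imJ ^ 2 - c * x.imK ^ 2 = 0
    · by_cases hd' : x.imK = 0
      · have hj : x.imJ = 0 := by rw [hd'] at hd; simpa using hd
        rw [hd', hj] at hx
        refine ⟨x.imI, 0, x.re, ?_, by linear_combination hx⟩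
        by_contra hcon
        push Not at hcon
        exact hx0 (by ext <;> simp [hd', hj, hcon])
      · exact ⟨x.imK, 0, x.imJ, Or.inl hd', by linear_combination hd⟩
    · refine ⟨x.re * x.imK + x.imI * x.imJ, x.imJ ^ 2 - c * x.imK ^ 2,
        x.re * x.imJ + c * x.imI * x.imK, Or.inr (Or.inl hd), ?_⟩
      linear_combination (x.imJ ^ 2 - c * x.imK ^ 2) * hx
  · rintro ⟨x, y, z, h0, h⟩ hcon
    have := hcon ⟨z, x, y, 0⟩ (by
      rw [← QuaternionAlgebra.coe_zero]
      congr 1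
      linear_combination h)
    have h1 := congrArg QuaternionAlgebra.re this
    have h2 := congrArg QuaternionAlgebra.imI this
    have h3 := congrArg QuaternionAlgebra.imJ this
    simp at h1 h2 h3
    tauto

/-- `B ≃ (a, b)` is unramified over `K` if and only if `z² - a x² - b y²` is isotropic over `K`. -/
theorem not_isRamifiedOver_iff (e : B ≃ₐ[ℚ] ℍ[ℚ, a, b]) :
    ¬ IsRamifiedOver K B ↔ IsIsotropic K (algebraMap ℚ K a) (algebraMap ℚ K b) := by
  rw [isRamifiedOver_iff K e, not_anisotropic_iff]

end BaseChange

/-! ### Definite quaternion algebras: reduced trace and norm -/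

/-- The canonical involution, reduced trace and positive definite reduced norm of a definite
quaternion algebra over `ℚ`. -/
class DefiniteQuaternion (B : Type*) [Ring B] [Algebra ℚ B] where
  finite : Module.Finite ℚ B
  nontrivial : Nontrivial B
  /-- the canonical involution -/
  conj : B →ₗ[ℚ] B
  /-- the reduced trace -/
  trd : B →ₗ[ℚ] ℚ
  /-- the reduced norm -/
  nrd : B → ℚ
  conj_one : conj 1 = 1
  conj_conj : ∀ x, conj (conj x) = x
  conj_mul : ∀ x y, conj (x * y) = conj y * conj x
  add_conj : ∀ x, x + conj x = algebraMap ℚ B (trd x)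
  mul_conj : ∀ x, x * conj x = algebraMap ℚ B (nrd x)
  nrd_pos : ∀ x, x ≠ 0 → 0 < nrd x

/-- A quaternion algebra `(a, b)` with `a, b < 0` is definite. -/
@[reducible]
noncomputable def DefiniteQuaternion.ofEquiv {B : Type*} [Ring B] [Algebra ℚ B] {a b : ℚ}
    (e : B ≃ₐ[ℚ] ℍ[ℚ, a, b]) (ha : a < 0) (hb : b < 0) : DefiniteQuaternion B where
  finite := Module.Finite.equiv e.toLinearEquiv.symm
  nontrivial := e.toEquiv.nontrivial
  conj :=
    { toFun := fun x => e.symm (star (e x))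
      map_add' := fun x y => by simp
      map_smul' := fun r x => by simp }
  trd := 2 • (QuaternionAlgebra.reₗ a 0 b ∘ₗ e.toLinearMap)
  nrd x := (e x * star (e x)).re
  conj_one := by simp
  conj_conj x := by simp
  conj_mul x y := by simp
  add_conj x := by
    apply e.injective
    simp [QuaternionAlgebra.self_add_star']
  mul_conj x := by
    apply e.injective
    simp only [LinearMap.coe_mk, AddHom.coe_mk, map_mul, AlgEquiv.apply_symm_apply, AlgEquiv.commutes]
    exact QuaternionAlgebra.mul_star_eq_coe _
  nrd_pos x hx := by
    have hx' : e x ≠ 0 := by simpa using hx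
    generalize e x = y at hx'
    rw [mul_star_eq, QuaternionAlgebra.re_coe]
    have hab : 0 < a * b := mul_pos_of_neg_of_neg ha hb
    by_contra hcon
    have h1 := sq_nonneg y.re
    have h2 := mul_nonneg (neg_nonneg.2 ha.le) (sq_nonneg y.imI)
    have h3 := mul_nonneg (neg_nonneg.2 hb.le) (sq_nonneg y.imJ)
    have h4 := mul_nonneg hab.le (sq_nonneg y.imK)
    have e1 : y.re = 0 := pow_eq_zero_iff (two_ne_zero) |>.1 (by linarith)
    have e2 : y.imI = 0 := by
      have : -a * y.imI ^ 2 = 0 := by linarith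
      simpa [ha.ne] using this
    have e3 : y.imJ = 0 := by
      have : -b * y.imJ ^ 2 = 0 := by linarith
      simpa [hb.ne] using this
    have e4 : y.imK = 0 := by
      have : a * b * y.imK ^ 2 = 0 := by linarith
      simpa [ha.ne, hb.ne] using this
    exact hx' (by ext <;> simp [e1, e2, e3, e4])

namespace DefiniteQuaternion
attribute [instance] DefiniteQuaternion.finite DefiniteQuaternion.nontrivial

variable {B : Type*} [Ring B] [Algebra ℚ B] [DefiniteQuaternion B]

theorem algebraMap_inj {r s : ℚ} : algebraMap ℚ B r = algebraMap ℚ B s ↔ r = s :=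
  (algebraMap ℚ B).injective.eq_iff

theorem conj_eq (x : B) : conj x = algebraMap ℚ B (trd x) - x := by
  rw [← add_conj, add_sub_cancel_left]

theorem conj_algebraMap (r : ℚ) : conj (algebraMap ℚ B r) = algebraMap ℚ B r := by
  rw [Algebra.algebraMap_eq_smul_one, map_smul, conj_one]

theorem conj_mul_self (x : B) : conj x * x = algebraMap ℚ B (nrd x) := by
  rw [← mul_conj, conj_eq, sub_mul, mul_sub, Algebra.commutes]

theorem nrd_zero : nrd (0 : B) = 0 := by
  rw [← algebraMap_inj (B := B), ← mul_conj, zero_mul, map_zero]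

theorem nrd_eq_zero {x : B} : nrd x = 0 ↔ x = 0 := by
  constructor
  · intro h; by_contra hx; exact (nrd_pos x hx).ne' h
  · rintro rfl; exact nrd_zero

theorem nrd_mul (x y : B) : nrd (x * y) = nrd x * nrd y := by
  rw [← algebraMap_inj (B := B), map_mul, ← mul_conj, conj_mul, mul_assoc, ← mul_assoc y, mul_conj,
    Algebra.commutes, ← mul_assoc, mul_conj]

theorem nrd_conj (x : B) : nrd (conj x) = nrd x := by
  rw [← algebraMap_inj (B := B), ← mul_conj, conj_conj, conj_mul_self]

theorem trd_algebraMap (r : ℚ) : trd (algebraMap ℚ B r) = 2 * r := by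
  rw [← algebraMap_inj (B := B), ← add_conj, conj_algebraMap, ← map_add, two_mul]

theorem nrd_algebraMap (r : ℚ) : nrd (algebraMap ℚ B r) = r ^ 2 := by
  rw [← algebraMap_inj (B := B), ← mul_conj, conj_algebraMap, ← map_mul, sq]

theorem nrd_one : nrd (1 : B) = 1 := by
  have := nrd_algebraMap (B := B) 1
  rwa [map_one, one_pow] at this

theorem nrd_add (x y : B) : nrd (x + y) = nrd x + nrd y + trd (x * conj y) := by
  rw [← algebraMap_inj (B := B), map_add, map_add, ← mul_conj, ← mul_conj, ← mul_conj, ← add_conj,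
    conj_mul, conj_conj, map_add]
  noncomm_ring

theorem nrd_neg (x : B) : nrd (-x) = nrd x := by
  rw [← algebraMap_inj (B := B), ← mul_conj, ← mul_conj, map_neg, neg_mul_neg]

theorem nrd_smul (r : ℚ) (x : B) : nrd (r • x) = r ^ 2 * nrd x := by
  rw [Algebra.smul_def, nrd_mul, nrd_algebraMap]

theorem mul_self_eq (x : B) :
    x * x = algebraMap ℚ B (trd x) * x - algebraMap ℚ B (nrd x) := by
  rw [← conj_mul_self, conj_eq]; noncomm_ring

theorem trd_sq (x : B) : trd (x * x) = trd x ^ 2 - 2 * nrd x := by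
  rw [mul_self_eq, map_sub, ← Algebra.smul_def, map_smul, trd_algebraMap, smul_eq_mul, sq]

/-- The discriminant of the reduced characteristic polynomial is not positive. -/
theorem trd_sq_le (x : B) : trd x ^ 2 ≤ 4 * nrd x := by
  have h : 0 ≤ nrd ((2 : ℚ) • x - algebraMap ℚ B (trd x)) := by
    by_cases h0 : (2 : ℚ) • x - algebraMap ℚ B (trd x) = 0
    · rw [h0, nrd_zero]
    · exact (nrd_pos _ h0).le
  rw [sub_eq_add_neg, nrd_add, nrd_smul, nrd_neg, nrd_algebraMap, map_neg, conj_algebraMap, mul_neg,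
    map_neg, ← Algebra.commutes, ← Algebra.smul_def, map_smul, map_smul, smul_eq_mul,
    smul_eq_mul] at h
  linarith

theorem isUnit_of_ne_zero {x : B} (hx : x ≠ 0) : IsUnit x := by
  have hn : nrd x ≠ 0 := fun h => hx (nrd_eq_zero.1 h)
  refine ⟨⟨x, (nrd x)⁻¹ • conj x, ?_, ?_⟩, rfl⟩
  · rw [mul_smul_comm, mul_conj, Algebra.algebraMap_eq_smul_one, smul_smul, inv_mul_cancel₀ hn,
      one_smul]
  · rw [smul_mul_assoc, conj_mul_self, Algebra.algebraMap_eq_smul_one, smul_smul,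
      inv_mul_cancel₀ hn, one_smul]

instance : NoZeroDivisors B where
  eq_zero_or_eq_zero_of_mul_eq_zero {x y} h := by
    have := congrArg nrd h
    rwa [nrd_mul, nrd_zero, mul_eq_zero, nrd_eq_zero, nrd_eq_zero] at this

end DefiniteQuaternion

end BrandtZeroes

namespace BrandtZeroes

/-! ### Quadratic subfields -/

/-- `i` and `j` anticommute and have squares `a` and `b`. -/
structure IsAnticommutingPair {B : Type*} [Ring B] [Algebra ℚ B] (i j : B) (a b : ℚ) : Prop where
  left_sq : i * i = algebraMap ℚ B a
  right_sq : j * j = algebraMap ℚ B b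
  anticomm : i * j = -(j * i)

section Pair
variable {B : Type*} [Ring B] [Algebra ℚ B] {i j : B} {a b : ℚ}

theorem IsAnticommutingPair.symm (h : IsAnticommutingPair i j a b) :
    IsAnticommutingPair j i b a :=
  ⟨h.right_sq, h.left_sq, by rw [h.anticomm, neg_neg]⟩

theorem IsAnticommutingPair.smul (h : IsAnticommutingPair i j a b) (c : ℚ) :
    IsAnticommutingPair i (c • j) a (c ^ 2 * b) where
  left_sq := h.left_sq
  right_sq := by
    rw [smul_mul_smul_comm, h.right_sq, ← sq, map_mul, Algebra.smul_def]
  anticomm := by rw [mul_smul_comm, smul_mul_assoc, h.anticomm, smul_neg]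

/-- For α = z + y i with conjugate α' = z - y i one has j α = α' j, so (α j)² = α α' j²: the
constant b may be multiplied by any norm from ℚ(i). -/
theorem IsAnticommutingPair.mul (h : IsAnticommutingPair i j a b) (z y : ℚ) :
    IsAnticommutingPair i ((z • 1 + y • i) * j) a ((z ^ 2 - a * y ^ 2) * b) where
  left_sq := h.left_sq
  right_sq := by
    have h1 : j * (z • 1 + y • i) = (z • 1 - y • i) * j := by
      rw [mul_add, mul_smul_comm, mul_smul_comm, mul_one, sub_mul, smul_mul_assoc, smul_mul_assoc,
        one_mul, h.anticomm, smul_neg, sub_neg_eq_add]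
    have h2 : (z • 1 + y • i) * (z • 1 - y • i) = algebraMap ℚ B (z ^ 2 - a * y ^ 2) := by
      have : (z • 1 + y • i) * (z • 1 - y • i) = (z ^ 2) • (1 : B) - (y ^ 2) • (i * i) := by
        simp only [add_mul, mul_sub, smul_mul_smul_comm, mul_one, one_mul, sq]
        rw [mul_comm z y]
        abel
      rw [this, h.left_sq, map_sub, Algebra.smul_def, Algebra.smul_def, mul_one, ← map_mul,
        mul_comm (y ^ 2)]
    calc (z • 1 + y • i) * j * ((z • 1 + y • i) * j)
        = (z • 1 + y • i) * (j * (z • 1 + y • i)) * j := by simp only [mul_assoc]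
      _ = (z • 1 + y • i) * (z • 1 - y • i) * (j * j) := by rw [h1]; simp only [mul_assoc]
      _ = _ := by rw [h2, h.right_sq, map_mul]
  anticomm := by
    have h1 : i * (z • 1 + y • i) = (z • 1 + y • i) * i := by
      rw [mul_add, add_mul, mul_smul_comm, smul_mul_assoc, mul_smul_comm, smul_mul_assoc, mul_one,
        one_mul]
    rw [← mul_assoc, h1, mul_assoc, h.anticomm, mul_neg, mul_assoc]

theorem isAnticommutingPair_of_equiv (e : B ≃ₐ[ℚ] ℍ[ℚ, a, b]) :
    IsAnticommutingPair (e.symm ⟨0, 1, 0, 0⟩) (e.symm ⟨0, 0, 1, 0⟩) a b where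
  left_sq := by
    rw [← map_mul, ← e.symm.commutes]; congr 1
    ext <;> simp [QuaternionAlgebra.algebraMap_eq]
  right_sq := by
    rw [← map_mul, ← e.symm.commutes]; congr 1
    ext <;> simp [QuaternionAlgebra.algebraMap_eq]
  anticomm := by
    rw [← map_mul, ← map_mul, ← map_neg]; congr 1
    ext <;> simp

/-- The relations define a homomorphism from ℍ[ℚ, a, b]. It is injective because for a, b < 0 that
algebra is a division algebra, and bijective by dimension. -/
theorem IsAnticommutingPair.nonempty_equiv [Nontrivial B] (h : IsAnticommutingPair i j a b)
    (ha : a < 0) (hb : b < 0) (hB : Module.finrank ℚ B = 4) : Nonempty (B ≃ₐ[ℚ] ℍ[ℚ, a, b]) := by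
  have hfin : Module.Finite ℚ B := Module.finite_of_finrank_eq_succ hB
  let q : QuaternionAlgebra.Basis B a 0 b :=
    { i := i, j := j, k := i * j
      i_mul_i := by rw [h.left_sq, zero_smul, add_zero, Algebra.algebraMap_eq_smul_one]
      j_mul_j := by rw [h.right_sq, Algebra.algebraMap_eq_smul_one]
      i_mul_j := rfl
      j_mul_i := by rw [zero_smul, zero_sub, h.anticomm, neg_neg] }
  let D : DefiniteQuaternion ℍ[ℚ, a, b] := DefiniteQuaternion.ofEquiv AlgEquiv.refl ha hb
  have hinj : Function.Injective q.liftHom := by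
    rw [injective_iff_map_eq_zero]
    intro x hx
    by_contra hx0
    exact ((DefiniteQuaternion.isUnit_of_ne_zero hx0).map q.liftHom).ne_zero hx
  have hsurj : Function.Surjective q.liftHom :=
    (LinearMap.injective_iff_surjective_of_finrank_eq_finrank
      (by rw [hB, QuaternionAlgebra.finrank_eq_four]) (f := q.liftHom.toLinearMap)).1 hinj
  exact ⟨(AlgEquiv.ofBijective q.liftHom ⟨hinj, hsurj⟩).symm⟩

end Pair

/-- A definite quaternion algebra over `ℚ` is `(a, b)` with negative integers `a, b`. -/
theorem exists_negative_presentation {B : Type*} [Ring B] [Algebra ℚ B]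
    (hB : IsQuaternionAlgebra ℚ B) (hdef : IsDefinite B) :
    ∃ a b : ℤ, a < 0 ∧ b < 0 ∧ Nonempty (B ≃ₐ[ℚ] ℍ[ℚ, (a : ℚ), (b : ℚ)]) := by
  obtain ⟨a, b, ha, hb, ⟨e⟩⟩ := hB
  have hiso : ¬ IsIsotropic ℝ (algebraMap ℚ ℝ a) (algebraMap ℚ ℝ b) := fun h =>
    (not_isRamifiedOver_iff ℝ e).2 h hdef
  have hneg : ∀ c : ℚ, c ≠ 0 → ¬ IsSquare (algebraMap ℚ ℝ c) → c < 0 := by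
    intro c hc h
    by_contra hcon
    refine h (Real.isSquare_iff.2 ?_)
    rw [eq_ratCast]
    exact_mod_cast not_lt.1 hcon
  have ha' : a < 0 := hneg a ha fun h => hiso (isIsotropic_of_isSquare h)
  have hb' : b < 0 := hneg b hb fun h => hiso (isIsotropic_of_isSquare h).symm
  have hN : Nontrivial B := e.toEquiv.nontrivial
  have hrank : Module.finrank ℚ B = 4 := by
    rw [e.toLinearEquiv.finrank_eq, QuaternionAlgebra.finrank_eq_four]
  -- Scaling each generator by the denominator of its square c turns c into the integer `c.num *
  -- c.den` of the same sign.
  have hp := ((isAnticommutingPair_of_equiv e).smul (b.den : ℚ)).symm.smul (a.den : ℚ)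
  have key : ∀ c : ℚ, (c.den : ℚ) ^ 2 * c = ((c.num * c.den : ℤ) : ℚ) := by
    intro c
    have := Rat.mul_den_eq_num c
    push_cast
    rw [← this]
    ring
  have hkey : ∀ c : ℚ, c < 0 → c.num * c.den < 0 := fun c hc =>
    mul_neg_of_neg_of_pos (Rat.num_neg.2 hc) (by exact_mod_cast c.den_pos)
  rw [key, key] at hp
  exact ⟨a.num * a.den, b.num * b.den, hkey a ha', hkey b hb', hp.symm.nonempty_equiv
    (by exact_mod_cast hkey a ha') (by exact_mod_cast hkey b hb') hrank⟩

/-! ### Embedding imaginary quadratic fields -/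

section Embedding
variable {B : Type*} [Ring B] [Algebra ℚ B] {a b : ℤ}

theorem isRamifiedOver_padic_iff (e : B ≃ₐ[ℚ] ℍ[ℚ, (a : ℚ), (b : ℚ)]) (p : ℕ) [Fact p.Prime] :
    ¬ IsRamifiedOver ℚ_[p] B ↔ IsIsotropic ℚ_[p] (a : ℚ_[p]) (b : ℚ_[p]) := by
  rw [not_isRamifiedOver_iff ℚ_[p] e, map_intCast, map_intCast]

theorem hilb_eq_ite (e : B ≃ₐ[ℚ] ℍ[ℚ, (a : ℚ), (b : ℚ)]) (ha : a ≠ 0) (hb : b ≠ 0) {N : ℕ}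
    (hN : HasDiscriminant B N) {p : ℕ} (hp : p.Prime) (h2 : p ≠ 2) :
    hilb p a b = if p ∣ N then -1 else 1 := by
  have := Fact.mk hp
  have h1 := isRamifiedOver_padic_iff e p
  rw [← hN.2 p] at h1
  split_ifs with h
  · refine (hilb_eq_or hp ha hb).resolve_left fun h3 => ?_
    exact h1.2 (isIsotropic_of_hilb_eq_one h2 ha hb h3) h
  · exact hilb_eq_one_of_isIsotropic ha hb (h1.1 h)

/-- `ℚ(√D)`, for `D < 0`, embeds into a definite quaternion algebra of odd discriminant `N` if `D`
is not a square in `ℚ_p` for all `p ∣ N`. -/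
theorem exists_mul_self_eq (e : B ≃ₐ[ℚ] ℍ[ℚ, (a : ℚ), (b : ℚ)]) (ha : a < 0) (hb : b < 0) {N : ℕ}
    (hN : HasDiscriminant B N) (hodd : Odd N) {D : ℤ} (hD : D < 0)
    (hDN : ∀ p : ℕ, p.Prime → p ∣ N → ¬ IsLocalSquare p D) :
    ∃ x : B, x * x = algebraMap ℚ B D := by
  have h2N : ¬ IsRamifiedOver ℚ_[2] B := by
    rw [← hN.2 2]
    exact fun h => (Nat.not_even_iff_odd.2 hodd) (even_iff_two_dvd.2 h)
  have hab2 := hilbTwo_eq_one_of_isIsotropic ha.ne hb.ne ((isRamifiedOver_padic_iff e 2).1 h2N)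
  -- Since (s, a) = (s, D) = (a, b) at all odd primes, B ≅ (a, b) ≅ (a, s) ≅ (D, s). Each
  -- isomorphism changes one generator: Legendre's theorem makes s b, up to squares, a norm from
  -- ℚ(√a), and then a D a norm from ℚ(√s).
  obtain ⟨s, hs, hsp⟩ := exists_common_slot ha hb hD hodd
    (fun p hp h2 => hilb_eq_ite e ha.ne hb.ne hN hp h2) hab2 hDN
  have hpair := isAnticommutingPair_of_equiv e
  obtain ⟨x, y, z, h0, h⟩ := exists_ternary_zero (a := s * b) (b := a)
    (mul_ne_zero hs.ne hb.ne) ha.ne (Or.inl (mul_pos_of_neg_of_neg hs hb)) (by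
      intro p hp h2
      rw [hilb_mul_left hp hs.ne hb.ne, (hsp p hp h2).1, hilb_comm p b]
      rcases hilb_eq_or hp ha.ne hb.ne with h | h <;> rw [h] <;> rfl)
  -- For x = 0 the equation z² = a y² with a < 0 has only the zero solution.
  have hx : x ≠ 0 := by
    rintro rfl
    have hy : y = 0 := by
      by_contra hy
      have : a * y ^ 2 < 0 := mul_neg_of_neg_of_pos ha (by positivity)
      nlinarith [sq_nonneg z]
    rw [hy] at h h0
    have hz : z = 0 := by simpa using h
    simp [hz] at h0
  have hxQ : (x : ℚ) ≠ 0 := by exact_mod_cast hx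
  have hbQ : (b : ℚ) ≠ 0 := by exact_mod_cast hb.ne
  have haQ : (a : ℚ) ≠ 0 := by exact_mod_cast ha.ne
  have hQ : (z : ℚ) ^ 2 = s * b * x ^ 2 + a * y ^ 2 := by exact_mod_cast h
  have hpair1 := (hpair.mul z y).smul ((b * x : ℚ)⁻¹)
  rw [show ((b * x : ℚ)⁻¹) ^ 2 * (((z : ℚ) ^ 2 - a * y ^ 2) * b) = s by
    rw [hQ]; field_simp; ring] at hpair1
  obtain ⟨x', y', z', h0', h'⟩ := exists_ternary_zero (a := a * D) (b := s)
    (mul_ne_zero ha.ne hD.ne) hs.ne (Or.inl (mul_pos_of_neg_of_neg ha hD)) (by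
      intro p hp h2
      rw [hilb_mul_left hp ha.ne hD.ne, hilb_comm p a, hilb_comm p D, (hsp p hp h2).1,
        (hsp p hp h2).2]
      rcases hilb_eq_or hp ha.ne hb.ne with h | h <;> rw [h] <;> rfl)
  have hx' : x' ≠ 0 := by
    rintro rfl
    have hy : y' = 0 := by
      by_contra hy
      have : s * y' ^ 2 < 0 := mul_neg_of_neg_of_pos hs (by positivity)
      nlinarith [sq_nonneg z']
    rw [hy] at h' h0'
    have hz : z' = 0 := by simpa using h'
    simp [hz] at h0'
  have hxQ' : (x' : ℚ) ≠ 0 := by exact_mod_cast hx'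
  have hQ' : (z' : ℚ) ^ 2 = a * D * x' ^ 2 + s * y' ^ 2 := by exact_mod_cast h'
  have hpair2 := (hpair1.symm.mul z' y').smul ((a * x' : ℚ)⁻¹)
  rw [show ((a * x' : ℚ)⁻¹) ^ 2 * (((z' : ℚ) ^ 2 - s * y' ^ 2) * a) = D by
    rw [hQ']; field_simp; ring] at hpair2
  exact ⟨_, hpair2.right_sq⟩

end Embedding

/-! ### The reduced characteristic polynomial at ramified primes -/

section Ramified
open DefiniteQuaternion
variable {B : Type*} [Ring B] [Algebra ℚ B] [DefiniteQuaternion B]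

/-- If `B` is ramified over `K`, an element whose reduced characteristic polynomial has a root in
`K` is rational. -/
theorem exists_algebraMap_of_root {K : Type*} [Field K] [Algebra ℚ K] (h : IsRamifiedOver K B)
    (x : B) {r : K} (hr : r ^ 2 - algebraMap ℚ K (trd x) * r + algebraMap ℚ K (nrd x) = 0) :
    ∃ c : ℚ, x = algebraMap ℚ B c := by
  -- This product is the reduced characteristic polynomial at r. As K ⊗ B is a division algebra, one
  -- factor vanishes; a functional that is 0 at 1 but not at x then shows that x is rational.
  have hprod : ((1 : K) ⊗ₜ[ℚ] x - r ⊗ₜ 1) * ((1 : K) ⊗ₜ[ℚ] conj x - r ⊗ₜ 1) = 0 := by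
    have e1 : (1 : K) ⊗ₜ[ℚ] (x * conj x) = algebraMap ℚ K (nrd x) ⊗ₜ[ℚ] (1 : B) := by
      rw [mul_conj, Algebra.algebraMap_eq_smul_one, TensorProduct.tmul_smul,
        TensorProduct.smul_tmul', Algebra.algebraMap_eq_smul_one]
    have e2 : r ⊗ₜ[ℚ] x + r ⊗ₜ[ℚ] conj x = (algebraMap ℚ K (trd x) * r) ⊗ₜ[ℚ] (1 : B) := by
      rw [← TensorProduct.tmul_add, add_conj, Algebra.algebraMap_eq_smul_one,
        TensorProduct.tmul_smul, TensorProduct.smul_tmul', Algebra.smul_def]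
    have e3 : ((1 : K) ⊗ₜ[ℚ] x - r ⊗ₜ 1) * ((1 : K) ⊗ₜ[ℚ] conj x - r ⊗ₜ 1) =
        (1 : K) ⊗ₜ[ℚ] (x * conj x) - (r ⊗ₜ[ℚ] x + r ⊗ₜ[ℚ] conj x) + (r ^ 2) ⊗ₜ[ℚ] (1 : B) := by
      simp only [sub_mul, mul_sub, Algebra.TensorProduct.tmul_mul_tmul, one_mul, mul_one, sq]
      abel
    rw [e3, e1, e2, ← TensorProduct.sub_tmul, ← TensorProduct.add_tmul]
    rw [show algebraMap ℚ K (nrd x) - algebraMap ℚ K (trd x) * r + r ^ 2 = 0 by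
      linear_combination hr, TensorProduct.zero_tmul]
  have key : ∀ y : B, (1 : K) ⊗ₜ[ℚ] y = r ⊗ₜ 1 → ∃ c : ℚ, y = algebraMap ℚ B c := by
    intro y hy
    by_contra hcon
    have hmem : y ∉ Submodule.span ℚ {(1 : B)} := by
      intro hmem
      obtain ⟨c, hc⟩ := Submodule.mem_span_singleton.1 hmem
      exact hcon ⟨c, by rw [← hc, Algebra.algebraMap_eq_smul_one]⟩
    obtain ⟨φ, hφ, hφ'⟩ := Submodule.exists_le_ker_of_notMem hmem
    have h1 := congrArg (fun w => TensorProduct.rid ℚ K (φ.lTensor K w)) hy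
    have h2 : φ 1 = 0 := hφ' (Submodule.mem_span_singleton_self _)
    simp [h2, hφ, -eq_ratCast] at h1
  by_cases h0 : (1 : K) ⊗ₜ[ℚ] x - r ⊗ₜ 1 = 0
  · exact key x (sub_eq_zero.1 h0)
  · have h1 := (h _ h0).mul_right_eq_zero.1 hprod
    obtain ⟨c, hc⟩ := key _ (sub_eq_zero.1 h1)
    exact ⟨c, by rw [← conj_conj x, hc, conj_algebraMap]⟩

variable {p : ℕ} [Fact p.Prime]

/-- At a ramified prime, elements of integral norm have integral trace. -/
theorem norm_trd_le_one (h : IsRamifiedOver ℚ_[p] B) {x : B} (hn : ‖(nrd x : ℚ_[p])‖ ≤ 1) :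
    ‖(trd x : ℚ_[p])‖ ≤ 1 := by
  -- If |t| > 1 ≥ |n|, substituting t X in the characteristic polynomial and dividing by t² gives X²
  -- - X + n/t², which has the simple root 0 modulo p. Hensel's lemma gives a root in ℤ_p, so x is a
  -- rational q with |q| ≤ 1, and t = 2 q is integral after all.
  by_contra! ht
  set t : ℚ_[p] := (trd x : ℚ_[p]) with htdef
  set n : ℚ_[p] := (nrd x : ℚ_[p]) with hndef
  have ht0 : t ≠ 0 := by rintro h0; rw [h0, norm_zero] at ht; linarith
  have hc : ‖n / t ^ 2‖ < 1 := by
    rw [norm_div, norm_pow, div_lt_one (by positivity)]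
    nlinarith
  obtain ⟨c, hcn⟩ : ∃ c : ℤ_[p], (c : ℚ_[p]) = n / t ^ 2 := ⟨⟨n / t ^ 2, hc.le⟩, rfl⟩
  rw [← hcn, ← PadicInt.norm_def] at hc
  let F : Polynomial ℤ_[p] := Polynomial.X ^ 2 - Polynomial.X + Polynomial.C c
  obtain ⟨z, hz, -⟩ := hensels_lemma (p := p) (R := ℤ_[p]) (F := F) (a := 0) (by
    simpa [F] using hc)
  have hz' : (z : ℚ_[p]) ^ 2 - z + n / t ^ 2 = 0 := by
    have : z ^ 2 - z + c = 0 := by simpa [F] using hz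
    rw [← hcn]
    exact_mod_cast congrArg (fun w : ℤ_[p] => (w : ℚ_[p])) this
  obtain ⟨q, rfl⟩ := exists_algebraMap_of_root h x (r := t * z) (by
    rw [eq_ratCast, eq_ratCast, ← htdef, ← hndef]
    field_simp at hz'
    linear_combination hz')
  rw [nrd_algebraMap] at hndef
  rw [trd_algebraMap] at htdef
  have hq : ‖(q : ℚ_[p])‖ ≤ 1 := by
    rw [hndef, Rat.cast_pow, norm_pow] at hn
    nlinarith [norm_nonneg (q : ℚ_[p])]
  have h2 : ‖((2 : ℤ) : ℚ_[p])‖ ≤ 1 := Padic.norm_int_le_one 2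
  rw [htdef, Rat.cast_mul, norm_mul] at ht
  push_cast at h2 ht
  nlinarith [norm_nonneg (q : ℚ_[p])]

/-- At a ramified prime, elements of integral norm are closed under addition. -/
theorem norm_nrd_add_le_one (h : IsRamifiedOver ℚ_[p] B) {x y : B}
    (hx : ‖(nrd x : ℚ_[p])‖ ≤ 1) (hy : ‖(nrd y : ℚ_[p])‖ ≤ 1) :
    ‖(nrd (x + y) : ℚ_[p])‖ ≤ 1 := by
  -- The norm of x y' is integral, y' being the conjugate of y, so the cross term of nrd (x + y) is
  -- integral as well.
  have hxy : ‖(trd (x * conj y) : ℚ_[p])‖ ≤ 1 := norm_trd_le_one h (by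
    rw [nrd_mul, nrd_conj, Rat.cast_mul, norm_mul]
    exact mul_le_one₀ hx (norm_nonneg _) hy)
  rw [nrd_add, Rat.cast_add, Rat.cast_add]
  refine (Padic.nonarchimedean _ _).trans (max_le ?_ hxy)
  exact (Padic.nonarchimedean _ _).trans (max_le hx hy)

/-- If `B` is ramified at the odd prime `p` and contains `√D`, where `p ∤ D < 0`, then `D` is not a
square modulo `p`. -/
theorem jacobiSym_eq_neg_one_of_mul_self (h : IsRamifiedOver ℚ_[p] B) (h2 : p ≠ 2) {D : ℤ}
    (hD : D < 0) (hpD : ¬ (p : ℤ) ∣ D) {x : B} (hx : x * x = algebraMap ℚ B D) :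
    jacobiSym D p = -1 := by
  have hp : p.Prime := Fact.out
  -- Otherwise X² - D, the characteristic polynomial of x, has a root in ℚ_p, so x is rational of
  -- trace 0, against nrd x = -D > 0.
  refine (jacobiSym_eq_or hp hpD).resolve_left fun h1 => ?_
  obtain ⟨r, hr⟩ := isSquare_padic_of_jacobiSym h2 hpD h1
  have hn : nrd x ^ 2 = (D : ℚ) ^ 2 := by rw [sq, ← nrd_mul, hx, nrd_algebraMap]
  have hx0 : x ≠ 0 := by
    rintro rfl
    rw [nrd_zero, zero_pow two_ne_zero, eq_comm, pow_eq_zero_iff two_ne_zero] at hn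
    exact hD.ne (by exact_mod_cast hn)
  have hDQ : (D : ℚ) < 0 := by exact_mod_cast hD
  have hn' : nrd x = -D := by
    rcases sq_eq_sq_iff_eq_or_eq_neg.1 hn with h | h
    · have := nrd_pos x hx0; linarith
    · exact h
  have ht : trd x = 0 := by
    have := trd_sq x
    rw [hx, trd_algebraMap, hn'] at this
    have : trd x ^ 2 = 0 := by linarith
    exact pow_eq_zero_iff two_ne_zero |>.1 this
  obtain ⟨q, rfl⟩ := exists_algebraMap_of_root h x (r := r) (by
    rw [ht, hn', map_zero, eq_ratCast]
    push_cast
    rw [hr]; ring)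
  rw [nrd_algebraMap] at hn'
  rw [trd_algebraMap] at ht
  have : q = 0 := by linarith
  rw [this] at hn'
  linarith

end Ramified

end BrandtZeroes

namespace BrandtZeroes

/-! ### Discriminants of imaginary quadratic fields -/

section QuadDisc
open scoped NumberTheorySymbols

/-- The element `√-d` of `ℚ(√-d)`. -/
noncomputable def sqrtNeg (d : ℕ) : QuadField d :=
  IntermediateField.AdjoinSimple.gen ℚ ((Real.sqrt d : ℂ) * Complex.I)

theorem sqrtNeg_sq (d : ℕ) : sqrtNeg d ^ 2 = -(d : QuadField d) := by
  have h : ((Real.sqrt d : ℝ) : ℂ) ^ 2 = d := by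
    rw [← Complex.ofReal_pow, Real.sq_sqrt (Nat.cast_nonneg d), Complex.ofReal_natCast]
  apply Subtype.ext
  simp [sqrtNeg, mul_pow, h]

theorem minpoly_sqrtNeg {d : ℕ} (hd : 0 < d) :
    minpoly ℚ ((Real.sqrt d : ℂ) * Complex.I) = Polynomial.X ^ 2 + Polynomial.C (d : ℚ) := by
  have h : ((Real.sqrt d : ℝ) : ℂ) ^ 2 = d := by
    rw [← Complex.ofReal_pow, Real.sq_sqrt (Nat.cast_nonneg d), Complex.ofReal_natCast]
  have hm : (Polynomial.X ^ 2 + Polynomial.C (d : ℚ)).Monic :=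
    Polynomial.monic_X_pow_add_C _ two_ne_zero
  have hdeg : (Polynomial.X ^ 2 + Polynomial.C (d : ℚ)).natDegree = 2 :=
    Polynomial.natDegree_X_pow_add_C
  refine (minpoly.eq_of_irreducible_of_monic ?_ (by simp [mul_pow, h]) hm).symm
  rw [hm.irreducible_iff_roots_eq_zero_of_degree_le_three hdeg.ge (by rw [hdeg]; norm_num)]
  rw [Multiset.eq_zero_iff_forall_notMem]
  intro x hx
  have h1 := Polynomial.isRoot_of_mem_roots hx
  simp only [Polynomial.IsRoot.def, Polynomial.eval_add, Polynomial.eval_pow, Polynomial.eval_X,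
    Polynomial.eval_C] at h1
  have h2 : (0 : ℚ) < d := by exact_mod_cast hd
  nlinarith [sq_nonneg x]

theorem isIntegral_sqrt_mul_I (d : ℕ) : IsIntegral ℚ ((Real.sqrt d : ℂ) * Complex.I) := by
  have h : ((Real.sqrt d : ℝ) : ℂ) ^ 2 = d := by
    rw [← Complex.ofReal_pow, Real.sq_sqrt (Nat.cast_nonneg d), Complex.ofReal_natCast]
  exact ⟨Polynomial.X ^ 2 + Polynomial.C (d : ℚ), Polynomial.monic_X_pow_add_C _ two_ne_zero,
    by simp [mul_pow, h]⟩

theorem finrank_quadField {d : ℕ} (hd : 0 < d) : Module.finrank ℚ (QuadField d) = 2 := by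
  rw [IntermediateField.adjoin.finrank (isIntegral_sqrt_mul_I d), minpoly_sqrtNeg hd]
  exact Polynomial.natDegree_X_pow_add_C

theorem trace_sqrtNeg {d : ℕ} (hd : 0 < d) :
    Algebra.trace ℚ (QuadField d) (sqrtNeg d) = 0 := by
  refine (trace_adjoinSimpleGen (isIntegral_sqrt_mul_I d)).trans ?_
  rw [minpoly_sqrtNeg hd, neg_eq_zero, Polynomial.nextCoeff_of_natDegree_pos]
  · rw [Polynomial.natDegree_X_pow_add_C]; simp [Polynomial.coeff_X_pow]
  · rw [Polynomial.natDegree_X_pow_add_C]; norm_num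

/-- `-4 d` is the discriminant of `ℚ(√-d)` up to a square. -/
theorem exists_quadDisc_mul_sq {d : ℕ} (hd : 0 < d) :
    ∃ k : ℤ, k ^ 2 * quadDisc d = -4 * (d : ℤ) := by
  have hint : IsIntegral ℤ (sqrtNeg d) :=
    ⟨Polynomial.X ^ 2 + Polynomial.C (d : ℤ), Polynomial.monic_X_pow_add_C _ two_ne_zero,
      by simp [sqrtNeg_sq]⟩
  let α : NumberField.RingOfIntegers (QuadField d) := ⟨sqrtNeg d, hint⟩
  have hα : α ^ 2 = -(d : NumberField.RingOfIntegers (QuadField d)) := by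
    apply NumberField.RingOfIntegers.ext
    have := sqrtNeg_sq d
    refine (map_pow (algebraMap _ (QuadField d)) α 2).trans (this.trans ?_)
    exact (((algebraMap (NumberField.RingOfIntegers (QuadField d)) (QuadField d)).map_neg _).trans
      (congrArg _ (map_natCast _ d))).symm
  have hrank : Module.finrank ℤ (NumberField.RingOfIntegers (QuadField d)) = 2 := by
    rw [NumberField.RingOfIntegers.rank, finrank_quadField hd]
  have ht1 : Algebra.trace ℤ (NumberField.RingOfIntegers (QuadField d)) 1 = 2 := by
    have := Algebra.trace_algebraMap (R := ℤ) (S := NumberField.RingOfIntegers (QuadField d)) 1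
    rw [map_one, hrank] at this
    simpa using this
  have htα : Algebra.trace ℤ (NumberField.RingOfIntegers (QuadField d)) α = 0 := by
    have := Algebra.coe_trace_int α
    rw [show (α : QuadField d) = sqrtNeg d from rfl, trace_sqrtNeg hd] at this
    exact_mod_cast this
  have htα2 : Algebra.trace ℤ (NumberField.RingOfIntegers (QuadField d)) (α * α) = -2 * d := by
    have := Algebra.trace_algebraMap (R := ℤ) (S := NumberField.RingOfIntegers (QuadField d)) (-d)
    rw [hrank] at this
    rw [← sq, hα]
    simp at this ⊢
    exact this
  let b := (Module.finBasisOfFinrankEq ℤ (NumberField.RingOfIntegers (QuadField d)) hrank)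
  have hdisc : Algebra.discr ℤ ![1, α] = -4 * d := by
    rw [Algebra.discr_def, Matrix.det_fin_two]
    simp only [Algebra.traceMatrix_apply, Algebra.traceForm_apply]
    simp [ht1, htα, htα2]
    ring
  -- Up to sign, k is the index of ℤ[√-d] in the ring of integers.
  refine ⟨(b.toMatrix ![1, α]).det, ?_⟩
  rw [quadDisc, ← NumberField.discr_eq_discr (QuadField d) b, ← Algebra.discr_of_matrix_vecMul,
    Module.Basis.toMatrix_map_vecMul, hdisc]

/-- From k² Δ_d = -4 d with p ∤ 2 d, the integers Δ_d and -d differ modulo p by a nonzero square. -/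
theorem legendreSym_quadDisc {d p : ℕ} [Fact p.Prime] (hd : 0 < d) (h2 : p ≠ 2) (hpd : ¬ p ∣ d) :
    legendreSym p (quadDisc d) = J(-(d : ℤ) | p) := by
  have hp : p.Prime := Fact.out
  obtain ⟨k, hk⟩ := exists_quadDisc_mul_sq hd
  rw [← jacobiSym.legendreSym.to_jacobiSym]
  have hk0 : (k : ZMod p) ≠ 0 := by
    intro h
    rw [ZMod.intCast_zmod_eq_zero_iff_dvd] at h
    have h4 : (p : ℤ) ∣ -4 * (d : ℤ) := hk ▸ (h.trans (dvd_pow_self k two_ne_zero)).mul_right _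
    have h4' : p ∣ 2 ^ 2 * d := by
      have := Int.natAbs_dvd_natAbs.2 h4
      simpa [Int.natAbs_mul] using this
    rcases (Nat.Prime.dvd_mul hp).1 h4' with h | h
    · exact h2 ((Nat.prime_dvd_prime_iff_eq hp Nat.prime_two).1 (hp.dvd_of_dvd_pow h))
    · exact hpd h
  have h20 : ((2 : ℤ) : ZMod p) ≠ 0 := by
    intro h
    rw [ZMod.intCast_zmod_eq_zero_iff_dvd] at h
    exact h2 ((Nat.prime_dvd_prime_iff_eq hp Nat.prime_two).1 (by exact_mod_cast h))
  have h1 : legendreSym p (k ^ 2 * quadDisc d) = legendreSym p (2 ^ 2 * -(d : ℤ)) := by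
    rw [hk]; congr 1; ring
  rwa [legendreSym.mul, legendreSym.mul, legendreSym.sq_one' p hk0, legendreSym.sq_one' p h20,
    one_mul, one_mul] at h1

theorem mem_inertDivisors_iff {N d : ℕ} (hN : Squarefree N) (hodd : Odd N) :
    d ∈ inertDivisors N ↔
      d ∣ N ∧ 1 < d ∧ ∀ p : ℕ, p.Prime → p ∣ N / d → J(-(d : ℤ) | p) = -1 := by
  refine and_congr_right fun hdN => and_congr_right fun hd => ?_
  have key : ∀ p : ℕ, [Fact p.Prime] → p ∣ N / d →
      legendreSym p (quadDisc d) = J(-(d : ℤ) | p) := by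
    intro p hp hpN
    refine legendreSym_quadDisc (by omega) ?_ ?_
    · rintro rfl
      exact Nat.not_even_iff_odd.2 hodd
        (even_iff_two_dvd.2 (hpN.trans (Nat.div_dvd_of_dvd hdN)))
    · intro hpd
      have : p * p ∣ N := by
        rw [← Nat.mul_div_cancel' hdN]
        exact mul_dvd_mul hpd hpN
      exact hp.out.one_lt.ne' (Nat.isUnit_iff.1 (hN p this))
  constructor
  · intro h p hp hpN
    have := Fact.mk hp
    rw [← key p hpN]
    exact h p hpN
  · intro h p hp hpN
    rw [key p hpN]
    exact h p hp.out hpN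

/-- For `d ∈ S`, `-d` is not a local square at any prime dividing `N`. -/
theorem not_isLocalSquare_of_mem_inertDivisors {N d : ℕ} (hN : Squarefree N) (hodd : Odd N)
    (h : d ∈ inertDivisors N) {p : ℕ} (hp : p.Prime) (hpN : p ∣ N) :
    ¬ IsLocalSquare p (-(d : ℤ)) := by
  obtain ⟨hdN, hd, h⟩ := (mem_inertDivisors_iff hN hodd).1 h
  have := Fact.mk hp
  rintro ⟨hev, hres⟩
  -- At p ∣ d the valuation of -d is odd, N being squarefree; at p ∣ N/d the residue symbol is -1.
  by_cases hpd : p ∣ d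
  · obtain ⟨c, rfl⟩ := hpd
    have hpc : ¬ (p : ℤ) ∣ -(c : ℤ) := by
      rw [dvd_neg, Int.natCast_dvd_natCast]
      rintro ⟨e, rfl⟩
      refine hp.one_lt.ne' (Nat.isUnit_iff.1 (hN p ((Dvd.intro e ?_).trans hdN)))
      ring
    have h1 : padicValInt p (-((p * c : ℕ) : ℤ)) = 1 := by
      have := padicValInt_pow_mul (p := p) (k := 1) (u := -(c : ℤ)) hp hpc
      rw [pow_one] at this
      rw [← this]
      congr 1; push_cast; ring
    rw [h1] at hev
    exact absurd hev (by decide)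
  · have hpd' : ¬ (p : ℤ) ∣ -(d : ℤ) := by rwa [dvd_neg, Int.natCast_dvd_natCast]
    have h1 := unitPart_pow_mul (p := p) (k := 0) (u := -(d : ℤ)) hp hpd'
    rw [pow_zero, one_mul] at h1
    rw [h1, h p hp (by
      have h2 : p ∣ d * (N / d) := by rwa [Nat.mul_div_cancel' hdN]
      exact (hp.dvd_mul.1 h2).resolve_left hpd)] at hres
    exact absurd hres (by decide)

/-- Reciprocity gives (-3 | p) = (p | 3), which is -1 for p ≡ 2 mod 3. This is why condition (ii) of
the theorem follows from (i). -/
theorem three_mem_inertDivisors {N : ℕ} (hN : Squarefree N) (hodd : Odd N) (h3 : 3 ∣ N)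
    (h : ∀ p : ℕ, p.Prime → p ∣ N → ¬ p ≡ 1 [MOD 3]) : 3 ∈ inertDivisors N := by
  rw [mem_inertDivisors_iff hN hodd]
  refine ⟨h3, by norm_num, fun p hp hpN => ?_⟩
  have hpN' : p ∣ N := hpN.trans (Nat.div_dvd_of_dvd h3)
  have hp3 : p ≠ 3 := by
    rintro rfl
    have : 3 * 3 ∣ N := by
      have := mul_dvd_mul_left 3 hpN
      rwa [Nat.mul_div_cancel' h3] at this
    exact absurd (Nat.isUnit_iff.1 (hN 3 this)) (by norm_num)
  have hpodd : Odd p := hodd.of_dvd_nat hpN'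
  have hmod : p % 3 = 2 := by
    have h1 := h p hp hpN'
    unfold Nat.ModEq at h1
    have h0 : p % 3 ≠ 0 := fun h0 => hp3
      ((Nat.prime_dvd_prime_iff_eq Nat.prime_three hp).1 (Nat.dvd_of_mod_eq_zero h0)).symm
    omega
  have hq : J((3 : ℕ) | p) = (-1) ^ (3 / 2 * (p / 2)) * J((p : ℤ) | 3) := by
    exact jacobiSym.quadratic_reciprocity (by decide) hpodd
  have hp3 : J((p : ℤ) | 3) = -1 := by
    rw [jacobiSym.mod_left]
    have : ((p : ℤ) % ((3 : ℕ) : ℤ)) = 2 := by omega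
    rw [this]
    norm_num
  have hneg : J(-1 | p) = (-1) ^ (p / 2) := by
    rw [jacobiSym.at_neg_one hpodd, ZMod.χ₄_eq_neg_one_pow (Nat.odd_iff.1 hpodd)]
  rw [show -((3 : ℕ) : ℤ) = -1 * ((3 : ℕ) : ℤ) by ring, jacobiSym.mul_left, hq, hp3, hneg,
    show 3 / 2 * (p / 2) = p / 2 by omega, ← mul_assoc, ← mul_pow]
  norm_num

end QuadDisc

end BrandtZeroes

namespace BrandtZeroes

/-! ### Integrality in definite quaternion algebras -/

/-- The integers, as a subring of `ℚ`. -/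
abbrev intRange : Subring ℚ := (Int.castRingHom ℚ).range

theorem intCast_mem_intRange (z : ℤ) : (z : ℚ) ∈ intRange := ⟨z, rfl⟩

/-- The denominator of q to the power n divides the numerator of c for every n. If it is at least 2,
the exponent n = |c.num| is already too large, as 2^n > n. -/
theorem mem_intRange_of_pow_mul {q c : ℚ} (hc : c ≠ 0) (h : ∀ n : ℕ, q ^ n * c ∈ intRange) :
    q ∈ intRange := by
  have hden : q.den = 1 := by
    by_contra hq
    have hq2 : 2 ≤ q.den := by have := q.den_pos; omega
    obtain ⟨z, hz⟩ := h c.num.natAbs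
    set n := c.num.natAbs with hn
    have h1 : (q.num : ℚ) ^ n * c.num = z * q.den ^ n * c.den := by
      have hz' : (z : ℚ) = q ^ n * c := hz
      rw [hz', ← Rat.mul_den_eq_num q, ← Rat.mul_den_eq_num c]
      ring
    have h2 : (q.num : ℤ) ^ n * c.num = z * (q.den : ℤ) ^ n * c.den := by exact_mod_cast h1
    have h3 : (q.den : ℤ) ^ n ∣ c.num := by
      have h3 : (q.den : ℤ) ^ n ∣ q.num ^ n * c.num := ⟨z * c.den, by rw [h2]; ring⟩
      exact (Rat.isCoprime_num_den q).symm.pow.dvd_of_dvd_mul_left h3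
    have h4 : q.den ^ n ∣ n := by
      have := Int.natAbs_dvd_natAbs.2 h3
      rwa [Int.natAbs_pow, Int.natAbs_natCast] at this
    have h5 : 0 < n := Int.natAbs_pos.2 (Rat.num_ne_zero.2 hc)
    have h6 := Nat.le_of_dvd h5 h4
    have h7 : 2 ^ n ≤ q.den ^ n := Nat.pow_le_pow_left hq2 n
    have h8 := Nat.lt_two_pow_self (n := n)
    omega
  exact ⟨q.num, by rw [eq_intCast]; exact (Rat.den_eq_one_iff q).1 hden⟩

theorem mem_intRange_of_padic {p : ℕ} [Fact p.Prime] {q : ℚ} {k : ℕ}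
    (h : (p : ℚ) ^ k * q ∈ intRange) (hq : ‖(q : ℚ_[p])‖ ≤ 1) : q ∈ intRange := by
  have hp : p.Prime := Fact.out
  have hp0 : (p : ℚ) ≠ 0 := by exact_mod_cast hp.ne_zero
  obtain ⟨z, hz⟩ := h
  have hden : q.den = 1 := by
    by_contra hne
    have hdvd : q.den ∣ p ^ k := by
      have h1 : q = (z : ℚ) / ((p ^ k : ℕ) : ℤ) := by
        rw [eq_div_iff (by exact_mod_cast pow_ne_zero k hp.ne_zero)]
        push_cast
        rw [mul_comm]; exact hz.symm
      have := Rat.den_dvd z ((p ^ k : ℕ) : ℤ)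
      rw [Rat.divInt_eq_div, ← h1] at this
      exact_mod_cast this
    obtain ⟨i, -, hi⟩ := (Nat.dvd_prime_pow hp).1 hdvd
    have hpden : p ∣ q.den := by
      rw [hi]
      exact dvd_pow_self p (by rintro rfl; exact hne (by simpa using hi))
    have h1 : ‖((q.den : ℤ) : ℚ_[p])‖ < 1 := Padic.norm_intCast_lt_one_iff.2 (by exact_mod_cast hpden)
    have h2 : ¬ ‖(q.num : ℚ_[p])‖ < 1 := by
      rw [Padic.norm_intCast_lt_one_iff]
      intro hpn
      have := Nat.dvd_gcd (Int.natCast_dvd.1 hpn) hpden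
      rw [q.reduced] at this
      exact hp.one_lt.ne' (Nat.dvd_one.1 this)
    refine h2 ?_
    have h3 : (q.num : ℚ_[p]) = q * ((q.den : ℤ) : ℚ_[p]) := by
      exact_mod_cast (congrArg (fun w : ℚ => (w : ℚ_[p])) (Rat.mul_den_eq_num q)).symm
    rw [h3, norm_mul]
    nlinarith [norm_nonneg ((q.den : ℤ) : ℚ_[p]), norm_nonneg (q : ℚ_[p])]
  exact ⟨q.num, by rw [eq_intCast]; exact (Rat.den_eq_one_iff q).1 hden⟩

theorem norm_le_one_of_mem_intRange {p : ℕ} [Fact p.Prime] {q : ℚ} (h : q ∈ intRange) :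
    ‖(q : ℚ_[p])‖ ≤ 1 := by
  obtain ⟨z, rfl⟩ := h
  rw [eq_intCast, Rat.cast_intCast]
  exact Padic.norm_int_le_one z

section Integral
open DefiniteQuaternion
variable {B : Type*} [Ring B]

theorem exists_den {M : Submodule ℤ B} (hM : M.FG) (f : B →ₗ[ℤ] ℚ) :
    ∃ D : ℤ, D ≠ 0 ∧ ∀ x ∈ M, (D : ℚ) * f x ∈ intRange := by
  induction M, hM using Submodule.fg_induction with
  | singleton x =>
    refine ⟨(f x).den, by exact_mod_cast (f x).den_nz, fun y hy => ?_⟩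
    obtain ⟨c, rfl⟩ := Submodule.mem_span_singleton.1 hy
    refine ⟨c * (f x).num, ?_⟩
    have := Rat.mul_den_eq_num (f x)
    rw [map_smul, eq_intCast, Int.cast_mul, zsmul_eq_mul]
    push_cast
    rw [← this]
    ring
  | sup M₁ M₂ _ _ ih₁ ih₂ =>
    obtain ⟨D₁, h₁, h₁'⟩ := ih₁
    obtain ⟨D₂, h₂, h₂'⟩ := ih₂
    refine ⟨D₁ * D₂, mul_ne_zero h₁ h₂, fun x hx => ?_⟩
    obtain ⟨y, hy, z, hz, rfl⟩ := Submodule.mem_sup.1 hx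
    have : ((D₁ * D₂ : ℤ) : ℚ) * f (y + z) = D₂ * (D₁ * f y) + D₁ * (D₂ * f z) := by
      rw [map_add]; push_cast; ring
    rw [this]
    exact add_mem (mul_mem (intCast_mem_intRange _) (h₁' y hy))
      (mul_mem (intCast_mem_intRange _) (h₂' z hz))

variable [Algebra ℚ B]

/-- A maximal order contains every overring that is finitely generated over `ℤ`. -/
theorem IsMaximalOrder.le_of_fg {O : Subalgebra ℤ B} (hO : IsMaximalOrder O) {R : Subalgebra ℤ B} (hOR : O ≤ R)
    (hR : (Subalgebra.toSubmodule R).FG) : R ≤ O := by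
  refine hO.2 ⟨hR, ?_⟩ hOR
  rw [eq_top_iff, ← hO.1.span_eq_top]
  exact Submodule.span_mono hOR

variable [DefiniteQuaternion B]

theorem nrd_intCast_mul (n : ℤ) (x : B) : nrd ((n : B) * x) = (n : ℚ) ^ 2 * nrd x := by
  rw [nrd_mul, ← map_intCast (algebraMap ℚ B), nrd_algebraMap]

theorem nrd_natCast_mul (n : ℕ) (x : B) : nrd ((n : B) * x) = (n : ℚ) ^ 2 * nrd x := by
  exact_mod_cast nrd_intCast_mul n x

theorem trd_intCast_mul (n : ℤ) (x : B) : trd ((n : B) * x) = n * trd x := by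
  rw [← map_intCast (algebraMap ℚ B), ← Algebra.smul_def, map_smul, smul_eq_mul]

theorem trd_natCast_mul (n : ℕ) (x : B) : trd ((n : B) * x) = n * trd x := by
  exact_mod_cast trd_intCast_mul n x

theorem exists_den_nrd {M : Submodule ℤ B} (hM : M.FG) :
    ∃ D : ℤ, D ≠ 0 ∧ ∀ x ∈ M, (D : ℚ) * nrd x ∈ intRange := by
  obtain ⟨D, hD, h⟩ := exists_den (hM.mul (hM.map ((conj (B := B)).restrictScalars ℤ)))
    ((trd (B := B)).restrictScalars ℤ)
  refine ⟨D * 2, mul_ne_zero hD two_ne_zero, fun x hx => ?_⟩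
  have := h (x * conj x) (Submodule.mul_mem_mul hx ⟨x, hx, rfl⟩)
  rw [mul_conj] at this
  change (D : ℚ) * trd (algebraMap ℚ B (nrd x)) ∈ _ at this
  rw [trd_algebraMap, ← mul_assoc] at this
  exact_mod_cast this

theorem nrd_pow (x : B) (n : ℕ) : nrd (x ^ n) = nrd x ^ n := by
  induction n with
  | zero => rw [pow_zero, pow_zero, nrd_one]
  | succ n ih => rw [pow_succ, pow_succ, nrd_mul, ih]

/-- An element that maps a nonzero lattice into itself has integral reduced norm. -/
theorem nrd_mem_intRange_of_stable {M : Submodule ℤ B} (hM : M.FG) {y : B} (hy : y ∈ M)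
    (hy0 : y ≠ 0) {x : B} (hx : ∀ m ∈ M, x * m ∈ M) : nrd x ∈ intRange := by
  obtain ⟨D, hD, h⟩ := exists_den_nrd hM
  -- All x^n y stay in M, where D bounds the denominators of norms.
  refine mem_intRange_of_pow_mul (c := D * nrd y)
    (mul_ne_zero (by exact_mod_cast hD) fun h0 => hy0 (nrd_eq_zero.1 h0)) fun n => ?_
  have hmem : x ^ n * y ∈ M := by
    induction n with
    | zero => simpa using hy
    | succ n ih => rw [pow_succ', mul_assoc]; exact hx _ ih
  have := h _ hmem
  rw [nrd_mul, nrd_pow] at this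
  rwa [mul_left_comm]

theorem trd_mem_intRange_of_stable {M : Submodule ℤ B} (hM : M.FG) {y : B} (hy : y ∈ M)
    (hy0 : y ≠ 0) {x : B} (hx : ∀ m ∈ M, x * m ∈ M) : trd x ∈ intRange := by
  have h1 := nrd_mem_intRange_of_stable hM hy hy0 hx
  have h2 : nrd (x + 1) ∈ intRange := nrd_mem_intRange_of_stable hM hy hy0 fun m hm => by
    rw [add_mul, one_mul]; exact add_mem (hx m hm) hm
  have h3 : trd x = nrd (x + 1) - nrd x - 1 := by
    rw [nrd_add, nrd_one, conj_one, mul_one]; ring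
  rw [h3]
  exact sub_mem (sub_mem h2 h1) (one_mem _)

variable {O : Subalgebra ℤ B}

theorem IsOrder.nrd_mem (hO : IsOrder O) {x : B} (hx : x ∈ O) : nrd x ∈ intRange :=
  nrd_mem_intRange_of_stable hO.fg (one_mem O) one_ne_zero fun _ hm => O.mul_mem hx hm

theorem IsOrder.trd_mem (hO : IsOrder O) {x : B} (hx : x ∈ O) : trd x ∈ intRange :=
  trd_mem_intRange_of_stable hO.fg (one_mem O) one_ne_zero fun _ hm => O.mul_mem hx hm

/-- A module of elements with integral traces against a lattice is finitely generated. -/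
theorem fg_of_trd_mem {L M : Submodule ℤ B} (hL : Submodule.IsLattice ℚ L)
    (h : ∀ x ∈ M, ∀ y ∈ L, trd (x * y) ∈ intRange) : M.FG := by
  obtain ⟨S, hS⟩ := hL.fg
  -- Pairing with generators of L embeds M in ℤ^S. The trace pairing is nondegenerate because trd (x
  -- * conj x) = 2 nrd x.
  let φ : B →ₗ[ℤ] (S → ℚ) := LinearMap.pi fun s =>
    ((trd (B := B)).restrictScalars ℤ) ∘ₗ LinearMap.mulRight ℤ (s : B)
  have hφ : ∀ x s, φ x s = trd (x * s) := fun _ _ => rfl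
  have hinj : Function.Injective φ := by
    rw [injective_iff_map_eq_zero]
    intro x hx
    have h1 : ∀ s ∈ S, trd (x * s) = 0 := fun s hs => by
      rw [← hφ x ⟨s, hs⟩, hx]; rfl
    have h2 : ∀ y ∈ L, trd (x * y) = 0 := by
      intro y hy
      rw [← hS] at hy
      induction hy using Submodule.span_induction with
      | mem y hy => exact h1 y hy
      | zero => rw [mul_zero, map_zero]
      | add a b _ _ ha hb => rw [mul_add, map_add, ha, hb, add_zero]
      | smul c a _ ha => rw [mul_smul_comm, map_zsmul, ha, smul_zero]
    have h3 : ∀ y : B, trd (x * y) = 0 := by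
      intro y
      have hy : y ∈ Submodule.span ℚ (L : Set B) := by rw [hL.span_eq_top]; trivial
      induction hy using Submodule.span_induction with
      | mem y hy => exact h2 y hy
      | zero => rw [mul_zero, map_zero]
      | add a b _ _ ha hb => rw [mul_add, map_add, ha, hb, add_zero]
      | smul c a _ ha => rw [mul_smul_comm, map_smul, ha, smul_zero]
    have h4 := h3 (conj x)
    rw [mul_conj, trd_algebraMap] at h4
    exact nrd_eq_zero.1 (by linarith)
  refine Submodule.fg_of_fg_map_injective φ hinj ?_
  have hrange : (LinearMap.range (((Algebra.linearMap ℤ ℚ)).compLeft S)).FG :=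
    Module.Finite.iff_fg.1 inferInstance
  refine hrange.of_le ?_
  rintro _ ⟨x, hx, rfl⟩
  have hz : ∀ s : S, ∃ z : ℤ, (z : ℚ) = trd (x * s) := fun s =>
    h x hx s (hS ▸ Submodule.subset_span s.2)
  choose z hz using hz
  exact ⟨z, funext fun s => by rw [hφ, ← hz s]; simp⟩

/-- Integral traces place R in the dual lattice of O, so R is finitely generated and maximality
applies. To show x ∈ O it thus suffices to find a ring containing O and x with integral traces. -/
theorem IsMaximalOrder.le_of_trd_mem (hO : IsMaximalOrder O) {R : Subalgebra ℤ B} (hOR : O ≤ R)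
    (hR : ∀ x ∈ R, trd x ∈ intRange) : R ≤ O :=
  hO.le_of_fg hOR (fg_of_trd_mem (L := Subalgebra.toSubmodule O) hO.1 fun _ hx _ hy =>
    hR _ (R.mul_mem hx (hOR hy)))

/-- The ring of elements that map the lattice `M` into itself by left multiplication. -/
def leftRing (M : Submodule ℤ B) : Subalgebra ℤ B where
  carrier := {x | ∀ m ∈ M, x * m ∈ M}
  mul_mem' ha hb m hm := by rw [mul_assoc]; exact ha _ (hb m hm)
  add_mem' ha hb m hm := by rw [add_mul]; exact M.add_mem (ha m hm) (hb m hm)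
  algebraMap_mem' c m hm := by rw [← Algebra.smul_def]; exact M.smul_mem c hm

theorem trd_mem_of_mem_leftRing {M : Submodule ℤ B} (hM : Submodule.IsLattice ℚ M) {x : B}
    (hx : x ∈ leftRing M) : trd x ∈ intRange := by
  have : ∃ y ∈ M, y ≠ 0 := by
    by_contra! h
    have h1 := hM.span_eq_top
    rw [Submodule.span_eq_bot.2 h] at h1
    exact bot_ne_top h1
  obtain ⟨y, hy, hy0⟩ := this
  exact trd_mem_intRange_of_stable hM.fg hy hy0 hx

/-- The left order of a lattice stable under a maximal order `O` is `O`. -/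
theorem IsMaximalOrder.mem_of_stable (hO : IsMaximalOrder O) {M : Submodule ℤ B}
    (hM : Submodule.IsLattice ℚ M) (h : ∀ o ∈ O, ∀ m ∈ M, o * m ∈ M) {x : B}
    (hx : ∀ m ∈ M, x * m ∈ M) : x ∈ O :=
  hO.le_of_trd_mem (R := leftRing M) h (fun _ => trd_mem_of_mem_leftRing hM) hx

theorem IsMaximalOrder.conj_mem (hO : IsMaximalOrder O) {x : B} (hx : x ∈ O) : conj x ∈ O := by
  obtain ⟨z, hz⟩ := hO.1.trd_mem hx
  rw [conj_eq, ← hz, eq_intCast, map_intCast]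
  exact O.sub_mem (intCast_mem O z) hx

/-- Every order is contained in a maximal order. -/
theorem IsOrder.exists_le_isMaximalOrder (hO : IsOrder O) :
    ∃ O' : Subalgebra ℤ B, IsMaximalOrder O' ∧ O ≤ O' := by
  -- The dual lattice of O contains all orders above O and is Noetherian, so there is a maximal one
  -- among them.
  let D : Submodule ℤ B :=
    { carrier := {x | ∀ y ∈ O, trd (x * y) ∈ intRange}
      add_mem' := fun ha hb y hy => by rw [add_mul, map_add]; exact add_mem (ha y hy) (hb y hy)
      zero_mem' := fun y _ => by rw [zero_mul, map_zero]; exact zero_mem _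
      smul_mem' := fun c x hx y hy => by
        rw [smul_mul_assoc, map_zsmul, zsmul_eq_mul]
        exact mul_mem (intCast_mem_intRange c) (hx y hy) }
  have hD : D.FG := fg_of_trd_mem (L := Subalgebra.toSubmodule O) hO fun _ hx => hx
  have hle : ∀ R : Subalgebra ℤ B, IsOrder R → O ≤ R → Subalgebra.toSubmodule R ≤ D :=
    fun R hR hOR x hx y hy => hR.trd_mem (R.mul_mem hx (hOR hy))
  have : IsNoetherian ℤ D := isNoetherian_of_fg_of_noetherian D hD
  obtain ⟨_, ⟨R, hR, hOR, rfl⟩, hmax⟩ := (wellFounded_gt (α := Submodule ℤ D)).has_min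
    {S | ∃ R : Subalgebra ℤ B, IsOrder R ∧ O ≤ R ∧ S = (Subalgebra.toSubmodule R).comap D.subtype}
    ⟨_, O, hO, le_rfl, rfl⟩
  refine ⟨R, ⟨hR, fun R' hR' hRR' x hx => ?_⟩, hOR⟩
  have h1 := hmax _ ⟨R', hR', hOR.trans hRR', rfl⟩
  by_contra hxR
  exact h1 (lt_of_le_of_ne (Submodule.comap_mono hRR') fun heq => hxR (by
    have : (⟨x, hle R' hR' (hOR.trans hRR') hx⟩ : D) ∈
        (Subalgebra.toSubmodule R).comap D.subtype := by rw [heq]; exact hx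
    exact this))

/-- Membership in a maximal order can be tested by the reduced norm at ramified primes. -/
theorem IsMaximalOrder.mem_of_pow_mul_mem (hO : IsMaximalOrder O) {p : ℕ} [Fact p.Prime]
    (hp : IsRamifiedOver ℚ_[p] B) {x : B} {k : ℕ} (hx : (p : B) ^ k * x ∈ O)
    (hn : ‖(nrd x : ℚ_[p])‖ ≤ 1) : x ∈ O := by
  -- R is the ring of elements of O[1/p] with p-integral norm. Its traces are integral away from p
  -- because p^k x ∈ O, and at p by `norm_trd_le_one`.
  let R : Subalgebra ℤ B :=
    { carrier := {x | ‖(nrd x : ℚ_[p])‖ ≤ 1 ∧ ∃ k : ℕ, (p : B) ^ k * x ∈ O}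
      mul_mem' := by
        rintro x y ⟨hx, k, hk⟩ ⟨hy, l, hl⟩
        refine ⟨?_, k + l, ?_⟩
        · rw [nrd_mul, Rat.cast_mul, norm_mul]
          exact mul_le_one₀ hx (norm_nonneg _) hy
        · have : (p : B) ^ (k + l) * (x * y) = (p : B) ^ k * x * ((p : B) ^ l * y) := by
            rw [pow_add, mul_assoc, mul_assoc, ← mul_assoc x, ← ((Nat.cast_commute p x).pow_left l).eq,
              mul_assoc]
          rw [this]
          exact O.mul_mem hk hl
      add_mem' := by
        rintro x y ⟨hx, k, hk⟩ ⟨hy, l, hl⟩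
        refine ⟨norm_nrd_add_le_one hp hx hy, k + l, ?_⟩
        have : (p : B) ^ (k + l) * (x + y) =
            (p : B) ^ l * ((p : B) ^ k * x) + (p : B) ^ k * ((p : B) ^ l * y) := by
          rw [mul_add, ← mul_assoc, ← mul_assoc, ← pow_add, ← pow_add, add_comm l k]
        rw [this]
        exact O.add_mem (O.mul_mem (O.pow_mem (natCast_mem O p) l) hk)
          (O.mul_mem (O.pow_mem (natCast_mem O p) k) hl)
      algebraMap_mem' := fun c =>
        ⟨norm_le_one_of_mem_intRange (hO.1.nrd_mem (O.algebraMap_mem c)), 0, by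
          rw [pow_zero, one_mul]; exact O.algebraMap_mem c⟩ }
  refine hO.le_of_trd_mem (R := R) (fun y hy =>
    ⟨norm_le_one_of_mem_intRange (hO.1.nrd_mem hy), 0, by rwa [pow_zero, one_mul]⟩) ?_
    (show x ∈ R from ⟨hn, k, hx⟩)
  rintro y ⟨hy, l, hl⟩
  refine mem_intRange_of_padic (p := p) (k := l) ?_ (norm_trd_le_one hp hy)
  have := hO.1.trd_mem hl
  rw [← Nat.cast_pow, trd_natCast_mul] at this
  exact_mod_cast this

theorem IsMaximalOrder.mem_of_natCast_mul_mem (hO : IsMaximalOrder O) {m : ℕ} (hm : m ≠ 0)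
    (hram : ∀ (p : ℕ) [Fact p.Prime], p ∣ m → IsRamifiedOver ℚ_[p] B) {x : B}
    (hx : (m : B) * x ∈ O) (hn : nrd x ∈ intRange) : x ∈ O := by
  induction m using Nat.recOnMul generalizing x with
  | zero => exact absurd rfl hm
  | one => simpa using hx
  | prime p hp =>
    have := Fact.mk hp
    exact hO.mem_of_pow_mul_mem (hram p dvd_rfl) (k := 1) (by rwa [pow_one])
      (norm_le_one_of_mem_intRange hn)
  | mul a b iha ihb =>
    have ha : a ≠ 0 := left_ne_zero_of_mul hm
    have hb : b ≠ 0 := right_ne_zero_of_mul hm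
    refine ihb hb (fun p _ h => hram p (h.mul_left a)) ?_ hn
    refine iha ha (fun p _ h => hram p (h.mul_right b)) ?_ ?_
    · rwa [← mul_assoc, ← Nat.cast_mul]
    · rw [nrd_natCast_mul]
      exact mul_mem (pow_mem (natCast_mem _ b) 2) hn

end Integral

end BrandtZeroes

namespace BrandtZeroes

/-! ### Two-sided ideals whose square is generated by an integer -/

section Scaled
variable {B : Type*} [Ring B]

/-- The multiple `n M` of a lattice. -/
abbrev scaled (n : ℕ) (M : Submodule ℤ B) : Submodule ℤ B := Submodule.span ℤ {(n : B)} * M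

theorem mem_scaled {n : ℕ} {M : Submodule ℤ B} {x : B} :
    x ∈ scaled n M ↔ ∃ z ∈ M, (n : B) * z = x :=
  Submodule.mem_span_singleton_mul

theorem natCast_mul_mem_scaled {n : ℕ} {M : Submodule ℤ B} {x : B} (hx : x ∈ M) :
    (n : B) * x ∈ scaled n M :=
  mem_scaled.2 ⟨x, hx, rfl⟩

theorem scaled_mul (n : ℕ) (M L : Submodule ℤ B) : scaled n M * L = scaled n (M * L) :=
  mul_assoc _ _ _

theorem mul_scaled (n : ℕ) (M L : Submodule ℤ B) : M * scaled n L = scaled n (M * L) := by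
  have : M * Submodule.span ℤ {(n : B)} = Submodule.span ℤ {(n : B)} * M := by
    ext x
    rw [Submodule.mem_mul_span_singleton, Submodule.mem_span_singleton_mul]
    simp only [(Nat.cast_commute n _).eq]
  rw [scaled, scaled, ← mul_assoc, this, mul_assoc]

theorem scaled_scaled (m n : ℕ) (M : Submodule ℤ B) : scaled m (scaled n M) = scaled (m * n) M := by
  rw [scaled, scaled, scaled, ← mul_assoc, Submodule.span_mul_span, Set.singleton_mul_singleton,
    Nat.cast_mul]

theorem natCast_mul_mem {M : Submodule ℤ B} (n : ℕ) {x : B} (hx : x ∈ M) : (n : B) * x ∈ M := by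
  rw [← nsmul_eq_mul]; exact M.smul_of_tower_mem n hx

theorem intCast_mul_mem {M : Submodule ℤ B} (n : ℤ) {x : B} (hx : x ∈ M) : (n : B) * x ∈ M := by
  rw [← zsmul_eq_mul]; exact M.smul_mem n hx

theorem scaled_le (n : ℕ) (M : Submodule ℤ B) : scaled n M ≤ M := by
  intro x hx
  obtain ⟨z, hz, rfl⟩ := mem_scaled.1 hx
  exact natCast_mul_mem n hz

theorem toSubmodule_mul_self (O : Subalgebra ℤ B) :
    Subalgebra.toSubmodule O * Subalgebra.toSubmodule O = Subalgebra.toSubmodule O :=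
  O.isIdempotentElem_toSubmodule

end Scaled

section TwoSided
variable {B : Type*} [Ring B] [Algebra ℚ B] {O : Subalgebra ℤ B}

theorem InvRightIdeal.ext' {I J : InvRightIdeal O} (h : I.carrier = J.carrier) : I = J := by
  cases I; cases J; congr

theorem InvTwoSidedIdeal.mul_mem_right (P : InvTwoSidedIdeal O) {x o : B} (hx : x ∈ P.carrier)
    (ho : o ∈ O) : x * o ∈ P.carrier := by
  have := Submodule.mul_mem_mul hx (show o ∈ Subalgebra.toSubmodule O from ho)
  rwa [P.mul_right] at this

theorem InvTwoSidedIdeal.mul_mem_left (P : InvTwoSidedIdeal O) {x o : B} (ho : o ∈ O)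
    (hx : x ∈ P.carrier) : o * x ∈ P.carrier := by
  have := Submodule.mul_mem_mul (show o ∈ Subalgebra.toSubmodule O from ho) hx
  rwa [P.mul_left] at this

/-- The trivial two-sided ideal `O`. -/
def InvTwoSidedIdeal.unit (hO : IsOrder O) : InvTwoSidedIdeal O where
  carrier := Subalgebra.toSubmodule O
  isLattice := hO
  mul_right := toSubmodule_mul_self O
  mul_left := toSubmodule_mul_self O
  exists_inv := ⟨_, hO, toSubmodule_mul_self O, toSubmodule_mul_self O⟩

/-- The product of two-sided ideals. -/
def InvTwoSidedIdeal.mul (P Q : InvTwoSidedIdeal O) : InvTwoSidedIdeal O where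
  carrier := P.carrier * Q.carrier
  isLattice := isLattice_mul P.isLattice Q.isLattice
  mul_right := by rw [mul_assoc, Q.mul_right]
  mul_left := by rw [← mul_assoc, P.mul_left]
  exists_inv := by
    obtain ⟨J, hJ, hJP, hPJ⟩ := P.exists_inv
    obtain ⟨K, hK, hKQ, hQK⟩ := Q.exists_inv
    refine ⟨K * J, isLattice_mul hK hJ, ?_, ?_⟩
    · rw [mul_assoc, ← mul_assoc J, hJP, Q.mul_left, hKQ]
    · rw [mul_assoc, ← mul_assoc Q.carrier, hQK, ← mul_assoc, P.mul_right, hPJ]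

theorem RightClassSet.mul_mul (x : RightClassSet O) (P Q : InvTwoSidedIdeal O) :
    (x.mul P).mul Q = x.mul (P.mul Q) := by
  induction x using Quotient.inductionOn with
  | h I => exact congrArg (Quotient.mk _) (InvRightIdeal.ext' (mul_assoc _ _ _))

theorem RightClassSet.mul_unit (hO : IsOrder O) (x : RightClassSet O) :
    x.mul (InvTwoSidedIdeal.unit hO) = x := by
  induction x using Quotient.inductionOn with
  | h I => exact congrArg (Quotient.mk _) (InvRightIdeal.ext' I.mul_right)

/-- A two-sided lattice over a maximal order whose square is contained in the order is contained in
the order. -/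
theorem IsMaximalOrder.le_of_mul_self_le (hO : IsMaximalOrder O) {Q : Submodule ℤ B} (hQ : Q.FG)
    (hl : ∀ o ∈ O, ∀ x ∈ Q, o * x ∈ Q) (hr : ∀ x ∈ Q, ∀ o ∈ O, x * o ∈ Q)
    (hsq : ∀ x ∈ Q, ∀ y ∈ Q, x * y ∈ O) : ∀ x ∈ Q, x ∈ O := by
  -- O + Q is closed under multiplication, so it is a finitely generated overring of O.
  let R : Subalgebra ℤ B :=
    { carrier := (Subalgebra.toSubmodule O ⊔ Q : Submodule ℤ B)
      mul_mem' := by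
        intro x y hx hy
        obtain ⟨a, ha, b, hb, rfl⟩ := Submodule.mem_sup.1 hx
        obtain ⟨c, hc, e, he, rfl⟩ := Submodule.mem_sup.1 hy
        have : (a + b) * (c + e) = (a * c + b * e) + (a * e + b * c) := by noncomm_ring
        rw [this]
        exact Submodule.add_mem_sup (O.add_mem (O.mul_mem ha hc) (hsq b hb e he))
          (Q.add_mem (hl a ha e he) (hr b hb c hc))
      add_mem' := fun hx hy => Submodule.add_mem _ hx hy
      algebraMap_mem' := fun c =>
        Submodule.mem_sup_left (show _ ∈ Subalgebra.toSubmodule O from O.algebraMap_mem c) }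
  intro x hx
  exact hO.le_of_fg (R := R) (fun y hy => Submodule.mem_sup_left hy) (hO.1.fg.sup hQ)
    (Submodule.mem_sup_right hx)

/-- Two-sided ideals with squares `m O` and `n O` commute if `m` and `n` are coprime. -/
theorem mul_eq_inf_of_coprime (X Y : InvTwoSidedIdeal O) {m n : ℕ} (hmn : m.Coprime n)
    (hX : X.carrier * X.carrier = scaled m (Subalgebra.toSubmodule O))
    (hY : Y.carrier * Y.carrier = scaled n (Subalgebra.toSubmodule O))
    (hXO : ∀ x ∈ X.carrier, x ∈ O) (hYO : ∀ x ∈ Y.carrier, x ∈ O) :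
    X.carrier * Y.carrier = X.carrier ⊓ Y.carrier := by
  apply le_antisymm
  · rw [Submodule.mul_le]
    exact fun x hx y hy => ⟨X.mul_mem_right hx (hYO y hy), Y.mul_mem_left (hXO x hx) hy⟩
  · rintro z ⟨hzX, hzY⟩
    -- One has m z ∈ X² Y ⊆ X Y and n z ∈ X Y² ⊆ X Y; a Bézout relation then gives z.
    have h1 : (m : B) * z ∈ X.carrier * Y.carrier := by
      have : (m : B) * 1 * z ∈ X.carrier * X.carrier * Y.carrier :=
        Submodule.mul_mem_mul (by rw [hX]; exact natCast_mul_mem_scaled (one_mem O)) hzY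
      rw [mul_one, mul_assoc] at this
      have hle : X.carrier * Y.carrier ≤ Y.carrier :=
        Submodule.mul_le.2 fun x hx y hy => Y.mul_mem_left (hXO x hx) hy
      exact (mul_le_mul' le_rfl hle : X.carrier * _ ≤ _) this
    have h2 : (n : B) * z ∈ X.carrier * Y.carrier := by
      have : z * ((n : B) * 1) ∈ X.carrier * (Y.carrier * Y.carrier) :=
        Submodule.mul_mem_mul hzX (by rw [hY]; exact natCast_mul_mem_scaled (one_mem O))
      rw [mul_one, ← (Nat.cast_commute n z).eq] at this
      have hle : Y.carrier * Y.carrier ≤ Y.carrier :=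
        Submodule.mul_le.2 fun x hx y hy => Y.mul_mem_left (hYO x hx) hy
      exact (mul_le_mul' le_rfl hle : X.carrier * _ ≤ _) this
    have hb : (m : ℤ) * m.gcdA n + n * m.gcdB n = 1 := by
      rw [← Nat.gcd_eq_gcd_ab, hmn]; rfl
    have hz : z = (m.gcdA n : B) * ((m : B) * z) + (m.gcdB n : B) * ((n : B) * z) := by
      have : ((m : ℤ) * m.gcdA n + n * m.gcdB n : ℤ) * z = z := by rw [hb]; simp
      rw [← mul_assoc, ← mul_assoc, ← add_mul]
      conv_lhs => rw [← this]
      push_cast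
      rw [(Nat.cast_commute m _).eq, (Nat.cast_commute n _).eq]
    rw [hz]
    exact add_mem (intCast_mul_mem _ h1) (intCast_mul_mem _ h2)

open DefiniteQuaternion
variable [DefiniteQuaternion B]

theorem natCast_ne_zero {n : ℕ} (hn : n ≠ 0) : (n : B) ≠ 0 := by
  rw [← map_natCast (algebraMap ℚ B), Ne, map_eq_zero_iff _ (algebraMap ℚ B).injective]
  exact_mod_cast hn

/-- A two-sided ideal with square `d O`, where all primes dividing `d` are ramified, consists of the
elements of `O` with reduced norm divisible by `d`. -/
theorem mem_iff_of_mul_self_eq (hO : IsMaximalOrder O) {d : ℕ} (hd : d ≠ 0)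
    (hram : ∀ (p : ℕ) [Fact p.Prime], p ∣ d → IsRamifiedOver ℚ_[p] B) {Q : InvTwoSidedIdeal O}
    (hQ : Q.carrier * Q.carrier = scaled d (Subalgebra.toSubmodule O)) (x : B) :
    x ∈ Q.carrier ↔ x ∈ O ∧ ∃ z : ℤ, nrd x = d * z := by
  have hdQ : (d : ℚ) ≠ 0 := by exact_mod_cast hd
  have hQO : ∀ y ∈ Q.carrier, y ∈ O :=
    hO.le_of_mul_self_le Q.isLattice.fg (fun _ ho _ hx => Q.mul_mem_left ho hx)
      (fun _ hx _ ho => Q.mul_mem_right hx ho) fun a ha b hb =>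
      scaled_le d _ (hQ ▸ Submodule.mul_mem_mul ha hb)
  -- From y² = d w with w ∈ O follows nrd(y)² = d² nrd(w), so d divides nrd y.
  have hQn : ∀ y ∈ Q.carrier, ∃ z : ℤ, nrd y = d * z := by
    intro y hy
    have h1 := Submodule.mul_mem_mul hy hy
    rw [hQ] at h1
    obtain ⟨w, hw, hwy⟩ := mem_scaled.1 h1
    obtain ⟨n, hn⟩ := hO.1.nrd_mem (hQO y hy)
    obtain ⟨m, hm⟩ := hO.1.nrd_mem (show w ∈ O from hw)
    rw [eq_intCast] at hn hm
    have h2 : (n : ℚ) ^ 2 = d ^ 2 * m := by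
      rw [hn, hm, sq, ← nrd_mul, ← hwy, nrd_natCast_mul]
    have h3 : (d : ℤ) ^ 2 ∣ n ^ 2 := ⟨m, by exact_mod_cast h2⟩
    obtain ⟨z, hz⟩ := (Int.pow_dvd_pow_iff two_ne_zero).1 h3
    exact ⟨z, by rw [← hn, hz]; push_cast; ring⟩
  refine ⟨fun h => ⟨hQO x h, hQn x h⟩, ?_⟩
  rintro ⟨hxO, z, hz⟩
  -- The element x y / d has integral norm and its multiple by d lies in O; all primes dividing d
  -- being ramified, it lies in O itself. So x Q ⊆ d O, whence x d ∈ x Q² ⊆ d Q.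
  have key : ∀ y ∈ Q.carrier, ∃ w ∈ O, x * y = (d : B) * w := by
    intro y hy
    obtain ⟨z', hz'⟩ := hQn y hy
    have h1 : (d : B) * ((d : ℚ)⁻¹ • (x * y)) = x * y := by
      rw [mul_smul_comm, ← map_natCast (algebraMap ℚ B), ← Algebra.smul_def, smul_smul,
        inv_mul_cancel₀ hdQ, one_smul]
    refine ⟨(d : ℚ)⁻¹ • (x * y), hO.mem_of_natCast_mul_mem hd hram ?_ ⟨z * z', ?_⟩, h1.symm⟩
    · rw [h1]; exact O.mul_mem hxO (hQO y hy)
    · rw [nrd_smul, nrd_mul, hz, hz', eq_intCast]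
      push_cast
      field_simp
  have key2 : ∀ t ∈ Q.carrier * Q.carrier, ∃ q ∈ Q.carrier, x * t = (d : B) * q := by
    intro t ht
    induction ht using Submodule.mul_induction_on' with
    | mem_mul_mem a ha b hb =>
      obtain ⟨w, hw, hwa⟩ := key a ha
      exact ⟨w * b, Q.mul_mem_left hw hb, by rw [← mul_assoc, hwa, mul_assoc]⟩
    | add a _ b _ ha hb =>
      obtain ⟨q, hq, hqa⟩ := ha
      obtain ⟨q', hq', hqb⟩ := hb
      exact ⟨q + q', add_mem hq hq', by rw [mul_add, hqa, hqb, mul_add]⟩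
  obtain ⟨q, hq, hqx⟩ := key2 ((d : B) * 1) (by
    rw [hQ]; exact natCast_mul_mem_scaled (one_mem O))
  rw [mul_one, ← (Nat.cast_commute d x).eq] at hqx
  rwa [mul_left_cancel₀ (natCast_ne_zero hd) hqx]

/-- Over the same prime the two ideals coincide, by their description through norms; over different
primes both products are the intersection. -/
theorem prime_mul_comm (hO : IsMaximalOrder O) {p q : ℕ} (hp : p.Prime) (hq : q.Prime)
    (hpr : ∀ [Fact p.Prime], IsRamifiedOver ℚ_[p] B) (hqr : ∀ [Fact q.Prime], IsRamifiedOver ℚ_[q] B)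
    {P Q : InvTwoSidedIdeal O} (hP : IsPrimeAbove p P) (hQ : IsPrimeAbove q Q) :
    P.carrier * Q.carrier = Q.carrier * P.carrier := by
  have hram : ∀ {r : ℕ}, r.Prime → (∀ [Fact r.Prime], IsRamifiedOver ℚ_[r] B) →
      ∀ (l : ℕ) [Fact l.Prime], l ∣ r → IsRamifiedOver ℚ_[l] B := by
    intro r hr hrr l hl hlr
    obtain rfl := (Nat.prime_dvd_prime_iff_eq hl.out hr).1 hlr
    exact hrr
  have hmP := mem_iff_of_mul_self_eq hO hp.ne_zero (hram hp hpr) hP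
  have hmQ := mem_iff_of_mul_self_eq hO hq.ne_zero (hram hq hqr) hQ
  by_cases h : p = q
  · subst h
    rw [show P.carrier = Q.carrier from Submodule.ext fun x => (hmP x).trans (hmQ x).symm]
  · have hc : p.Coprime q := (Nat.coprime_primes hp hq).2 h
    rw [mul_eq_inf_of_coprime P Q hc hP hQ (fun x hx => ((hmP x).1 hx).1)
      (fun x hx => ((hmQ x).1 hx).1), mul_eq_inf_of_coprime Q P hc.symm hQ hP
      (fun x hx => ((hmQ x).1 hx).1) (fun x hx => ((hmP x).1 hx).1), inf_comm]

end TwoSided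

end BrandtZeroes

namespace BrandtZeroes

/-! ### Closed paths of parity `-1` come from quadratic elements -/

theorem SignPattern.apply_one {N : ℕ} (ε : SignPattern N) (h : 1 ∣ N) : ε ⟨1, h⟩ = 1 := by
  have := ε.map_mul ⟨1, h⟩ ⟨1, h⟩ ⟨1, h⟩ (Nat.coprime_one_left 1) (mul_one 1).symm
  exact mul_eq_left.1 this.symm

/-- If `d k`, for odd squarefree `d ≠ 1` and `0 ≤ k ≤ 4`, is a rational square, then `k` is `0`
or `3`. -/
theorem eq_zero_or_three_of_sq_eq {d : ℕ} (hd : Squarefree d) (hodd : Odd d) (h1 : d ≠ 1) {r : ℚ}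
    {k : ℤ} (hk0 : 0 ≤ k) (hk4 : k ≤ 4) (h : r ^ 2 = d * k) : k = 0 ∨ k = 3 := by
  have hns : ∀ s : ℚ, s ^ 2 ≠ d := by
    intro s hs
    have : IsSquare (d : ℚ) := ⟨s, by rw [← hs, sq]⟩
    obtain ⟨w, hw⟩ := Rat.isSquare_natCast_iff.1 this
    have hw1 := Nat.isUnit_iff.1 (hd w ⟨1, by rw [hw, mul_one]⟩)
    exact h1 (by rw [hw, hw1])
  -- For k = 1 and k = 4 the number d would be a square; for k = 2 the number 2 d would be one, with
  -- d odd.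
  interval_cases k
  · exact Or.inl rfl
  · exact absurd (by simpa using h) (hns r)
  · exfalso
    have : IsSquare ((d * 2 : ℕ) : ℚ) := ⟨r, by rw [← sq, h]; push_cast; ring⟩
    obtain ⟨w, hw⟩ := Rat.isSquare_natCast_iff.1 this
    obtain ⟨e, rfl⟩ := hodd
    rcases Nat.even_or_odd' w with ⟨v, rfl | rfl⟩
    · have : 2 * (v * v) = 2 * e + 1 := by nlinarith
      omega
    · have : 2 * (2 * v * v + 2 * v) + 1 = (2 * e + 1) * 2 := by nlinarith
      omega
  · exact Or.inr rfl
  · exact absurd (by rw [div_pow, h]; push_cast; ring) (hns (r / 2))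

section Path
open DefiniteQuaternion
variable {B : Type*} [Ring B] [Algebra ℚ B] [DefiniteQuaternion B] {O : Subalgebra ℤ B} {N : ℕ}

/-- Q is the product of the primes along the path, and d collects those used an odd number of times.
A prime used again moves from d to m, and its two signs cancel. That Q commutes with all prime
ideals is carried along in order to compute Q² in the induction. -/
theorem exists_twoSided_of_signedPath (hO : IsMaximalOrder O) (hN : HasDiscriminant B N)
    {ε : SignPattern N} {x z : RightClassSet O} {s : ℤˣ} (h : SignedPath ε x z s) :
    ∃ (Q : InvTwoSidedIdeal O) (d : ℕ) (hd : d ∣ N) (m : ℕ), m ≠ 0 ∧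
      Q.carrier * Q.carrier = scaled (m ^ 2 * d) (Subalgebra.toSubmodule O) ∧
      (∀ (p : ℕ) (P : InvTwoSidedIdeal O), p.Prime → p ∣ N → IsPrimeAbove p P →
        Q.carrier * P.carrier = P.carrier * Q.carrier) ∧
      z = x.mul Q ∧ s = ε ⟨d, hd⟩ := by
  induction h with
  | nil x =>
    refine ⟨InvTwoSidedIdeal.unit hO.1, 1, one_dvd N, 1, one_ne_zero, ?_, ?_,
      (RightClassSet.mul_unit hO.1 x).symm, (ε.apply_one _).symm⟩
    · change Subalgebra.toSubmodule O * Subalgebra.toSubmodule O = _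
      rw [toSubmodule_mul_self, scaled, one_pow, one_mul, Nat.cast_one, ← Submodule.one_eq_span,
        one_mul]
    · exact fun p P _ _ _ => P.mul_left.trans P.mul_right.symm
  | @cons p hp hpN P hP x z s _ ih =>
    obtain ⟨Q, d, hd, m, hm, hQ, hcomm, hz, hs⟩ := ih
    have hsq : P.carrier * Q.carrier * (P.carrier * Q.carrier) =
        scaled (p * (m ^ 2 * d)) (Subalgebra.toSubmodule O) := by
      rw [mul_assoc, ← mul_assoc Q.carrier, hcomm p P hp hpN hP, mul_assoc P.carrier,
        ← mul_assoc P.carrier P.carrier, hQ, show P.carrier * P.carrier = scaled p _ from hP,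
        scaled_mul, mul_scaled, scaled_scaled, toSubmodule_mul_self]
    have hcomm' : ∀ (q : ℕ) (P' : InvTwoSidedIdeal O), q.Prime → q ∣ N → IsPrimeAbove q P' →
        P.carrier * Q.carrier * P'.carrier = P'.carrier * (P.carrier * Q.carrier) := by
      intro q P' hq hqN hP'
      have := prime_mul_comm hO hp hq ((hN.2 p).1 hpN) ((hN.2 q).1 hqN) hP hP'
      rw [mul_assoc, hcomm q P' hq hqN hP', ← mul_assoc, this, mul_assoc]
    have hz' : z = x.mul (P.mul Q) := by rw [hz, RightClassSet.mul_mul]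
    by_cases hpd : p ∣ d
    · obtain ⟨e, rfl⟩ := hpd
      have he : e ∣ N := (Dvd.intro_left p rfl).trans hd
      have hcop : p.Coprime e := by
        rw [hp.coprime_iff_not_dvd]
        rintro ⟨f, rfl⟩
        exact hp.one_lt.ne' (Nat.isUnit_iff.1 (hN.1 p (dvd_trans ⟨f, by ring⟩ hd)))
      refine ⟨P.mul Q, e, he, p * m, mul_ne_zero hp.ne_zero hm, ?_, hcomm', hz', ?_⟩
      · refine hsq.trans ?_
        congr 1
        ring
      · rw [hs, ε.map_mul ⟨p, hpN⟩ ⟨e, he⟩ ⟨p * e, hd⟩ hcop rfl, ← mul_assoc,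
          Int.units_mul_self, one_mul]
    · have hcop : p.Coprime d := (hp.coprime_iff_not_dvd).2 hpd
      have hpdN : p * d ∣ N := hcop.mul_dvd_of_dvd_of_dvd hpN hd
      refine ⟨P.mul Q, p * d, hpdN, m, hm, ?_, hcomm', hz', ?_⟩
      · refine hsq.trans ?_
        congr 1
        ring
      · rw [hs, ε.map_mul ⟨p, hpN⟩ ⟨d, hd⟩ ⟨p * d, hpdN⟩ hcop rfl]

/-- If `c I = I Q` with `Q² = n O`, then the reduced norm of `c` is `n` and its squared trace is an
integral multiple of `n`. -/
theorem nrd_trd_of_mul_eq {I : InvRightIdeal O} {Q : InvTwoSidedIdeal O} {n : ℕ} (hn : n ≠ 0)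
    (hQ : Q.carrier * Q.carrier = scaled n (Subalgebra.toSubmodule O)) {c : B}
    (hc : Submodule.span ℤ {c} * I.carrier = I.carrier * Q.carrier) :
    nrd c = n ∧ ∃ k : ℤ, trd c ^ 2 = n * k := by
  have hnQ : (n : ℚ) ≠ 0 := by exact_mod_cast hn
  have hI : Submodule.span ℤ {c * c} * I.carrier = scaled n I.carrier := by
    rw [← Set.singleton_mul_singleton, ← Submodule.span_mul_span, mul_assoc, hc, ← mul_assoc, hc,
      mul_assoc, hQ, mul_scaled, I.mul_right]
  have hcast : ∀ y : B, (n : ℚ)⁻¹ • ((n : B) * y) = y := fun y => by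
    rw [← map_natCast (algebraMap ℚ B), ← Algebra.smul_def, smul_smul, inv_mul_cancel₀ hnQ,
      one_smul]
  -- Since c² I = I Q² = n I, the element u is a unit of the left order of I. Its norm is a positive
  -- unit of ℤ, hence 1, and its trace is an integer.
  set u : B := (n : ℚ)⁻¹ • (c * c) with hu
  have hun : c * c = (n : B) * u := by
    rw [hu, mul_smul_comm, hcast]
  have hu1 : ∀ y ∈ I.carrier, u * y ∈ I.carrier := by
    intro y hy
    have h1 : c * c * y ∈ scaled n I.carrier := by
      rw [← hI]; exact Submodule.mem_span_singleton_mul.2 ⟨y, hy, rfl⟩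
    obtain ⟨z, hz, hzy⟩ := mem_scaled.1 h1
    rw [hu, smul_mul_assoc, ← hzy, hcast]
    exact hz
  have hu2 : ∀ y ∈ I.carrier, ∃ z ∈ I.carrier, u * z = y := by
    intro y hy
    have h1 : (n : B) * y ∈ Submodule.span ℤ {c * c} * I.carrier := by
      rw [hI]; exact natCast_mul_mem_scaled hy
    obtain ⟨z, hz, hzy⟩ := Submodule.mem_span_singleton_mul.1 h1
    exact ⟨z, hz, by rw [hu, smul_mul_assoc, hzy, hcast]⟩
  obtain ⟨y, hy, hy0⟩ : ∃ y ∈ I.carrier, y ≠ 0 := by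
    by_contra! h
    have h1 := I.isLattice.span_eq_top
    rw [Submodule.span_eq_bot.2 h] at h1
    exact bot_ne_top h1
  have hu0 : u ≠ 0 := by
    rintro h0
    obtain ⟨z, -, hz⟩ := hu2 y hy
    rw [h0, zero_mul] at hz
    exact hy0 hz.symm
  obtain ⟨v, hv⟩ := isUnit_of_ne_zero hu0
  have hv1 : ∀ y ∈ I.carrier, (↑v⁻¹ : B) * y ∈ I.carrier := by
    intro y hy
    obtain ⟨z, hz, rfl⟩ := hu2 y hy
    rwa [← hv, ← mul_assoc, Units.inv_mul, one_mul]
  obtain ⟨a, ha⟩ := nrd_mem_intRange_of_stable I.isLattice.fg hy hy0 hu1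
  obtain ⟨b, hb⟩ := nrd_mem_intRange_of_stable I.isLattice.fg hy hy0 hv1
  obtain ⟨t, ht⟩ := trd_mem_intRange_of_stable I.isLattice.fg hy hy0 hu1
  rw [eq_intCast] at ha hb ht
  have hab : a * b = 1 := by
    have : (a : ℚ) * b = 1 := by
      rw [ha, hb, ← nrd_mul, ← hv, Units.mul_inv, nrd_one]
    exact_mod_cast this
  have hnu : nrd u = 1 := by
    have hpos := nrd_pos u hu0
    rw [← ha] at hpos ⊢
    rcases Int.eq_one_or_neg_one_of_mul_eq_one hab with h | h
    · rw [h]; norm_num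
    · rw [h] at hpos; norm_num at hpos
  have hc0 : c ≠ 0 := by
    rintro rfl
    rw [mul_zero, smul_zero] at hu
    exact hu0 hu
  have hnc : nrd c = n := by
    have h1 : nrd c ^ 2 = (n : ℚ) ^ 2 := by rw [sq, ← nrd_mul, hun, nrd_natCast_mul, hnu, mul_one]
    rcases sq_eq_sq_iff_eq_or_eq_neg.1 h1 with h | h
    · exact h
    · have := nrd_pos c hc0
      have : (0 : ℚ) ≤ n := Nat.cast_nonneg n
      linarith
  -- From trd(c)² = trd(c²) + 2 nrd(c) and c² = n u.
  refine ⟨hnc, t + 2, ?_⟩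
  have h1 := trd_sq c
  rw [hun, trd_natCast_mul, ← ht, hnc] at h1
  push_cast
  linarith

/-- A closed path of parity `-1` yields a square root of `-d` in `B`, for some `d ∣ N` with
`ε_d = -1`. -/
theorem exists_mul_self_eq_of_closedPath (hO : IsMaximalOrder O) (hN : HasDiscriminant B N)
    (hodd : Odd N) {ε : SignPattern N} {x : RightClassSet O} (h : SignedPath ε x x (-1)) :
    ∃ (d : ℕ) (hd : d ∣ N), d ≠ 1 ∧ ε ⟨d, hd⟩ = -1 ∧
      ∃ y : B, y * y = algebraMap ℚ B ((-(d : ℤ) : ℤ) : ℚ) := by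
  obtain ⟨Q, d, hd, m, hm, hQ, -, hx, hs⟩ := exists_twoSided_of_signedPath hO hN h
  have hd1 : d ≠ 1 := by
    rintro rfl
    rw [ε.apply_one] at hs
    exact absurd hs (by decide)
  have hd0 : d ≠ 0 := by
    rintro rfl
    exact hN.1.ne_zero (zero_dvd_iff.1 hd)
  refine ⟨d, hd, hd1, hs.symm, ?_⟩
  induction x using Quotient.inductionOn with
  | h I =>
    obtain ⟨c, hc⟩ := Quotient.exact hx
    obtain ⟨hnc, k, hk⟩ := nrd_trd_of_mul_eq (mul_ne_zero (pow_ne_zero 2 hm) hd0) hQ hc.symm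
    have hmQ : (m : ℚ) ≠ 0 := by exact_mod_cast hm
    have hdpos : (0 : ℚ) < d := by exact_mod_cast Nat.pos_of_ne_zero hd0
    have hm2 : (0 : ℚ) < m ^ 2 * d := by positivity
    have hle := trd_sq_le (c : B)
    rw [hnc] at hle
    rw [hk] at hle
    push_cast at hk hle hnc
    have hk0 : 0 ≤ k := by
      have h1 : (0 : ℚ) ≤ m ^ 2 * d * k := hk ▸ sq_nonneg _
      exact_mod_cast (mul_nonneg_iff_of_pos_left hm2).1 h1
    have hk4 : k ≤ 4 := by
      have : (k : ℚ) ≤ 4 := le_of_mul_le_mul_left (by linarith) hm2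
      exact_mod_cast this
    -- The square of 2 c - trd c is (trd c)² - 4 nrd c = m² d (k - 4). Scaling by 1/(2m) for k = 0
    -- and by 1/m for k = 3 gives a square root of -d.
    have hsq : ∀ r : ℚ, (r • ((2 : ℚ) • (c : B) - algebraMap ℚ B (trd (c : B)))) *
        (r • ((2 : ℚ) • (c : B) - algebraMap ℚ B (trd (c : B)))) =
        algebraMap ℚ B (r ^ 2 * (m ^ 2 * d * (k - 4))) := by
      intro r
      have h1 : ((2 : ℚ) • (c : B) - algebraMap ℚ B (trd (c : B))) *
          ((2 : ℚ) • (c : B) - algebraMap ℚ B (trd (c : B))) =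
          algebraMap ℚ B (trd (c : B) ^ 2 - 4 * nrd (c : B)) := by
        have e1 := mul_self_eq (c : B)
        have e2 := Algebra.commutes (trd (c : B)) (c : B)
        simp only [two_smul, sub_mul, mul_sub, add_mul, mul_add, map_sub, map_mul, e1, ← e2,
          map_ofNat, sq]
        noncomm_ring
      rw [smul_mul_smul_comm, h1, hk, hnc, ← sq, Algebra.smul_def, ← map_mul]
      congr 2
      ring
    rcases eq_zero_or_three_of_sq_eq (r := trd (c : B) / m) (hN.1.squarefree_of_dvd hd)
      (hodd.of_dvd_nat hd) hd1 hk0 hk4 (by rw [div_pow, hk]; field_simp) with rfl | rfl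
    · refine ⟨_, (hsq (1 / (2 * m))).trans ?_⟩
      congr 1
      push_cast
      field_simp
      norm_num
    · refine ⟨_, (hsq (1 / m)).trans ?_⟩
      congr 1
      push_cast
      field_simp
      norm_num

end Path

end BrandtZeroes

namespace BrandtZeroes

/-! ### Lattices -/

section Lattice
variable {B : Type*} [Ring B] [Algebra ℚ B]

theorem isLattice_of_le {M L : Submodule ℤ B} (hM : Submodule.IsLattice ℚ M) (hML : M ≤ L)
    (hL : L.FG) : Submodule.IsLattice ℚ L where
  fg := hL
  span_eq_top := by
    rw [eq_top_iff, ← hM.span_eq_top]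
    exact Submodule.span_mono hML

theorem inv_smul_natCast_mul {n : ℕ} (hn : n ≠ 0) (x : B) : (n : ℚ)⁻¹ • ((n : B) * x) = x := by
  rw [← map_natCast (algebraMap ℚ B), ← Algebra.smul_def, smul_smul,
    inv_mul_cancel₀ (by exact_mod_cast hn), one_smul]

theorem natCast_mul_inv_smul {n : ℕ} (hn : n ≠ 0) (x : B) : (n : B) * ((n : ℚ)⁻¹ • x) = x := by
  rw [mul_smul_comm, inv_smul_natCast_mul hn]

theorem isLattice_of_natCast_mul_mem {M L : Submodule ℤ B} (hM : Submodule.IsLattice ℚ M)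
    (hL : L.FG) {n : ℕ} (hn : n ≠ 0) (h : ∀ x ∈ M, (n : B) * x ∈ L) : Submodule.IsLattice ℚ L where
  fg := hL
  span_eq_top := by
    rw [eq_top_iff, ← hM.span_eq_top, Submodule.span_le]
    intro x hx
    rw [← inv_smul_natCast_mul hn x]
    exact Submodule.smul_mem _ _ (Submodule.subset_span (h x hx))

theorem exists_natCast_mul_mem {M : Submodule ℤ B} (hM : Submodule.IsLattice ℚ M) (x : B) :
    ∃ n : ℕ, n ≠ 0 ∧ (n : B) * x ∈ M := by
  have hx : x ∈ Submodule.span ℚ (M : Set B) := by rw [hM.span_eq_top]; trivial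
  induction hx using Submodule.span_induction with
  | mem x hx => exact ⟨1, one_ne_zero, by simpa using hx⟩
  | zero => exact ⟨1, one_ne_zero, by simp⟩
  | add x y _ _ ihx ihy =>
    obtain ⟨m, hm, hmx⟩ := ihx
    obtain ⟨n, hn, hny⟩ := ihy
    refine ⟨m * n, mul_ne_zero hm hn, ?_⟩
    rw [mul_add]
    refine add_mem ?_ ?_
    · rw [mul_comm m, Nat.cast_mul, mul_assoc]; exact natCast_mul_mem n hmx
    · rw [Nat.cast_mul, mul_assoc]; exact natCast_mul_mem m hny
  | smul c x _ ih =>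
    obtain ⟨n, hn, hnx⟩ := ih
    refine ⟨c.den * n, mul_ne_zero c.den_nz hn, ?_⟩
    have h1 : ((c.den * n : ℕ) : B) * (c • x) = (c.num : B) * ((n : B) * x) := by
      rw [Nat.cast_mul, mul_assoc, mul_smul_comm, ← map_natCast (algebraMap ℚ B) c.den,
        ← Algebra.smul_def, smul_smul, mul_comm (c.den : ℚ), Rat.mul_den_eq_num, Algebra.smul_def,
        map_intCast]
    rw [h1]
    exact intCast_mul_mem _ hnx

theorem exists_natCast_mul_mul_mem {M L : Submodule ℤ B} (hM : M.FG)
    (hL : Submodule.IsLattice ℚ L) (x : B) :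
    ∃ n : ℕ, n ≠ 0 ∧ ∀ y ∈ M, (n : B) * (x * y) ∈ L := by
  induction M, hM using Submodule.fg_induction with
  | singleton y =>
    obtain ⟨n, hn, h⟩ := exists_natCast_mul_mem hL (x * y)
    refine ⟨n, hn, fun z hz => ?_⟩
    obtain ⟨c, rfl⟩ := Submodule.mem_span_singleton.1 hz
    rw [mul_smul_comm, mul_smul_comm]
    exact L.smul_mem c h
  | sup M₁ M₂ _ _ ih₁ ih₂ =>
    obtain ⟨m, hm, h₁⟩ := ih₁
    obtain ⟨n, hn, h₂⟩ := ih₂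
    refine ⟨m * n, mul_ne_zero hm hn, fun z hz => ?_⟩
    obtain ⟨u, hu, v, hv, rfl⟩ := Submodule.mem_sup.1 hz
    rw [mul_add, mul_add]
    refine add_mem ?_ ?_
    · rw [mul_comm m, Nat.cast_mul, mul_assoc]; exact natCast_mul_mem n (h₁ u hu)
    · rw [Nat.cast_mul, mul_assoc]; exact natCast_mul_mem m (h₂ v hv)

theorem exists_ne_zero_of_isLattice [Nontrivial B] {M : Submodule ℤ B}
    (hM : Submodule.IsLattice ℚ M) : ∃ y ∈ M, y ≠ 0 := by
  by_contra! h
  have h1 := hM.span_eq_top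
  rw [Submodule.span_eq_bot.2 h] at h1
  exact bot_ne_top h1

end Lattice

/-! ### Two-sided prime ideals -/

section Prime
open DefiniteQuaternion
variable {B : Type*} [Ring B] [Algebra ℚ B] [DefiniteQuaternion B] {O : Subalgebra ℤ B}

theorem nrd_eq_of_mul_self {d : ℕ} (hd : d ≠ 0) {b : B}
    (hb : b * b = algebraMap ℚ B ((-(d : ℤ) : ℤ) : ℚ)) : nrd b = d := by
  have hdpos : (0 : ℚ) < d := by exact_mod_cast Nat.pos_of_ne_zero hd
  have h1 : nrd b ^ 2 = (d : ℚ) ^ 2 := by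
    rw [sq, ← nrd_mul, hb, nrd_algebraMap]; push_cast; ring
  have h0 : b ≠ 0 := by
    rintro rfl
    rw [nrd_zero, zero_pow two_ne_zero, eq_comm, pow_eq_zero_iff two_ne_zero] at h1
    exact hdpos.ne' h1
  rcases sq_eq_sq_iff_eq_or_eq_neg.1 h1 with h | h
  · exact h
  · have := nrd_pos b h0
    linarith

/-- If `B` contains `√-d`, where `p` divides `d` exactly once and `B` is ramified at `p`, then
there is a two-sided prime ideal above `p`. -/
theorem exists_isPrimeAbove (hO : IsMaximalOrder O) {p d : ℕ} [Fact p.Prime]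
    (hram : IsRamifiedOver ℚ_[p] B) (hpd : p ∣ d) (hpd2 : ¬ p * p ∣ d) {b : B}
    (hb : b * b = algebraMap ℚ B ((-(d : ℤ) : ℤ) : ℚ)) :
    ∃ P : InvTwoSidedIdeal O, IsPrimeAbove p P := by
  have hp : p.Prime := Fact.out
  have hp0 : p ≠ 0 := hp.ne_zero
  have hpQ : (p : ℚ) ≠ 0 := by exact_mod_cast hp0
  have hd0 : d ≠ 0 := by rintro rfl; exact hpd2 (dvd_zero _)
  have key : ∀ x ∈ O, (∃ z : ℤ, nrd x = p ^ 2 * z) → ∃ w ∈ O, (p : B) * w = x := by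
    rintro x hx ⟨z, hz⟩
    refine ⟨(p : ℚ)⁻¹ • x, hO.mem_of_pow_mul_mem hram (k := 1) ?_ ?_, natCast_mul_inv_smul hp0 x⟩
    · rwa [pow_one, natCast_mul_inv_smul hp0]
    · refine norm_le_one_of_mem_intRange ⟨z, ?_⟩
      rw [nrd_smul, hz, eq_intCast]
      field_simp
  -- The candidate consists of the elements of O with norm divisible by p. For x, y in it, `x * conj
  -- y` has norm divisible by p², so it lies in p O by `key`, and the cross term of nrd (x + y) is
  -- divisible by p.
  let M : Submodule ℤ B :=
    { carrier := {x | x ∈ O ∧ ∃ z : ℤ, nrd x = p * z}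
      zero_mem' := ⟨O.zero_mem, 0, by rw [nrd_zero]; simp⟩
      add_mem' := by
        rintro x y ⟨hx, z, hz⟩ ⟨hy, z', hz'⟩
        obtain ⟨w, hw, hwx⟩ := key (x * conj y) (O.mul_mem hx (hO.conj_mem hy))
          ⟨z * z', by rw [nrd_mul, nrd_conj, hz, hz']; push_cast; ring⟩
        obtain ⟨t, ht⟩ := hO.1.trd_mem hw
        rw [eq_intCast] at ht
        refine ⟨O.add_mem hx hy, z + z' + t, ?_⟩
        rw [nrd_add, hz, hz', ← hwx, trd_natCast_mul, ← ht]
        push_cast; ring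
      smul_mem' := by
        rintro c x ⟨hx, z, hz⟩
        refine ⟨O.smul_mem hx c, c ^ 2 * z, ?_⟩
        rw [zsmul_eq_mul, nrd_intCast_mul, hz]
        push_cast; ring }
  have hMO : M ≤ Subalgebra.toSubmodule O := fun x hx => hx.1
  have hr : ∀ x ∈ M, ∀ o ∈ O, x * o ∈ M := by
    rintro x ⟨hx, z, hz⟩ o ho
    obtain ⟨n, hn⟩ := hO.1.nrd_mem ho
    rw [eq_intCast] at hn
    exact ⟨O.mul_mem hx ho, z * n, by rw [nrd_mul, hz, ← hn]; push_cast; ring⟩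
  have hl : ∀ o ∈ O, ∀ x ∈ M, o * x ∈ M := by
    rintro o ho x ⟨hx, z, hz⟩
    obtain ⟨n, hn⟩ := hO.1.nrd_mem ho
    rw [eq_intCast] at hn
    exact ⟨O.mul_mem ho hx, n * z, by rw [nrd_mul, hz, ← hn]; push_cast; ring⟩
  have hpM : (p : B) ∈ M := ⟨natCast_mem O p, p, by
    have := nrd_natCast_mul p (1 : B)
    rw [mul_one, nrd_one, mul_one] at this
    rw [this]; push_cast; ring⟩
  have hMr : M * Subalgebra.toSubmodule O = M := le_antisymm
    (Submodule.mul_le.2 hr) fun x hx => by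
      simpa using Submodule.mul_mem_mul hx (show (1 : B) ∈ Subalgebra.toSubmodule O from one_mem O)
  have hMl : Subalgebra.toSubmodule O * M = M := le_antisymm
    (Submodule.mul_le.2 hl) fun x hx => by
      simpa using Submodule.mul_mem_mul (show (1 : B) ∈ Subalgebra.toSubmodule O from one_mem O) hx
  have hlat : Submodule.IsLattice ℚ M :=
    isLattice_of_natCast_mul_mem hO.1 (hO.1.fg.of_le hMO) hp0 fun x hx => hr _ hpM x hx
  have hMM : M * M = scaled p (Subalgebra.toSubmodule O) := by
    apply le_antisymm
    · rw [Submodule.mul_le]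
      rintro x ⟨hx, z, hz⟩ y ⟨hy, z', hz'⟩
      exact mem_scaled.2 (key (x * y) (O.mul_mem hx hy)
        ⟨z * z', by rw [nrd_mul, hz, hz']; push_cast; ring⟩)
    -- This inclusion needs an element whose norm has p-valuation 1: a multiple m b with p ∤ m.
    -- Writing d = p e, its square is -p m² e with p ∤ m² e; together with p² ∈ M² this gives p ∈
    -- M².
    · obtain ⟨n, hn, hnb⟩ := exists_natCast_mul_mem hO.1 b
      obtain ⟨k, m, hpm, rfl⟩ := Nat.exists_eq_pow_mul_and_not_dvd hn p hp.ne_one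
      obtain ⟨e, rfl⟩ := hpd
      have hnrd := nrd_eq_of_mul_self hd0 hb
      have hmb : (m : B) * b ∈ M := by
        have h1 : nrd ((m : B) * b) = p * ((m ^ 2 * e : ℕ) : ℤ) := by
          rw [nrd_natCast_mul, hnrd]; push_cast; ring
        refine ⟨hO.mem_of_pow_mul_mem hram (k := k) ?_ ?_, _, h1⟩
        · rw [← mul_assoc, ← Nat.cast_pow, ← Nat.cast_mul]; exact hnb
        · rw [h1]
          exact norm_le_one_of_mem_intRange
            (mul_mem (natCast_mem _ p) (intCast_mem_intRange _))
      have hcop : Nat.Coprime (m ^ 2 * e) p := by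
        refine Nat.Coprime.symm ((hp.coprime_iff_not_dvd).2 fun h => ?_)
        rcases hp.dvd_mul.1 h with h | h
        · exact hpm (hp.dvd_of_dvd_pow h)
        · exact hpd2 (mul_dvd_mul_left p h)
      have h1 : ((p * (m ^ 2 * e) : ℕ) : B) ∈ M * M := by
        have e1 : (m : B) * b * ((m : B) * b) = -((p * (m ^ 2 * e) : ℕ) : B) := by
          rw [mul_assoc, ← mul_assoc b, ← (Nat.cast_commute m b).eq, mul_assoc, hb, map_intCast,
            ← mul_assoc, Int.cast_neg, Int.cast_natCast, mul_neg, ← Nat.cast_mul, ← Nat.cast_mul]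
          congr 2
          ring
        rw [← neg_neg ((p * (m ^ 2 * e) : ℕ) : B), ← e1]
        exact Submodule.neg_mem _ (Submodule.mul_mem_mul hmb hmb)
      have h2 : ((p * p : ℕ) : B) ∈ M * M := by
        rw [Nat.cast_mul]; exact Submodule.mul_mem_mul hpM hpM
      have h3 : (p : B) ∈ M * M := by
        have hbez : ((m ^ 2 * e : ℕ) : ℤ) * (m ^ 2 * e).gcdA p + p * (m ^ 2 * e).gcdB p = 1 := by
          rw [← Nat.gcd_eq_gcd_ab, hcop]; rfl
        have h4 : (p : ℤ) = (m ^ 2 * e).gcdA p * ((p * (m ^ 2 * e) : ℕ) : ℤ) +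
            (m ^ 2 * e).gcdB p * ((p * p : ℕ) : ℤ) := by
          conv_lhs => rw [← mul_one (p : ℤ), ← hbez]
          push_cast; ring
        have h5 : (p : B) = ((m ^ 2 * e).gcdA p : B) * ((p * (m ^ 2 * e) : ℕ) : B) +
            ((m ^ 2 * e).gcdB p : B) * ((p * p : ℕ) : B) := by
          exact_mod_cast congrArg (fun w : ℤ => (w : B)) h4
        rw [h5]
        exact add_mem (intCast_mul_mem _ h1) (intCast_mul_mem _ h2)
      intro x hx
      obtain ⟨o, ho, rfl⟩ := mem_scaled.1 hx
      have := Submodule.mul_mem_mul h3 ho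
      rwa [mul_assoc, hMr] at this
  have hcentral : ∀ L : Submodule ℤ B, L * Submodule.span ℤ {algebraMap ℚ B (p : ℚ)⁻¹} =
      Submodule.span ℤ {algebraMap ℚ B (p : ℚ)⁻¹} * L := by
    intro L
    ext x
    rw [Submodule.mem_mul_span_singleton, Submodule.mem_span_singleton_mul]
    simp only [Algebra.commutes]
  have hinv : Submodule.span ℤ {algebraMap ℚ B (p : ℚ)⁻¹} *
      scaled p (Subalgebra.toSubmodule O) = Subalgebra.toSubmodule O := by
    rw [scaled, ← mul_assoc, Submodule.span_mul_span, Set.singleton_mul_singleton,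
      ← map_natCast (algebraMap ℚ B), ← map_mul, inv_mul_cancel₀ hpQ, map_one,
      ← Submodule.one_eq_span, one_mul]
  refine ⟨⟨M, hlat, hMr, hMl, Submodule.span ℤ {algebraMap ℚ B (p : ℚ)⁻¹} * M, ?_, ?_, ?_⟩, hMM⟩
  · refine isLattice_of_le hlat (fun x hx => ?_) ((Submodule.fg_span_singleton _).mul hlat.fg)
    refine Submodule.mem_span_singleton_mul.2 ⟨(p : B) * x, natCast_mul_mem p hx, ?_⟩
    rw [← Algebra.smul_def, inv_smul_natCast_mul hp0]
  · rw [mul_assoc, hMM, hinv]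
  · rw [← mul_assoc, hcentral, mul_assoc, hMM, hinv]

end Prime

end BrandtZeroes

namespace BrandtZeroes

/-! ### Invertibility of lattices over maximal orders -/

section
variable {B : Type*} [Ring B] {O : Subalgebra ℤ B}

theorem mul_mem_scaled_left {p : ℕ} {o x : B} (ho : o ∈ O)
    (hx : x ∈ scaled p (Subalgebra.toSubmodule O)) :
    o * x ∈ scaled p (Subalgebra.toSubmodule O) := by
  obtain ⟨w, hw, rfl⟩ := mem_scaled.1 hx
  rw [← mul_assoc, ← (Nat.cast_commute p o).eq, mul_assoc]
  exact natCast_mul_mem_scaled (O.mul_mem ho hw)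

theorem mul_mem_scaled_right {p : ℕ} {o x : B} (ho : o ∈ O)
    (hx : x ∈ scaled p (Subalgebra.toSubmodule O)) :
    x * o ∈ scaled p (Subalgebra.toSubmodule O) := by
  obtain ⟨w, hw, rfl⟩ := mem_scaled.1 hx
  rw [mul_assoc]
  exact natCast_mul_mem_scaled (O.mul_mem hw ho)

/-- The lattice `{x ∈ B : x I ⊆ O}`. -/
def leftInverse (O : Subalgebra ℤ B) (I : Submodule ℤ B) : Submodule ℤ B where
  carrier := {x | ∀ y ∈ I, x * y ∈ O}
  add_mem' ha hb y hy := by rw [add_mul]; exact O.add_mem (ha y hy) (hb y hy)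
  zero_mem' y _ := by rw [zero_mul]; exact O.zero_mem
  smul_mem' c x hx y hy := by rw [smul_mul_assoc]; exact O.smul_mem (hx y hy) c

theorem mul_mem_leftInverse {I : Submodule ℤ B} {o x : B} (ho : o ∈ O)
    (hx : x ∈ leftInverse O I) : o * x ∈ leftInverse O I := fun y hy => by
  rw [mul_assoc]; exact O.mul_mem ho (hx y hy)

theorem leftInverse_mul_le (O : Subalgebra ℤ B) (I : Submodule ℤ B) :
    leftInverse O I * I ≤ Subalgebra.toSubmodule O :=
  Submodule.mul_le.2 fun _ hx _ hy => hx _ hy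

/-- If the squares of all elements of a two-sided ideal `K` lie in `p O`, some two-sided ideal
`X ⊄ p O` satisfies `X K ⊆ p O`. -/
theorem exists_annihilator {p : ℕ} (h1 : (1 : B) ∉ scaled p (Subalgebra.toSubmodule O))
    {K : Submodule ℤ B} (hKO : ∀ k ∈ K, k ∈ O) (hKl : ∀ o ∈ O, ∀ k ∈ K, o * k ∈ K)
    (hsq : ∀ k ∈ K, k * k ∈ scaled p (Subalgebra.toSubmodule O)) (hK : K.FG) :
    ∃ X : Submodule ℤ B, (∀ x ∈ X, x ∈ O) ∧ (∀ o ∈ O, ∀ x ∈ X, o * x ∈ X) ∧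
      (∀ x ∈ X, ∀ k ∈ K, x * k ∈ scaled p (Subalgebra.toSubmodule O)) ∧
      ∃ x ∈ X, x ∉ scaled p (Subalgebra.toSubmodule O) := by
  classical
  -- Polarization: k o k is expressed through the squares of k + o k, k and o k.
  have hkok : ∀ k ∈ K, ∀ o ∈ O, k * o * k ∈ scaled p (Subalgebra.toSubmodule O) := by
    intro k hk o ho
    have : k * o * k = (k + o * k) * (k + o * k) - k * k - o * (k * k) - o * k * (o * k) := by
      noncomm_ring
    rw [this]
    exact sub_mem (sub_mem (sub_mem (hsq _ (add_mem hk (hKl o ho k hk))) (hsq k hk))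
      (mul_mem_scaled_left ho (hsq k hk))) (hsq _ (hKl o ho k hk))
  -- Modulo p, K is a nil ideal and its annihilator is found generator by generator. If X k is not
  -- in p O, pass to the x ∈ X with x O k ⊆ p O; these include some x₁ k outside p O, because k O k
  -- ⊆ p O.
  have hfin : ∀ s : Finset B, (∀ k ∈ s, k ∈ K) → ∃ X : Submodule ℤ B, (∀ x ∈ X, x ∈ O) ∧
      (∀ o ∈ O, ∀ x ∈ X, o * x ∈ X) ∧ (∀ x ∈ X, ∀ o ∈ O, x * o ∈ X) ∧
      (∀ x ∈ X, ∀ k ∈ s, x * k ∈ scaled p (Subalgebra.toSubmodule O)) ∧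
      ∃ x ∈ X, x ∉ scaled p (Subalgebra.toSubmodule O) := by
    intro s
    induction s using Finset.induction_on with
    | empty =>
      exact fun _ => ⟨Subalgebra.toSubmodule O, fun _ h => h, fun _ ho _ hx => O.mul_mem ho hx,
        fun _ hx _ ho => O.mul_mem hx ho, fun _ _ _ h => absurd h (Finset.notMem_empty _),
        1, one_mem O, h1⟩
    | insert k s _ ih =>
      intro hs
      obtain ⟨X, hXO, hXl, hXr, hXs, x₀, hx₀, hx₀'⟩ :=
        ih fun k' hk' => hs k' (Finset.mem_insert_of_mem hk')
      have hk := hs k (Finset.mem_insert_self k s)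
      by_cases hXk : ∀ x ∈ X, x * k ∈ scaled p (Subalgebra.toSubmodule O)
      · refine ⟨X, hXO, hXl, hXr, fun x hx k' hk' => ?_, x₀, hx₀, hx₀'⟩
        rcases Finset.mem_insert.1 hk' with rfl | hk'
        · exact hXk x hx
        · exact hXs x hx k' hk'
      · push Not at hXk
        obtain ⟨x₁, hx₁, hx₁'⟩ := hXk
        let X' : Submodule ℤ B :=
          { carrier := {x | x ∈ X ∧ ∀ o ∈ O, x * o * k ∈ scaled p (Subalgebra.toSubmodule O)}
            zero_mem' := ⟨X.zero_mem, fun o _ => by rw [zero_mul, zero_mul]; exact zero_mem _⟩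
            add_mem' := fun ha hb => ⟨X.add_mem ha.1 hb.1, fun o ho => by
              rw [add_mul, add_mul]; exact add_mem (ha.2 o ho) (hb.2 o ho)⟩
            smul_mem' := fun c x hx => ⟨X.smul_mem c hx.1, fun o ho => by
              rw [smul_mul_assoc, smul_mul_assoc]; exact Submodule.smul_mem _ c (hx.2 o ho)⟩ }
        refine ⟨X', fun x hx => hXO x hx.1, fun o ho x hx => ⟨hXl o ho x hx.1, fun o' ho' => ?_⟩,
          fun x hx o ho => ⟨hXr x hx.1 o ho, fun o' ho' => ?_⟩, fun x hx k' hk' => ?_, x₁ * k,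
          ⟨hXr x₁ hx₁ k (hKO k hk), fun o ho => ?_⟩, hx₁'⟩
        · rw [mul_assoc o, mul_assoc o]
          exact mul_mem_scaled_left ho (hx.2 o' ho')
        · rw [mul_assoc x]
          exact hx.2 _ (O.mul_mem ho ho')
        · rcases Finset.mem_insert.1 hk' with rfl | hk'
          · simpa using hx.2 1 (one_mem O)
          · exact hXs x hx.1 k' hk'
        · rw [mul_assoc x₁, mul_assoc x₁]
          exact mul_mem_scaled_left (hXO x₁ hx₁) (hkok k hk o ho)
  obtain ⟨s, hs⟩ := hK
  obtain ⟨X, hXO, hXl, -, hXs, hX⟩ := hfin s fun k hk => hs ▸ Submodule.subset_span hk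
  refine ⟨X, hXO, hXl, fun x hx k hk => ?_, hX⟩
  rw [← hs] at hk
  induction hk using Submodule.span_induction with
  | mem k hk => exact hXs x hx k hk
  | zero => rw [mul_zero]; exact zero_mem _
  | add a b _ _ ha hb => rw [mul_add]; exact add_mem ha hb
  | smul c a _ ha => rw [mul_smul_comm]; exact Submodule.smul_mem _ c ha

end

section Invertible
open DefiniteQuaternion
variable {B : Type*} [Ring B] [Algebra ℚ B] [DefiniteQuaternion B] {O : Subalgebra ℤ B}

/-- The image of a lattice under the canonical involution. -/
def conjLattice (M : Submodule ℤ B) : Submodule ℤ B :=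
  M.comap ((conj (B := B)).restrictScalars ℤ)

theorem mem_conjLattice {M : Submodule ℤ B} {x : B} : x ∈ conjLattice M ↔ conj x ∈ M := Iff.rfl

theorem isLattice_conjLattice {M : Submodule ℤ B} (hM : Submodule.IsLattice ℚ M) :
    Submodule.IsLattice ℚ (conjLattice M) where
  fg := by
    have : conjLattice M = M.map ((conj (B := B)).restrictScalars ℤ) := by
      ext x
      constructor
      · exact fun hx => ⟨conj x, hx, conj_conj x⟩
      · rintro ⟨y, hy, rfl⟩
        exact mem_conjLattice.2 (by simpa [conj_conj] using hy)
    rw [this]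
    exact hM.fg.map _
  span_eq_top := by
    rw [eq_top_iff]
    intro x _
    have hx : conj x ∈ Submodule.span ℚ (M : Set B) := by rw [hM.span_eq_top]; trivial
    rw [← conj_conj x]
    generalize conj x = y at hx
    induction hx using Submodule.span_induction with
    | mem y hy => exact Submodule.subset_span (mem_conjLattice.2 (by rwa [conj_conj]))
    | zero => rw [map_zero]; exact Submodule.zero_mem _
    | add a b _ _ ha hb => rw [map_add]; exact add_mem ha hb
    | smul c a _ ha => rw [map_smul]; exact Submodule.smul_mem _ c ha

/-- The right order of a lattice that is stable under right multiplication by `O` is `O`. -/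
theorem IsMaximalOrder.mem_of_stable_right (hO : IsMaximalOrder O) {M : Submodule ℤ B}
    (hM : Submodule.IsLattice ℚ M) (h : ∀ m ∈ M, ∀ o ∈ O, m * o ∈ M) {x : B}
    (hx : ∀ m ∈ M, m * x ∈ M) : x ∈ O := by
  have : conj x ∈ O := hO.mem_of_stable (isLattice_conjLattice hM)
    (fun o ho m hm => mem_conjLattice.2 (by
      rw [DefiniteQuaternion.conj_mul]; exact h _ hm _ (hO.conj_mem ho)))
    (fun m hm => mem_conjLattice.2 (by rw [DefiniteQuaternion.conj_mul, conj_conj]; exact hx _ hm))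
  simpa [conj_conj] using hO.conj_mem this

theorem conj_mem_scaled (hO : IsMaximalOrder O) {p : ℕ} {x : B}
    (hx : x ∈ scaled p (Subalgebra.toSubmodule O)) :
    conj x ∈ scaled p (Subalgebra.toSubmodule O) := by
  obtain ⟨o, ho, rfl⟩ := mem_scaled.1 hx
  refine mem_scaled.2 ⟨conj o, hO.conj_mem ho, ?_⟩
  rw [DefiniteQuaternion.conj_mul, ← map_natCast (algebraMap ℚ B), conj_algebraMap, Algebra.commutes]

/-- A two-sided ideal `T` of a maximal order `O` containing a prime number is `O` if only elements of
`O` multiply it into `O`. -/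
theorem one_mem_of_prime_mem (hO : IsMaximalOrder O) {T : Submodule ℤ B} (hTO : ∀ t ∈ T, t ∈ O)
    (hTl : ∀ o ∈ O, ∀ t ∈ T, o * t ∈ T) (hTr : ∀ t ∈ T, ∀ o ∈ O, t * o ∈ T) {p : ℕ}
    (hp : p.Prime) (hpT : (p : B) ∈ T) (hT : ∀ x : B, (∀ t ∈ T, x * t ∈ O) → x ∈ O) :
    (1 : B) ∈ T := by
  -- If 1 ∉ T, then T ∩ ℤ = p ℤ. For k ∈ K = T ∩ conj T, trace and norm lie in T ∩ ℤ, so k² = trd(k)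
  -- k - nrd(k) ∈ p O, and some X not contained in p O has X K ⊆ p O. As (conj T) T ⊆ K, the
  -- hypothesis on T gives X (conj T) ⊆ p O; from this follow (conj T) X ⊆ p O and, by conjugation,
  -- (conj X) T ⊆ p O. So conj X ⊆ p O, hence X ⊆ p O, a contradiction.
  by_contra h1
  have hp0 := hp.ne_zero
  have hpOT : ∀ x ∈ scaled p (Subalgebra.toSubmodule O), x ∈ T := by
    intro x hx
    obtain ⟨o, ho, rfl⟩ := mem_scaled.1 hx
    exact hTr _ hpT o ho
  have hint : ∀ w : ℤ, (w : B) ∈ T → ∃ z : ℤ, w = p * z := by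
    intro w hw
    by_contra hpw
    have hcop : IsCoprime (p : ℤ) w :=
      (Nat.prime_iff_prime_int.1 hp).coprime_iff_not_dvd.2 fun ⟨z, hz⟩ => hpw ⟨z, hz⟩
    obtain ⟨a, b, hab⟩ := hcop
    refine h1 ?_
    have : (1 : B) = (a : B) * (p : B) + (b : B) * (w : B) := by
      exact_mod_cast congrArg (fun w : ℤ => (w : B)) hab.symm
    rw [this]
    exact add_mem (intCast_mul_mem a hpT) (intCast_mul_mem b hw)
  let K : Submodule ℤ B := T ⊓ conjLattice T
  have hKO : ∀ k ∈ K, k ∈ O := fun k hk => hTO k hk.1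
  have hKl : ∀ o ∈ O, ∀ k ∈ K, o * k ∈ K := fun o ho k hk =>
    ⟨hTl o ho k hk.1, mem_conjLattice.2 (by rw [DefiniteQuaternion.conj_mul]; exact hTr _ hk.2 _ (hO.conj_mem ho))⟩
  have hsq : ∀ k ∈ K, k * k ∈ scaled p (Subalgebra.toSubmodule O) := by
    intro k hk
    obtain ⟨t, ht⟩ := hO.1.trd_mem (hKO k hk)
    obtain ⟨n, hn⟩ := hO.1.nrd_mem (hKO k hk)
    rw [eq_intCast] at ht hn
    obtain ⟨t', rfl⟩ := hint t (by
      have : (t : B) = k + conj k := by rw [add_conj, ← ht, map_intCast]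
      rw [this]; exact add_mem hk.1 hk.2)
    obtain ⟨n', rfl⟩ := hint n (by
      have : (n : B) = k * conj k := by rw [mul_conj, ← hn, map_intCast]
      rw [this]; exact hTr _ hk.1 _ (hTO _ hk.2))
    refine mem_scaled.2 ⟨t' * k - n', O.sub_mem (O.mul_mem (intCast_mem O t') (hKO k hk))
      (intCast_mem O n'), ?_⟩
    rw [mul_self_eq, ← ht, ← hn, map_intCast, map_intCast]
    push_cast
    noncomm_ring
  have hKfg : K.FG := hO.1.fg.of_le hKO
  obtain ⟨X, hXO, hXl, hXK, x₀, hx₀, hx₀'⟩ :=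
    exists_annihilator (fun h => h1 (hpOT 1 h)) hKO hKl hsq hKfg
  have hTs : ∀ x : B, (∀ t ∈ T, x * t ∈ scaled p (Subalgebra.toSubmodule O)) →
      x ∈ scaled p (Subalgebra.toSubmodule O) := by
    intro x hx
    refine mem_scaled.2 ⟨(p : ℚ)⁻¹ • x, hT _ fun t ht => ?_, natCast_mul_inv_smul hp0 x⟩
    obtain ⟨o, ho, hot⟩ := mem_scaled.1 (hx t ht)
    rw [smul_mul_assoc, ← hot, inv_smul_natCast_mul hp0]
    exact ho
  have hX1 : ∀ x ∈ X, ∀ t ∈ T, x * conj t ∈ scaled p (Subalgebra.toSubmodule O) := by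
    intro x hx t ht
    refine hTs _ fun t' ht' => ?_
    rw [mul_assoc]
    refine hXK x hx _ ⟨hTl _ (hO.conj_mem (hTO t ht)) t' ht', mem_conjLattice.2 ?_⟩
    rw [DefiniteQuaternion.conj_mul, conj_conj]
    exact hTl _ (hO.conj_mem (hTO t' ht')) t ht
  have hTlat : Submodule.IsLattice ℚ T :=
    isLattice_of_natCast_mul_mem hO.1 (hO.1.fg.of_le hTO) hp0 fun o ho => hTr _ hpT o ho
  -- The element (conj t) x / p maps conj T into itself, and the left order of conj T is O.
  have hX2 : ∀ x ∈ X, ∀ t ∈ T, conj t * x ∈ scaled p (Subalgebra.toSubmodule O) := by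
    intro x hx t ht
    refine mem_scaled.2 ⟨(p : ℚ)⁻¹ • (conj t * x), ?_, natCast_mul_inv_smul hp0 _⟩
    refine hO.mem_of_stable (isLattice_conjLattice hTlat) (fun o ho m hm => mem_conjLattice.2 (by
      rw [DefiniteQuaternion.conj_mul]; exact hTr _ hm _ (hO.conj_mem ho))) fun m hm => ?_
    obtain ⟨o, ho, hom⟩ := mem_scaled.1 (hX1 x hx _ (mem_conjLattice.1 hm))
    rw [conj_conj] at hom
    rw [smul_mul_assoc, mul_assoc, ← hom, ← mul_assoc, ← (Nat.cast_commute p _).eq, mul_assoc,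
      inv_smul_natCast_mul hp0, mem_conjLattice, DefiniteQuaternion.conj_mul, conj_conj]
    exact hTl _ (hO.conj_mem ho) t ht
  have hX3 := hTs (conj x₀) fun t ht => by
    have := conj_mem_scaled hO (hX2 x₀ hx₀ t ht)
    rwa [DefiniteQuaternion.conj_mul, conj_conj] at this
  have := conj_mem_scaled hO hX3
  rw [conj_conj] at this
  exact hx₀' this

/-- A two-sided ideal `T` of full rank of a maximal order `O` is `O` if only elements of `O`
multiply it into `O`. -/
theorem one_mem_of_natCast_mem (hO : IsMaximalOrder O) {T : Submodule ℤ B} (hTO : ∀ t ∈ T, t ∈ O)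
    (hTl : ∀ o ∈ O, ∀ t ∈ T, o * t ∈ T) (hTr : ∀ t ∈ T, ∀ o ∈ O, t * o ∈ T) {n : ℕ}
    (hn : n ≠ 0) (hnT : (n : B) ∈ T) (hT : ∀ x : B, (∀ t ∈ T, x * t ∈ O) → x ∈ O) :
    (1 : B) ∈ T := by
  -- The property is multiplicative in m: 1 = t + a o and 1 = s + b o' give 1 = (t + a o s) + a b o
  -- o'. So the prime case suffices, and m = n leads back to T because n ∈ T.
  have hadd : ∀ m : ℕ, m ≠ 0 → (1 : B) ∈ T ⊔ scaled m (Subalgebra.toSubmodule O) := by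
    intro m
    induction m using Nat.recOnMul with
    | zero => exact fun h => absurd rfl h
    | one => exact fun _ => Submodule.mem_sup_right (mem_scaled.2 ⟨1, one_mem O, by simp⟩)
    | prime p hp =>
      intro _
      refine one_mem_of_prime_mem hO (fun t ht => ?_) (fun o ho t ht => ?_) (fun t ht o ho => ?_) hp
        (Submodule.mem_sup_right (mem_scaled.2 ⟨1, one_mem O, mul_one _⟩))
        fun x hx => hT x fun t ht => hx t (Submodule.mem_sup_left ht)
      · obtain ⟨a, ha, b, hb, rfl⟩ := Submodule.mem_sup.1 ht
        exact O.add_mem (hTO a ha) (scaled_le p _ hb)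
      · obtain ⟨a, ha, b, hb, rfl⟩ := Submodule.mem_sup.1 ht
        rw [mul_add]
        exact Submodule.add_mem_sup (hTl o ho a ha) (mul_mem_scaled_left ho hb)
      · obtain ⟨a, ha, b, hb, rfl⟩ := Submodule.mem_sup.1 ht
        rw [add_mul]
        exact Submodule.add_mem_sup (hTr a ha o ho) (mul_mem_scaled_right ho hb)
    | mul a b iha ihb =>
      intro hab
      obtain ⟨t, ht, u, hu, htu⟩ := Submodule.mem_sup.1 (iha (left_ne_zero_of_mul hab))
      obtain ⟨s, hs, v, hv, hsv⟩ := Submodule.mem_sup.1 (ihb (right_ne_zero_of_mul hab))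
      obtain ⟨o, ho, rfl⟩ := mem_scaled.1 hu
      obtain ⟨o', ho', rfl⟩ := mem_scaled.1 hv
      refine Submodule.mem_sup.2 ⟨t + (a : B) * o * s,
        add_mem ht (hTl _ (O.mul_mem (natCast_mem O a) ho) s hs), (a * b : ℕ) * (o * o'),
        natCast_mul_mem_scaled (O.mul_mem ho ho'), ?_⟩
      have e : ((a * b : ℕ) : B) * (o * o') = (a : B) * o * ((b : B) * o') := by
        rw [Nat.cast_mul, mul_assoc, mul_assoc, ← mul_assoc o, ← (Nat.cast_commute b o).eq, mul_assoc]
      rw [e, add_assoc, ← mul_add, hsv, mul_one, htu]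
  obtain ⟨t, ht, u, hu, htu⟩ := Submodule.mem_sup.1 (hadd n hn)
  obtain ⟨o, ho, rfl⟩ := mem_scaled.1 hu
  rw [← htu]
  exact add_mem ht (hTr _ hnT o ho)

theorem isLattice_leftInverse (hO : IsOrder O) {I : Submodule ℤ B}
    (hI : Submodule.IsLattice ℚ I) : Submodule.IsLattice ℚ (leftInverse O I) := by
  have hfg : (leftInverse O I).FG := by
    obtain ⟨y, hy, hy0⟩ := exists_ne_zero_of_isLattice hI
    refine Submodule.fg_of_fg_map_injective (LinearMap.mulRight ℤ y)
      (fun a b hab => mul_right_cancel₀ hy0 hab) (hO.fg.of_le ?_)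
    rintro _ ⟨x, hx, rfl⟩
    exact hx y hy
  obtain ⟨n, hn, h⟩ := exists_natCast_mul_mul_mem hI.fg hO 1
  refine isLattice_of_natCast_mul_mem hO hfg hn fun o ho y hy => ?_
  have := O.mul_mem ho (h y hy)
  rwa [one_mul, ← mul_assoc, ← (Nat.cast_commute n o).eq] at this

/-- Right lattices over a maximal order are left invertible. -/
theorem one_mem_leftInverse_mul (hO : IsMaximalOrder O) {I : Submodule ℤ B}
    (hI : Submodule.IsLattice ℚ I) (hr : ∀ x ∈ I, ∀ o ∈ O, x * o ∈ I) :
    (1 : B) ∈ leftInverse O I * I := by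
  have hJ := isLattice_leftInverse hO.1 hI
  obtain ⟨n, hn, hnT⟩ := exists_natCast_mul_mem (isLattice_mul hJ hI) 1
  rw [mul_one] at hnT
  refine one_mem_of_natCast_mem hO (leftInverse_mul_le O I) ?_ ?_ hn hnT ?_
  · intro o ho t ht
    induction ht using Submodule.mul_induction_on' with
    | mem_mul_mem a ha b hb =>
      rw [← mul_assoc]; exact Submodule.mul_mem_mul (mul_mem_leftInverse ho ha) hb
    | add a _ b _ ha hb => rw [mul_add]; exact add_mem ha hb
  · intro t ht o ho
    induction ht using Submodule.mul_induction_on' with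
    | mem_mul_mem a ha b hb => rw [mul_assoc]; exact Submodule.mul_mem_mul ha (hr b hb o ho)
    | add a _ b _ ha hb => rw [add_mul]; exact add_mem ha hb
  -- With J the left inverse lattice, x J I ⊆ O means x J ⊆ J, so x lies in the left order of J,
  -- which is O.
  · intro x hx
    refine hO.mem_of_stable hJ (fun o ho j hj => mul_mem_leftInverse ho hj) fun j hj y hy => ?_
    rw [mul_assoc]
    exact hx _ (Submodule.mul_mem_mul hj hy)

/-- Lattices with maximal left and right orders are right invertible. -/
theorem one_mem_mul_leftInverse (hO : IsMaximalOrder O) {O' : Subalgebra ℤ B}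
    (hO' : IsMaximalOrder O') {I : Submodule ℤ B} (hI : Submodule.IsLattice ℚ I)
    (hr : ∀ x ∈ I, ∀ o ∈ O, x * o ∈ I) (hl : ∀ o ∈ O', ∀ x ∈ I, o * x ∈ I) :
    (1 : B) ∈ I * leftInverse O I := by
  -- Conjugation makes I a right lattice over O', which is left invertible; conjugating back
  -- exchanges the two factors.
  have h1 := one_mem_leftInverse_mul hO' (isLattice_conjLattice hI) fun x hx o ho =>
    mem_conjLattice.2 (by rw [DefiniteQuaternion.conj_mul]; exact hl _ (hO'.conj_mem ho) _ hx)
  have key : ∀ z ∈ leftInverse O' (conjLattice I) * conjLattice I,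
      conj z ∈ I * leftInverse O I := by
    intro z hz
    induction hz using Submodule.mul_induction_on' with
    | mem_mul_mem x hx y hy =>
      rw [DefiniteQuaternion.conj_mul]
      refine Submodule.mul_mem_mul hy fun i hi => ?_
      refine hO.mem_of_stable_right hI hr fun m hm => ?_
      have h2 := hO'.conj_mem (hx (conj m) (mem_conjLattice.2 (by rwa [conj_conj])))
      rw [DefiniteQuaternion.conj_mul, conj_conj] at h2
      rw [← mul_assoc]
      exact hl _ h2 i hi
    | add a _ b _ ha hb => rw [map_add]; exact add_mem ha hb
  have := key 1 h1
  rwa [conj_one] at this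

/-- The ideal of a lattice with maximal left and right orders. -/
def InvRightIdeal.ofMaximal (hO : IsMaximalOrder O) {O' : Subalgebra ℤ B}
    (hO' : IsMaximalOrder O') (I : Submodule ℤ B) (hI : Submodule.IsLattice ℚ I)
    (hr : ∀ x ∈ I, ∀ o ∈ O, x * o ∈ I) (hl : ∀ o ∈ O', ∀ x ∈ I, o * x ∈ I) : InvRightIdeal O where
  carrier := I
  isLattice := hI
  mul_right := le_antisymm (Submodule.mul_le.2 hr) fun x hx => by
    simpa using Submodule.mul_mem_mul hx (show (1 : B) ∈ Subalgebra.toSubmodule O from one_mem O)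
  exists_inv := by
    refine ⟨leftInverse O I, isLattice_leftInverse hO.1 hI,
      le_antisymm (leftInverse_mul_le O I) fun o ho => ?_, le_antisymm ?_ fun x hx => ?_⟩
    · have h1 := Submodule.mul_mem_mul (show o ∈ Subalgebra.toSubmodule O from ho)
        (one_mem_leftInverse_mul hO hI hr)
      rw [mul_one, ← mul_assoc] at h1
      refine (mul_le_mul' (Submodule.mul_le.2 fun a ha b hb => mul_mem_leftInverse ha hb) le_rfl :
        Subalgebra.toSubmodule O * leftInverse O I * I ≤ leftInverse O I * I) h1
    · rw [Submodule.mul_le]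
      intro a ha b hb y hy
      rw [mul_assoc]
      exact hr a ha _ (hb y hy)
    · have key : ∀ z ∈ I * leftInverse O I, x * z ∈ I * leftInverse O I := by
        intro z hz
        induction hz using Submodule.mul_induction_on' with
        | mem_mul_mem a ha b hb => rw [← mul_assoc]; exact Submodule.mul_mem_mul (hx a ha) hb
        | add a _ b _ ha hb => rw [mul_add]; exact add_mem ha hb
      simpa using key 1 (one_mem_mul_leftInverse hO hO' hI hr hl)

end Invertible

end BrandtZeroes

namespace BrandtZeroes

/-! ### Closed paths of parity `-1` from quadratic elements -/

section Converse
open DefiniteQuaternion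
variable {B : Type*} [Ring B] [Algebra ℚ B] [DefiniteQuaternion B] {O : Subalgebra ℤ B} {N : ℕ}

/-- An element with an integral square lies in some maximal order. -/
theorem exists_isMaximalOrder_mem (hO : IsOrder O) {b : B} {D : ℤ}
    (hb : b * b = algebraMap ℚ B (D : ℚ)) : ∃ O' : Subalgebra ℤ B, IsMaximalOrder O' ∧ b ∈ O' := by
  -- As b² is the integer D, b maps O + b O into itself, so the left order of this lattice contains
  -- b.
  set M : Submodule ℤ B :=
    Subalgebra.toSubmodule O ⊔ Submodule.span ℤ {b} * Subalgebra.toSubmodule O with hM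
  have hfg : M.FG := hO.fg.sup ((Submodule.fg_span_singleton b).mul hO.fg)
  have hlat : Submodule.IsLattice ℚ M := isLattice_of_le hO le_sup_left hfg
  have h1 : (1 : B) ∈ M := Submodule.mem_sup_left (one_mem O)
  have hbM : b ∈ leftRing M := by
    intro m hm
    obtain ⟨x, hx, y, hy, rfl⟩ := Submodule.mem_sup.1 hm
    obtain ⟨o, ho, rfl⟩ := Submodule.mem_span_singleton_mul.1 hy
    rw [mul_add, ← mul_assoc, hb, map_intCast, add_comm]
    exact Submodule.add_mem_sup (O.mul_mem (intCast_mem O D) ho)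
      (Submodule.mem_span_singleton_mul.2 ⟨x, hx, rfl⟩)
  have hord : IsOrder (leftRing M) := by
    refine ⟨hfg.of_le fun x hx => by simpa using hx 1 h1, ?_⟩
    rw [eq_top_iff]
    intro x _
    obtain ⟨n, hn, h⟩ := exists_natCast_mul_mul_mem hfg hlat x
    rw [← inv_smul_natCast_mul hn x]
    refine Submodule.smul_mem _ _ (Submodule.subset_span fun m hm => ?_)
    rw [mul_assoc]
    exact h m hm
  obtain ⟨O', hO', hle⟩ := hord.exists_le_isMaximalOrder
  exact ⟨O', hO', hle hbM⟩

/-- For `d ∣ N` there is a path of parity `ε_d` from `x` to `x Q`, where `Q² = d O`. -/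
theorem exists_signedPath (hO : IsMaximalOrder O) (hN : HasDiscriminant B N) (ε : SignPattern N)
    {d : ℕ} (hd : d ∣ N)
    (hP : ∀ p : ℕ, p.Prime → p ∣ d → ∃ P : InvTwoSidedIdeal O, IsPrimeAbove p P) :
    ∃ Q : InvTwoSidedIdeal O, Q.carrier * Q.carrier = scaled d (Subalgebra.toSubmodule O) ∧
      ∀ x : RightClassSet O, SignedPath ε x (x.mul Q) (ε ⟨d, hd⟩) := by
  induction d using induction_on_primes with
  | zero => exact absurd (zero_dvd_iff.1 hd) hN.1.ne_zero
  | one =>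
    refine ⟨InvTwoSidedIdeal.unit hO.1, ?_, fun x => ?_⟩
    · change Subalgebra.toSubmodule O * Subalgebra.toSubmodule O = _
      rw [toSubmodule_mul_self, scaled, Nat.cast_one, ← Submodule.one_eq_span, one_mul]
    · rw [RightClassSet.mul_unit, ε.apply_one]
      exact SignedPath.nil x
  | prime_mul p a hp ih =>
    have hpN : p ∣ N := (Dvd.intro a rfl).trans hd
    have haN : a ∣ N := (Dvd.intro_left p rfl).trans hd
    have hcop : p.Coprime a := by
      rw [hp.coprime_iff_not_dvd]
      rintro ⟨f, rfl⟩
      exact hp.one_lt.ne' (Nat.isUnit_iff.1 (hN.1 p (dvd_trans ⟨f, by ring⟩ hd)))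
    obtain ⟨P, hPp⟩ := hP p hp (Dvd.intro a rfl)
    obtain ⟨Q, hQ, hpath⟩ := ih haN fun q hq hqa => hP q hq (hqa.mul_left p)
    have hram : ∀ {e : ℕ}, e ∣ N → ∀ (q : ℕ) [Fact q.Prime], q ∣ e → IsRamifiedOver ℚ_[q] B :=
      fun he q _ hq => (hN.2 q).1 (hq.trans he)
    have hN0 : ∀ {e : ℕ}, e ∣ N → e ≠ 0 := fun he => ne_zero_of_dvd_ne_zero hN.1.ne_zero he
    have hPO := fun x hx => ((mem_iff_of_mul_self_eq hO hp.ne_zero (hram hpN) hPp x).1 hx).1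
    have hQO := fun x hx => ((mem_iff_of_mul_self_eq hO (hN0 haN) (hram haN) hQ x).1 hx).1
    have hcomm : Q.carrier * P.carrier = P.carrier * Q.carrier := by
      rw [mul_eq_inf_of_coprime P Q hcop hPp hQ hPO hQO,
        mul_eq_inf_of_coprime Q P hcop.symm hQ hPp hQO hPO, inf_comm]
    refine ⟨P.mul Q, ?_, fun x => ?_⟩
    · change P.carrier * Q.carrier * (P.carrier * Q.carrier) = _
      rw [mul_assoc, ← mul_assoc Q.carrier, hcomm, mul_assoc P.carrier, ← mul_assoc P.carrier P.carrier,
        hQ, show P.carrier * P.carrier = scaled p _ from hPp, scaled_mul, mul_scaled, scaled_scaled,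
        toSubmodule_mul_self]
    · rw [ε.map_mul ⟨p, hpN⟩ ⟨a, haN⟩ ⟨p * a, hd⟩ hcop rfl, ← RightClassSet.mul_mul]
      exact SignedPath.cons hp hpN P hPp x (hpath (x.mul P))

/-- If `B` contains `√-d`, then some class is fixed by the two-sided ideal with square `d O`. -/
theorem exists_mul_eq_self (hO : IsMaximalOrder O) (hN : HasDiscriminant B N) {d : ℕ} (hd : d ∣ N)
    {b : B} (hb : b * b = algebraMap ℚ B ((-(d : ℤ) : ℤ) : ℚ)) {Q : InvTwoSidedIdeal O}
    (hQ : Q.carrier * Q.carrier = scaled d (Subalgebra.toSubmodule O)) :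
    ∃ x : RightClassSet O, x.mul Q = x := by
  have hd0 : d ≠ 0 := ne_zero_of_dvd_ne_zero hN.1.ne_zero hd
  have hmem := mem_iff_of_mul_self_eq hO hd0 (fun q _ hq => (hN.2 q).1 (hq.trans hd)) hQ
  have hnb := nrd_eq_of_mul_self hd0 hb
  have hb0 : b ≠ 0 := by
    rintro rfl
    rw [nrd_zero] at hnb
    exact hd0 (by exact_mod_cast hnb.symm)
  obtain ⟨O', hO', hbO'⟩ := exists_isMaximalOrder_mem hO.1 hb
  -- The connecting lattice O' O is stable under O' ∋ b on the left and O on the right; its class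
  -- will be the fixed one.
  obtain ⟨L, hLlat, hr, hl⟩ : ∃ L : Submodule ℤ B, Submodule.IsLattice ℚ L ∧
      (∀ x ∈ L, ∀ o ∈ O, x * o ∈ L) ∧ ∀ o ∈ O', ∀ x ∈ L, o * x ∈ L := by
    refine ⟨Subalgebra.toSubmodule O' * Subalgebra.toSubmodule O, isLattice_mul hO'.1 hO.1,
      fun x hx o ho => ?_, fun o ho x hx => ?_⟩
    · have := Submodule.mul_mem_mul hx (show o ∈ Subalgebra.toSubmodule O from ho)
      rwa [mul_assoc, toSubmodule_mul_self] at this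
    · have := Submodule.mul_mem_mul (show o ∈ Subalgebra.toSubmodule O' from ho) hx
      rwa [← mul_assoc, toSubmodule_mul_self] at this
  let I := InvRightIdeal.ofMaximal hO hO' L hLlat hr hl
  -- For j in the inverse of L, j b y lies in O and its norm is d nrd(j y), so it lies in Q. Now
  -- expand 1 in L times its inverse.
  have hle : ∀ y ∈ L, b * y ∈ L * Q.carrier := by
    intro y hy
    have hby := hl b hbO' y hy
    have key : ∀ t ∈ L * leftInverse O L, t * (b * y) ∈ L * Q.carrier := by
      intro t ht
      induction ht using Submodule.mul_induction_on' with
      | mem_mul_mem i hi j hj =>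
        rw [mul_assoc]
        refine Submodule.mul_mem_mul hi ((hmem _).2 ⟨hj _ hby, ?_⟩)
        obtain ⟨z, hz⟩ := hO.1.nrd_mem (hj y hy)
        rw [eq_intCast] at hz
        refine ⟨z, ?_⟩
        rw [nrd_mul, nrd_mul, hnb, hz, nrd_mul]
        ring
      | add u _ v _ hu hv => rw [add_mul]; exact add_mem hu hv
    simpa using key 1 (one_mem_mul_leftInverse hO hO' hLlat hr hl)
  -- By the previous inclusion b L Q ⊆ L Q² = d L, and since d = -b² one may cancel b.
  have hge : ∀ t ∈ L * Q.carrier, ∃ z ∈ L, b * z = t := by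
    intro t ht
    have h1 : b * t ∈ scaled d L := by
      have h2 : b * t ∈ L * Q.carrier * Q.carrier := by
        induction ht using Submodule.mul_induction_on' with
        | mem_mul_mem i hi q hq => rw [← mul_assoc]; exact Submodule.mul_mem_mul (hle i hi) hq
        | add u _ v _ hu hv => rw [mul_add]; exact add_mem hu hv
      rwa [mul_assoc, hQ, mul_scaled, show L * _ = L from I.mul_right] at h2
    obtain ⟨z, hz, hzt⟩ := mem_scaled.1 h1
    refine ⟨-z, neg_mem hz, mul_left_cancel₀ hb0 ?_⟩
    rw [← mul_assoc, hb, map_intCast, Int.cast_neg, Int.cast_natCast, neg_mul_neg]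
    exact hzt
  refine ⟨Quotient.mk _ I, Eq.symm (Quotient.sound ?_)⟩
  obtain ⟨u, hu⟩ := isUnit_of_ne_zero hb0
  refine ⟨u, ?_⟩
  change L * Q.carrier = Submodule.span ℤ {(u : B)} * L
  rw [hu]
  ext t
  rw [Submodule.mem_span_singleton_mul]
  exact ⟨hge t, by rintro ⟨z, hz, rfl⟩; exact hle z hz⟩

/-- If `B` contains `√-d`, where `d ∣ N` and `ε_d = -1`, then `ε` has a trivial zero. -/
theorem exists_isTrivialZero (hO : IsMaximalOrder O) (hN : HasDiscriminant B N) {ε : SignPattern N}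
    {d : ℕ} (hd : d ∣ N) (hε : ε ⟨d, hd⟩ = -1) {b : B}
    (hb : b * b = algebraMap ℚ B ((-(d : ℤ) : ℤ) : ℚ)) :
    ∃ x : RightClassSet O, IsTrivialZero ε x := by
  obtain ⟨Q, hQ, hpath⟩ := exists_signedPath hO hN ε hd fun p hp hpd => by
    have := Fact.mk hp
    exact exists_isPrimeAbove hO ((hN.2 p).1 (hpd.trans hd)) hpd (fun h =>
      hp.one_lt.ne' (Nat.isUnit_iff.1 (hN.1 p (h.trans hd)))) hb
  obtain ⟨x, hx⟩ := exists_mul_eq_self hO hN hd hb hQ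
  refine ⟨x, fun hadm => hadm x ⟨InvTwoSidedIdeal.unit hO.1, RightClassSet.mul_unit hO.1 x⟩ ?_⟩
  have := hpath x
  rwa [hx, hε] at this

end Converse

end BrandtZeroes

/-! ### The criterion for trivial zeroes -/

open BrandtZeroes in
theorem proposition3p6 {B : Type*} [Ring B] [Algebra ℚ B]
    (hB : BrandtZeroes.IsQuaternionAlgebra ℚ B) (hdef : BrandtZeroes.IsDefinite B)
    (N : ℕ) (hN : BrandtZeroes.HasDiscriminant B N) (hodd : Odd N)
    (O : Subalgebra ℤ B) (hO : BrandtZeroes.IsMaximalOrder O)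
    (ε : BrandtZeroes.SignPattern N) (hε : ε ≠ BrandtZeroes.SignPattern.plus N) :
    BrandtZeroes.HasNoTrivialZeroes O ε ↔
      (∀ (d : ℕ) (hd : d ∣ N), d ∈ BrandtZeroes.inertDivisors N → ε ⟨d, hd⟩ = 1) ∧
      (∀ h3 : 3 ∣ N, ε ⟨3, h3⟩ = 1 ∨ ∃ p : ℕ, p.Prime ∧ p ∣ N ∧ p ≡ 1 [MOD 3]) := by
  obtain ⟨a, b, ha, hb, ⟨e⟩⟩ := exists_negative_presentation hB hdef
  let _ : DefiniteQuaternion B :=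
    DefiniteQuaternion.ofEquiv e (by exact_mod_cast ha) (by exact_mod_cast hb)
  constructor
  · intro h
    have hS : ∀ (d : ℕ) (hd : d ∣ N), d ∈ inertDivisors N → ε ⟨d, hd⟩ = 1 := by
      intro d hd hdS
      refine (Int.units_eq_one_or _).resolve_right fun hneg => ?_
      have hdpos : 0 < d := Nat.pos_of_ne_zero (ne_zero_of_dvd_ne_zero hN.1.ne_zero hd)
      obtain ⟨x, hx⟩ := exists_mul_self_eq e ha hb hN hodd (D := -(d : ℤ)) (by omega)
        fun p hp hpN => not_isLocalSquare_of_mem_inertDivisors hN.1 hodd hdS hp hpN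
      obtain ⟨y, hy⟩ := exists_isTrivialZero hO hN hd hneg hx
      exact h y hy
    refine ⟨hS, fun h3 => ?_⟩
    by_contra! hcon
    exact hcon.1 (hS 3 h3 (three_mem_inertDivisors hN.1 hodd h3 fun p hp hpN => hcon.2 p hp hpN))
  · rintro ⟨hS, -⟩ x hx
    refine hx fun y _ hy => ?_
    obtain ⟨d, hd, hd1, hneg, c, hc⟩ := exists_mul_self_eq_of_closedPath hO hN hodd hy
    have hd0 : d ≠ 0 := ne_zero_of_dvd_ne_zero hN.1.ne_zero hd
    -- At p ∣ N/d, which is odd and prime to d, B is a division algebra containing √-d, so -d is a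
    -- nonsquare modulo p.
    have hdS : d ∈ inertDivisors N := by
      rw [mem_inertDivisors_iff hN.1 hodd]
      refine ⟨hd, by omega, fun p hp hpN => ?_⟩
      have := Fact.mk hp
      have hpN' : p ∣ N := hpN.trans (Nat.div_dvd_of_dvd hd)
      refine jacobiSym_eq_neg_one_of_mul_self ((hN.2 p).1 hpN') ?_ (by omega) ?_ hc
      · rintro rfl
        exact Nat.not_even_iff_odd.2 hodd (even_iff_two_dvd.2 hpN')
      · rw [dvd_neg, Int.natCast_dvd_natCast]
        intro hpd
        refine hp.one_lt.ne' (Nat.isUnit_iff.1 (hN.1 p ?_))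
        have := mul_dvd_mul hpd hpN
        rwa [Nat.mul_div_cancel' hd] at this
    rw [hS d hd hdS] at hneg
    exact absurd hneg (by decide)
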